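/- Let $K$ be a non-Archimedean field (the absolute value may be trivial). Let $N$ be a finitely generated free abelian group, $M=\mathrm{Hom}(N,\mathbb Z)$, and let $S=(\Delta_{ij})_{i,j\in I}$, $I$ finite, be a system of fans in $N_{\mathbb R}$: the $\Delta_{ij}$ are rational polyhedral fans with $\Delta_{ij}=\Delta_{ji}$, and $\Delta_{ij}\cap\Delta_{jk}$ is a subfan of $\Delta_{ik}$. Let $\Omega(S)$ be the set of classes $[\sigma,i]$ of pairs with $\sigma\in\Delta_{ii}$, where $(\sigma,i)\sim(\tau,j)$ iff $\sigma=\tau\in\Delta_{ij}$, ordered by $[\tau,j]\preceq[\sigma,i]$ iff $\tau$ is a face of $\sigma$ and $[\tau,i]=[\tau,j]$. Put $S_\sigma=\sigma^\vee\cap M$ and $\overline{\mathbb R}=\mathbb R\cup\{\infty\}$. The toric prevariety $X=X(S)$ over $K$ is the $K$-scheme glued from the affine toric varieties $U_{[\sigma,i]}=\mathrm{Spec}\,K[S_\sigma]$ along the open immersions $U_{[\tau,j]}\to U_{[\sigma,i]}$ for $[\tau,j]\preceq[\sigma,i]$; the space $X^{\mathrm{trop}}$ is glued in the same way from the spaces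 $U_{[\sigma,i]}^{\mathrm{trop}}=\mathrm{Hom}(S_\sigma,\overline{\mathbb R})$ (with the topology of pointwise convergence). Let $X^{\mathrm{an}}$ be the underlying topological space of the Berkovich analytification of $X$. A morphism $(F,\mathfrak f)\colon S\to S'$ of systems of fans consists of a homomorphism $F\colon N\to N'$ and an order preserving map $\mathfrak f\colon\Omega(S)\to\Omega(S')$ such that $F_{\mathbb R}(\sigma)\subseteq\sigma'$ whenever $\mathfrak f([\sigma,i])=[\sigma',i']$; it induces a toric morphism $f\colon X(S)\to X(S')$ and a map $f^{\mathrm{trop}}\colon X(S)^{\mathrm{trop}}\to X(S')^{\mathrm{trop}}$. (i) There is a unique map $\mathrm{trop}_X\colon X^{\mathrm{an}}\to X^{\mathrm{trop}}$ whose restriction to $U_{[\sigma,i]}^{\mathrm{an}}$ is, for each $[\sigma,i]\in\Omega(S)$, the map $U_{[\sigma,i]}^{\mathrm{an}}\to U_{[\sigma,i]}^{\mathrm{trop}}$, $x\mapsto(s\mapsto-\log|\chi^s|_x)$. It is continuous and proper: it is universally closed, and preimages of compact (that is, quasi-compact and Hausdorff) subsets are compact. (ii) For a toric morphism $f\colon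 X\to X'$ induced by a morphism of systems of fans, $\mathrm{trop}_{X'}\circ f^{\mathrm{an}}=f^{\mathrm{trop}}\circ\mathrm{trop}_X$. (iii) There is a continuous section $J_X\colon X^{\mathrm{trop}}\to X^{\mathrm{an}}$ of $\mathrm{trop}_X$ which sends $u\in\mathrm{Hom}(S_\sigma,\overline{\mathbb R})=U_{[\sigma,i]}^{\mathrm{trop}}$ to the multiplicative seminorm $\sum_s a_s\chi^s\mapsto\sup_s|a_s|e^{-u(s)}$ on $K[S_\sigma]$. Its image $\Sigma(X^{\mathrm{an}})$ is closed in $X^{\mathrm{an}}$ and $J_X$ is a homeomorphism onto it, and $J_X\circ\mathrm{trop}_X$ is a strong deformation retraction of $X^{\mathrm{an}}$ onto $\Sigma(X^{\mathrm{an}})$. (iv) Let $T=\mathrm{Spec}\,K[M]$ be the big torus and $T^\circ=\{t\in T^{\mathrm{an}}: |\chi^m|_t=1\text{ for all }m\in M\}$. Let $|[X^{\mathrm{an}}/T^\circ]|$ be the underlying topological space of the analytic stack quotient, that is, the topological colimit (quotient space) of the groupoid $T^\circ\times X^{\mathrm{an}}\rightrightarrows X^{\mathrm{an}}$ given by the action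 and the projection, where $T^\circ\times X^{\mathrm{an}}$ is the product of analytic spaces. Then there is a homeomorphism $\mu_X\colon|[X^{\mathrm{an}}/T^\circ]|\to X^{\mathrm{trop}}$ whose composite with the projection $X^{\mathrm{an}}\to|[X^{\mathrm{an}}/T^\circ]|$ is $\mathrm{trop}_X$. -/

import Mathlib

universe u

noncomputable section

open CategoryTheory CategoryTheory.Limits AlgebraicGeometry TopologicalSpace
open scoped TensorProduct

namespace ToricTrop

/-! ### Cones, fans and systems of fans -/

section Cones

variable (N : Type u) [AddCommGroup N]

/-- The dual lattice `M = Hom(N, ℤ)`. -/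
abbrev DualLattice : Type u := N →ₗ[ℤ] ℤ

/-- The real vector space `N_ℝ = N ⊗ ℝ`. -/
abbrev RealSpace : Type u := ℝ ⊗[ℤ] N

variable {N}

/-- The linear form on `N_ℝ` extending `m ∈ M`. -/
def pairing (m : DualLattice N) : RealSpace N →ₗ[ℝ] ℝ :=
  (TensorProduct.AlgebraTensorModule.rid ℤ ℝ ℝ).toLinearMap ∘ₗ m.baseChange ℝ

/-- A convex cone generated by finitely many lattice vectors. -/
def IsRationalPolyhedral (σ : PointedCone ℝ (RealSpace N)) : Prop :=
  ∃ s : Finset N, σ = PointedCone.hull ℝ ((fun n : N => (1 : ℝ) ⊗ₜ[ℤ] n) '' (s : Set N))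

/-- The monoid `S_σ = σ^∨ ∩ M`. -/
def dualMonoid (σ : PointedCone ℝ (RealSpace N)) : AddSubmonoid (DualLattice N) where
  carrier := {m | ∀ v ∈ σ, 0 ≤ pairing m v}
  zero_mem' := by
    intro v _
    simp [pairing]
  add_mem' := by
    intro a b ha hb v hv
    have h1 := ha v hv
    have h2 := hb v hv
    have : pairing (a + b) v = pairing a v + pairing b v := by
      simp [pairing, LinearMap.baseChange_add]
    rw [this]
    exact add_nonneg h1 h2

/-- `τ` is a face of `σ`: `τ = σ ∩ m^⊥` for some `m ∈ σ^∨ ∩ M`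
(for a rational polyhedral cone these are all its faces). -/
def IsFace (τ σ : PointedCone ℝ (RealSpace N)) : Prop :=
  ∃ m ∈ dualMonoid σ, ∀ v, v ∈ τ ↔ v ∈ σ ∧ pairing m v = 0

lemma pairing_add (a b : DualLattice N) (v : RealSpace N) :
    pairing (a + b) v = pairing a v + pairing b v := by
  simp [pairing, LinearMap.baseChange_add]

lemma pairing_zero (v : RealSpace N) : pairing (0 : DualLattice N) v = 0 := by
  simp [pairing]

lemma pairing_nsmul (n : ℕ) (a : DualLattice N) (v : RealSpace N) :
    pairing (n • a) v = n * pairing a v := by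
  induction n with
  | zero => simp [pairing_zero]
  | succ k ih => rw [succ_nsmul, pairing_add, ih]; push_cast; ring

lemma IsFace.le {τ σ : PointedCone ℝ (RealSpace N)} (h : IsFace τ σ) : τ ≤ σ := by
  obtain ⟨m, _, hm⟩ := h
  exact fun v hv => ((hm v).1 hv).1

lemma IsFace.refl (σ : PointedCone ℝ (RealSpace N)) : IsFace σ σ :=
  ⟨0, (dualMonoid σ).zero_mem, fun v => by simp [pairing_zero]⟩

lemma dualMonoid_anti {τ σ : PointedCone ℝ (RealSpace N)} (h : τ ≤ σ) :
    dualMonoid σ ≤ dualMonoid τ := fun _ hm v hv => hm v (h hv)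

/-- If `τ = σ ∩ m^⊥`, then every element of `S_τ` becomes an element of `S_σ` after adding a
multiple of `m`. -/
lemma exists_add_nsmul_mem {τ σ : PointedCone ℝ (RealSpace N)} (hσ : IsRationalPolyhedral σ)
    {m : DualLattice N} (hm : m ∈ dualMonoid σ) (hτ : ∀ v, v ∈ τ ↔ v ∈ σ ∧ pairing m v = 0)
    {w : DualLattice N} (hw : w ∈ dualMonoid τ) : ∃ n : ℕ, w + n • m ∈ dualMonoid σ := by
  obtain ⟨s, rfl⟩ := hσ
  have key : ∀ x ∈ s, ∃ n : ℕ, ∀ k ≥ n, 0 ≤ pairing (w + k • m) ((1 : ℝ) ⊗ₜ[ℤ] x) := by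
    intro x hx
    have hxσ : ((1 : ℝ) ⊗ₜ[ℤ] x) ∈
        PointedCone.hull ℝ ((fun n : N => (1 : ℝ) ⊗ₜ[ℤ] n) '' (s : Set N)) :=
      Submodule.subset_span ⟨x, hx, rfl⟩
    rcases (hm _ hxσ).eq_or_lt with h0 | h0
    · refine ⟨0, fun k _ => ?_⟩
      rw [pairing_add, pairing_nsmul, ← h0, mul_zero, add_zero]
      exact hw _ ((hτ _).2 ⟨hxσ, h0.symm⟩)
    · obtain ⟨n, hn⟩ := exists_nat_gt (-(pairing w ((1 : ℝ) ⊗ₜ[ℤ] x)) / pairing m ((1 : ℝ) ⊗ₜ[ℤ] x))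
      refine ⟨n, fun k hk => ?_⟩
      rw [pairing_add, pairing_nsmul]
      rw [div_lt_iff₀ h0] at hn
      have : (n : ℝ) * pairing m ((1 : ℝ) ⊗ₜ[ℤ] x) ≤ k * pairing m ((1 : ℝ) ⊗ₜ[ℤ] x) := by
        gcongr
      linarith
  choose! f hf using key
  refine ⟨s.sup f, fun v hv => ?_⟩
  induction hv using Submodule.span_induction with
  | mem x hx =>
    obtain ⟨y, hy, rfl⟩ := hx
    exact hf y hy _ (Finset.le_sup (f := f) hy)
  | zero => simp
  | add x y _ _ hx hy => rw [map_add]; exact add_nonneg hx hy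
  | smul a x _ hx =>
    have : a • x = (a : ℝ) • x := rfl
    rw [this, map_smul]
    exact mul_nonneg a.2 hx

lemma IsFace.trans {ρ τ σ : PointedCone ℝ (RealSpace N)} (hσ : IsRationalPolyhedral σ)
    (h₁ : IsFace ρ τ) (h₂ : IsFace τ σ) : IsFace ρ σ := by
  obtain ⟨w, hw, hρ⟩ := h₁
  obtain ⟨m, hm, hτ⟩ := h₂
  obtain ⟨n, hn⟩ := exists_add_nsmul_mem hσ hm hτ hw
  refine ⟨w + n • m + m, (dualMonoid σ).add_mem hn hm, fun v => ?_⟩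
  rw [hρ, hτ, pairing_add]
  constructor
  · rintro ⟨⟨hv, h0⟩, h1⟩
    refine ⟨hv, ?_⟩
    rw [pairing_add, pairing_nsmul, h0, h1]
    simp
  · rintro ⟨hv, h0⟩
    have a := hn v hv
    have b := hm v hv
    have hb : pairing m v = 0 := by linarith
    refine ⟨⟨hv, hb⟩, ?_⟩
    rw [pairing_add, pairing_nsmul, hb] at h0
    simpa using h0

/-- Two faces of `σ` cut out by `m₁` and `m₂` meet in the face cut out by `m₁ + m₂`. -/
lemma mem_inf_iff_of_faces {τ₁ τ₂ σ : PointedCone ℝ (RealSpace N)} {m₁ m₂ : DualLattice N}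
    (hm₁ : m₁ ∈ dualMonoid σ) (hm₂ : m₂ ∈ dualMonoid σ)
    (h₁ : ∀ v, v ∈ τ₁ ↔ v ∈ σ ∧ pairing m₁ v = 0)
    (h₂ : ∀ v, v ∈ τ₂ ↔ v ∈ σ ∧ pairing m₂ v = 0) (v : RealSpace N) :
    v ∈ τ₁ ⊓ τ₂ ↔ v ∈ σ ∧ pairing (m₁ + m₂) v = 0 := by
  rw [Submodule.mem_inf, h₁, h₂, pairing_add]
  constructor
  · rintro ⟨⟨hv, a⟩, _, b⟩
    exact ⟨hv, by rw [a, b, add_zero]⟩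
  · rintro ⟨hv, h⟩
    have a := hm₁ v hv
    have b := hm₂ v hv
    exact ⟨⟨hv, by linarith⟩, hv, by linarith⟩

end Cones

/-- A (rational polyhedral) fan in `N_ℝ`: a finite nonempty collection of strongly convex rational
polyhedral cones, closed under faces, any two of which meet in a common face. -/
structure Fan (N : Type u) [AddCommGroup N] where
  cones : Set (PointedCone ℝ (RealSpace N))
  finite : cones.Finite
  nonempty : cones.Nonempty
  rational : ∀ σ ∈ cones, IsRationalPolyhedral σ
  stronglyConvex : ∀ σ ∈ cones, ∀ v ∈ σ, -v ∈ σ → v = 0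
  face_mem : ∀ σ ∈ cones, ∀ τ, IsFace τ σ → τ ∈ cones
  inter_face : ∀ σ ∈ cones, ∀ τ ∈ cones, IsFace (σ ⊓ τ) σ ∧ IsFace (σ ⊓ τ) τ

/-- A system of fans in `N_ℝ`. (Given that `Δ i j` and `Δ j k` are fans, the collection
`Δ i j ∩ Δ j k` is a subfan of `Δ i k` as soon as it is contained in it.) -/
structure FanSystem (N : Type u) [AddCommGroup N] (I : Type u) where
  Δ : I → I → Fan N
  symm : ∀ i j, Δ i j = Δ j i
  inter_subset : ∀ i j k, (Δ i j).cones ∩ (Δ j k).cones ⊆ (Δ i k).cones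

namespace FanSystem

variable {N : Type u} [AddCommGroup N] {I : Type u} (S : FanSystem N I)

lemma mem_diag {i j : I} {σ : PointedCone ℝ (RealSpace N)} (h : σ ∈ (S.Δ i j).cones) :
    σ ∈ (S.Δ i i).cones := S.inter_subset i j i ⟨h, S.symm i j ▸ h⟩

/-- The pairs `(σ, i)` with `σ ∈ Δ i i`. -/
def PreChart : Type u := {p : PointedCone ℝ (RealSpace N) × I // p.1 ∈ (S.Δ p.2 p.2).cones}

/-- `(σ, i)` and `(τ, j)` are equivalent iff `σ = τ` and this cone lies in `Δ i j`. -/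
instance preChartSetoid : Setoid S.PreChart where
  r p q := p.1.1 = q.1.1 ∧ p.1.1 ∈ (S.Δ p.1.2 q.1.2).cones
  iseqv :=
    { refl := fun p => ⟨rfl, p.2⟩
      symm := fun {p q} h => ⟨h.1.symm, by rw [S.symm]; exact h.1 ▸ h.2⟩
      trans := fun {p q r} h h' =>
        ⟨h.1.trans h'.1, S.inter_subset _ q.1.2 _ ⟨h.2, by rw [h.1]; exact h'.2⟩⟩ }

/-- The set `Ω(S)` of equivalence classes `[σ, i]`. -/
def Chart : Type u := Quotient S.preChartSetoid

/-- The class `[σ, i]`. -/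
def Chart.mk (σ : PointedCone ℝ (RealSpace N)) (i : I) (h : σ ∈ (S.Δ i i).cones) : S.Chart :=
  Quotient.mk _ ⟨(σ, i), h⟩

variable {S}

/-- The cone `σ` of a class `[σ, i]`. -/
def Chart.cone (ω : S.Chart) : PointedCone ℝ (RealSpace N) :=
  Quotient.lift (fun p : S.PreChart => p.1.1) (fun p q (h : S.preChartSetoid.r p q) => h.1) ω

lemma Chart.mk_eq_mk {σ τ : PointedCone ℝ (RealSpace N)} {i j : I}
    {h : σ ∈ (S.Δ i i).cones} {h' : τ ∈ (S.Δ j j).cones} :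
    Chart.mk S σ i h = Chart.mk S τ j h' ↔ σ = τ ∧ σ ∈ (S.Δ i j).cones :=
  Quotient.eq (r := S.preChartSetoid)

lemma Chart.exists_rep (ω : S.Chart) : ∃ σ i h, ω = Chart.mk S σ i h := by
  obtain ⟨⟨⟨σ, i⟩, h⟩, rfl⟩ := Quotient.exists_rep ω
  exact ⟨σ, i, h, rfl⟩

@[simp] lemma Chart.cone_mk {σ : PointedCone ℝ (RealSpace N)} {i : I}
    (h : σ ∈ (S.Δ i i).cones) : (Chart.mk S σ i h).cone = σ := rfl

lemma Chart.rational (ω : S.Chart) : IsRationalPolyhedral ω.cone := by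
  obtain ⟨σ, i, h, rfl⟩ := ω.exists_rep
  exact (S.Δ i i).rational σ h

/-- `[τ, j] ⪯ [σ, i]` iff `τ` is a face of `σ` and `[τ, j] = [τ, i]`. -/
instance : PartialOrder S.Chart where
  le ω ω' := ∃ (τ σ : PointedCone ℝ (RealSpace N)) (i : I) (hτ : τ ∈ (S.Δ i i).cones)
    (hσ : σ ∈ (S.Δ i i).cones), IsFace τ σ ∧ ω = Chart.mk S τ i hτ ∧ ω' = Chart.mk S σ i hσ
  le_refl ω := by
    obtain ⟨σ, i, h, rfl⟩ := ω.exists_rep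
    exact ⟨σ, σ, i, h, h, IsFace.refl σ, rfl, rfl⟩
  le_trans := by
    rintro ω₁ ω₂ ω₃ ⟨ρ, τ, i, hρ, hτ, h, rfl, rfl⟩ ⟨τ', σ, j, hτ', hσ, h', e, rfl⟩
    obtain ⟨rfl, hij⟩ := Chart.mk_eq_mk.1 e
    refine ⟨ρ, σ, j, (S.Δ j j).face_mem _ hτ' _ h, hσ, h.trans ((S.Δ j j).rational _ hσ) h',
      Chart.mk_eq_mk.2 ⟨rfl, (S.Δ i j).face_mem _ hij _ h⟩, rfl⟩
  le_antisymm := by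
    rintro ω₁ ω₂ ⟨τ, σ, i, hτ, hσ, h, rfl, rfl⟩ ⟨σ', τ', j, hσ', hτ', h', e, e'⟩
    obtain ⟨rfl, hij⟩ := Chart.mk_eq_mk.1 e
    obtain ⟨rfl, hij'⟩ := Chart.mk_eq_mk.1 e'
    have : τ = σ := le_antisymm h.le h'.le
    subst this
    rfl

lemma Chart.isFace {ω ω' : S.Chart} (h : ω ≤ ω') : IsFace ω.cone ω'.cone := by
  obtain ⟨τ, σ, i, hτ, hσ, h, rfl, rfl⟩ := h
  exact h

lemma Chart.dualMonoid_le {ω ω' : S.Chart} (h : ω ≤ ω') :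
    dualMonoid ω'.cone ≤ dualMonoid ω.cone := dualMonoid_anti (Chart.isFace h).le

/-- Two elements below `ω` have a common lower bound whose cone is the intersection. -/
lemma Chart.exists_inf {ω₁ ω₂ ω : S.Chart} (h₁ : ω₁ ≤ ω) (h₂ : ω₂ ≤ ω) :
    ∃ ω₀, ω₀ ≤ ω₁ ∧ ω₀ ≤ ω₂ ∧ ω₀.cone = ω₁.cone ⊓ ω₂.cone := by
  obtain ⟨τ, σ, i, hτ, hσ, hf, rfl, rfl⟩ := h₁
  obtain ⟨τ', σ', j, hτ', hσ', hf', rfl, e⟩ := h₂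
  obtain ⟨rfl, hij⟩ := Chart.mk_eq_mk.1 e
  have hτ'' : τ' ∈ (S.Δ i i).cones := (S.Δ i i).face_mem _ hσ _ hf'
  have e' : Chart.mk S τ' j hτ' = Chart.mk S τ' i hτ'' :=
    Chart.mk_eq_mk.2 ⟨rfl, by rw [S.symm]; exact (S.Δ i j).face_mem _ hij _ hf'⟩
  obtain ⟨ha, hb⟩ := (S.Δ i i).inter_face _ hτ _ hτ''
  have h0 := (S.Δ i i).face_mem _ hτ _ ha
  refine ⟨Chart.mk S (τ ⊓ τ') i h0, ⟨_, _, i, h0, hτ, ha, rfl, rfl⟩,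
    ⟨_, _, i, h0, hτ'', hb, rfl, e'⟩, rfl⟩

end FanSystem

/-- A morphism of systems of fans. -/
structure FanSystem.Hom {N N' I I' : Type u} [AddCommGroup N] [AddCommGroup N']
    (S : FanSystem N I) (S' : FanSystem N' I') where
  toLin : N →ₗ[ℤ] N'
  onCharts : S.Chart → S'.Chart
  monotone : ∀ ω ω', ω ≤ ω' → onCharts ω ≤ onCharts ω'
  maps_cone : ∀ ω, ∀ v ∈ ω.cone, toLin.baseChange ℝ v ∈ (onCharts ω).cone

/-! ### Affine toric varieties -/

section Affine

variable (K : Type u) [Field K]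

/-- `Spec A` as a `K`-scheme. -/
def specOver (A : Type u) [CommRing A] [Algebra K A] : Over (Spec (CommRingCat.of K)) :=
  Over.mk (Spec.map (CommRingCat.ofHom (algebraMap K A)))

variable {K} in
/-- The morphism of `K`-schemes `Spec B ⟶ Spec A` given by `A →ₐ[K] B`. -/
def specOver.map {A B : Type u} [CommRing A] [Algebra K A] [CommRing B] [Algebra K B]
    (f : A →ₐ[K] B) : specOver K B ⟶ specOver K A :=
  Over.homMk (Spec.map (CommRingCat.ofHom f.toRingHom)) (by
    dsimp [specOver]
    rw [← Spec.map_comp, ← CommRingCat.ofHom_comp]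
    congr 2
    exact f.comp_algebraMap)

variable {N : Type u} [AddCommGroup N]

/-- The coordinate ring `K[S_σ]`. -/
abbrev coordRing (σ : PointedCone ℝ (RealSpace N)) : Type u := AddMonoidAlgebra K (dualMonoid σ)

/-- The character `χ^s ∈ K[S_σ]`. -/
abbrev chi {σ : PointedCone ℝ (RealSpace N)} (s : dualMonoid σ) : coordRing K σ :=
  AddMonoidAlgebra.single s 1

/-- For `τ ⊆ σ`, the inclusion `K[S_σ] → K[S_τ]`. -/
def restrictHom {τ σ : PointedCone ℝ (RealSpace N)} (h : τ ≤ σ) :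
    coordRing K σ →ₐ[K] coordRing K τ :=
  AddMonoidAlgebra.mapDomainAlgHom K K (AddSubmonoid.inclusion (dualMonoid_anti h))

lemma restrictHom_single {τ σ : PointedCone ℝ (RealSpace N)} (h : τ ≤ σ) (s : dualMonoid σ)
    (a : K) : restrictHom K h (AddMonoidAlgebra.single s a) =
      AddMonoidAlgebra.single (AddSubmonoid.inclusion (dualMonoid_anti h) s) a := by
  simp [restrictHom]

lemma restrictHom_refl (σ : PointedCone ℝ (RealSpace N)) :
    restrictHom K (le_refl σ) = AlgHom.id K _ := by
  refine AddMonoidAlgebra.algHom_ext (fun s => ?_) (by ext)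
  rw [restrictHom_single]
  rfl

lemma restrictHom_comp {ρ τ σ : PointedCone ℝ (RealSpace N)} (h : ρ ≤ τ) (h' : τ ≤ σ) :
    (restrictHom K h).comp (restrictHom K h') = restrictHom K (h.trans h') := by
  refine AddMonoidAlgebra.algHom_ext (fun s => ?_) (by ext)
  rw [AlgHom.comp_apply, restrictHom_single, restrictHom_single, restrictHom_single]
  rfl

lemma isUnit_chi {τ : PointedCone ℝ (RealSpace N)} (s : dualMonoid τ)
    (hs : ∀ v ∈ τ, pairing s.1 v = 0) : IsUnit (chi K s) := by
  have hn : -s.1 ∈ dualMonoid τ := by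
    intro v hv
    have h1 := pairing_add s.1 (-s.1) v
    rw [add_neg_cancel, pairing_zero, hs v hv] at h1
    linarith
  refine IsUnit.of_mul_eq_one (chi K ⟨-s.1, hn⟩) ?_
  rw [AddMonoidAlgebra.single_mul_single, AddMonoidAlgebra.one_def, mul_one]
  congr 1
  exact Subtype.ext (add_neg_cancel s.1)

/-- `K[S_τ]` is the localization of `K[S_σ]` at `χ^m` if `τ = σ ∩ m^⊥`. -/
lemma isLocalization_restrictHom {τ σ : PointedCone ℝ (RealSpace N)} (hσ : IsRationalPolyhedral σ)
    (m : dualMonoid σ) (hτ : ∀ v, v ∈ τ ↔ v ∈ σ ∧ pairing m.1 v = 0) (h : τ ≤ σ) :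
    letI := (restrictHom K h).toRingHom.toAlgebra
    IsLocalization.Away (chi K m) (coordRing K τ) := by
  let _ := (restrictHom K h).toRingHom.toAlgebra
  have hinj : Function.Injective (restrictHom K h) :=
    AddMonoidAlgebra.mapDomain_injective (AddSubmonoid.inclusion_injective _)
  have hmap : ∀ x, algebraMap (coordRing K σ) (coordRing K τ) x = restrictHom K h x := fun _ => rfl
  have hunit : IsUnit (restrictHom K h (chi K m)) := by
    rw [restrictHom_single]
    exact isUnit_chi K _ fun v hv => ((hτ v).1 hv).2
  refine IsLocalization.Away.mk _ ?_ ?_ ?_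
  · exact hunit
  · intro z
    induction z using AddMonoidAlgebra.induction_linear with
    | zero => exact ⟨0, 0, by simp⟩
    | add f g hf hg =>
      obtain ⟨n, a, ha⟩ := hf
      obtain ⟨k, b, hb⟩ := hg
      refine ⟨n + k, a * chi K m ^ k + b * chi K m ^ n, ?_⟩
      rw [hmap (chi K m), hmap] at ha hb
      rw [hmap, hmap, map_add, map_mul, map_mul, map_pow, map_pow, ← ha, ← hb]
      ring
    | single s a =>
      obtain ⟨n, hn⟩ := exists_add_nsmul_mem hσ m.2 hτ s.2
      refine ⟨n, AddMonoidAlgebra.single ⟨_, hn⟩ a, ?_⟩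
      rw [hmap, hmap, restrictHom_single, restrictHom_single, AddMonoidAlgebra.single_pow,
        AddMonoidAlgebra.single_mul_single, one_pow, mul_one]
      congr 1
  · intro a b hab
    exact ⟨0, by rw [hinj hab]⟩

end Affine

/-! ### Toric prevarieties -/

section Prevariety

variable (K : Type u) [Field K] {N : Type u} [AddCommGroup N] {I : Type u} (S : FanSystem N I)

/-- The affine toric variety `U_[σ, i] = Spec K[S_σ]` as a `K`-scheme. -/
abbrev chartScheme (ω : S.Chart) : Over (Spec (CommRingCat.of K)) := specOver K (coordRing K ω.cone)

variable {S} in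
/-- The open immersion `U_[τ, j] ⟶ U_[σ, i]` for `[τ, j] ⪯ [σ, i]`. -/
def chartTrans {ω ω' : S.Chart} (h : ω ≤ ω') : chartScheme K S ω ⟶ chartScheme K S ω' :=
  specOver.map (restrictHom K (FanSystem.Chart.isFace h).le)

lemma specOver.map_id (A : Type u) [CommRing A] [Algebra K A] :
    specOver.map (AlgHom.id K A) = 𝟙 (specOver K A) := by
  ext1
  exact Spec.map_id _

variable {K} in
lemma specOver.map_comp {A B C : Type u} [CommRing A] [Algebra K A] [CommRing B] [Algebra K B]
    [CommRing C] [Algebra K C] (g : B →ₐ[K] C) (f : A →ₐ[K] B) :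
    specOver.map (g.comp f) = specOver.map g ≫ specOver.map f := by
  ext1
  rw [Over.comp_left]
  exact Spec.map_comp (CommRingCat.ofHom f.toRingHom) (CommRingCat.ofHom g.toRingHom)

/-- The diagram of the affine toric varieties `U_[σ, i]`, `[σ, i] ∈ Ω(S)`. -/
def chartDiagramOver : S.Chart ⥤ Over (Spec (CommRingCat.of K)) where
  obj ω := chartScheme K S ω
  map h := chartTrans K (leOfHom h)
  map_id ω := by
    change specOver.map (restrictHom K le_rfl) = _
    rw [restrictHom_refl, specOver.map_id]
  map_comp h h' := by
    change specOver.map _ = specOver.map _ ≫ specOver.map _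
    rw [← specOver.map_comp, restrictHom_comp]

/-- The underlying diagram of schemes. -/
def chartDiagram : S.Chart ⥤ Scheme.{u} := chartDiagramOver K S ⋙ Over.forget _

instance {ω ω' : S.Chart} (h : ω ⟶ ω') : IsOpenImmersion ((chartDiagram K S).map h) := by
  obtain ⟨m, hm, hτ⟩ := FanSystem.Chart.isFace (leOfHom h)
  have hl := (FanSystem.Chart.isFace (leOfHom h)).le
  let _ := (restrictHom K hl).toRingHom.toAlgebra
  have := isLocalization_restrictHom K ω'.rational ⟨m, hm⟩ hτ hl
  exact IsOpenImmersion.of_isLocalization (S := coordRing K ω.cone) (chi K (⟨m, hm⟩ : dualMonoid ω'.cone))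

instance : (chartDiagram K S ⋙ Scheme.forget).IsLocallyDirected where
  cond {ω₁ ω₂ ω} f₁ f₂ x₁ x₂ hx := by
    obtain ⟨m₁, hm₁, hτ₁⟩ := FanSystem.Chart.isFace (leOfHom f₁)
    obtain ⟨m₂, hm₂, hτ₂⟩ := FanSystem.Chart.isFace (leOfHom f₂)
    have hl₁ := (FanSystem.Chart.isFace (leOfHom f₁)).le
    have hl₂ := (FanSystem.Chart.isFace (leOfHom f₂)).le
    obtain ⟨ω₀, h₁, h₂, hc⟩ := FanSystem.Chart.exists_inf (leOfHom f₁) (leOfHom f₂)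
    have hl := (FanSystem.Chart.isFace h₁).le
    have hm₂' : m₂ ∈ dualMonoid ω₁.cone := dualMonoid_anti hl₁ hm₂
    have hloc := isLocalization_restrictHom K ω₁.rational ⟨m₂, hm₂'⟩ (τ := ω₀.cone) (by
      intro v
      rw [hc, Submodule.mem_inf, hτ₂]
      exact ⟨fun h => ⟨h.1, h.2.2⟩, fun h => ⟨h.1, hl₁ h.1, h.2⟩⟩) hl
    let p₁ : PrimeSpectrum (coordRing K ω₁.cone) := x₁
    let p₂ : PrimeSpectrum (coordRing K ω₂.cone) := x₂
    have hp : PrimeSpectrum.comap (restrictHom K hl₁).toRingHom p₁ =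
      PrimeSpectrum.comap (restrictHom K hl₂).toRingHom p₂ := hx
    have hmem : chi K (⟨m₂, hm₂'⟩ : dualMonoid ω₁.cone) ∉ p₁.asIdeal := by
      intro hmem
      have h3 : chi K (⟨m₂, hm₂⟩ : dualMonoid ω.cone) ∈
          (PrimeSpectrum.comap (restrictHom K hl₁).toRingHom p₁).asIdeal := by
        change restrictHom K hl₁ _ ∈ p₁.asIdeal
        rw [restrictHom_single]
        exact hmem
      rw [hp] at h3
      change restrictHom K hl₂ _ ∈ p₂.asIdeal at h3
      rw [restrictHom_single] at h3
      exact p₂.isPrime.ne_top (Ideal.eq_top_of_isUnit_mem _ h3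
        (isUnit_chi K _ fun v hv => ((hτ₂ v).1 hv).2))
    let _ := (restrictHom K hl).toRingHom.toAlgebra
    have hr := PrimeSpectrum.localization_away_comap_range (coordRing K ω₀.cone)
      (chi K (⟨m₂, hm₂'⟩ : dualMonoid ω₁.cone))
    obtain ⟨y, hy⟩ : p₁ ∈ Set.range
        (PrimeSpectrum.comap (algebraMap (coordRing K ω₁.cone) (coordRing K ω₀.cone))) := by
      rw [hr]
      exact hmem
    let z : (chartDiagram K S).obj ω₀ := y
    have hy₁ : (chartDiagram K S).map (homOfLE h₁) z = x₁ := hy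
    refine ⟨ω₀, homOfLE h₁, homOfLE h₂, z, hy₁, ?_⟩
    change (chartDiagram K S).map (homOfLE h₂) z = x₂
    apply ((chartDiagram K S).map f₂).isOpenEmbedding.injective
    refine Eq.trans ?_ hx
    change _ = (chartDiagram K S).map f₁ x₁
    rw [← hy₁, ← Scheme.Hom.comp_apply, ← Scheme.Hom.comp_apply, ← Functor.map_comp,
      ← Functor.map_comp]
    rfl

/-- The toric prevariety `X(S)` over `K`: the `K`-scheme obtained by gluing the `U_[σ, i]`,
`[σ, i] ∈ Ω(S)`, along the open immersions `U_[τ, j] ⟶ U_[σ, i]` for `[τ, j] ⪯ [σ, i]`. -/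
def toricPrevariety : Over (Spec (CommRingCat.of K)) :=
  Over.mk (colimit.desc (chartDiagram K S)
    { pt := Spec (CommRingCat.of K)
      ι := { app := fun ω => (chartScheme K S ω).hom
             naturality := fun _ _ h => (Over.w ((chartDiagramOver K S).map h)).trans
              (Category.comp_id _).symm } })

variable {S} in
/-- The inclusion of the torus-invariant affine open subset `U_[σ, i]` of `X(S)`. -/
def chartIncl (ω : S.Chart) : chartScheme K S ω ⟶ toricPrevariety K S :=
  Over.homMk (colimit.ι (chartDiagram K S) ω) (colimit.ι_desc _ _)

lemma chartTrans_chartIncl {ω ω' : S.Chart} (h : ω ≤ ω') :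
    chartTrans K h ≫ chartIncl K ω' = chartIncl K ω := by
  ext1
  exact colimit.w (chartDiagram K S) (homOfLE h)

end Prevariety

/-! ### Toric morphisms -/

section ToricMorphism

variable {N N' I I' : Type u} [AddCommGroup N] [AddCommGroup N']
  {S : FanSystem N I} {S' : FanSystem N' I'} (φ : S.Hom S')

lemma pairing_comp (F : N →ₗ[ℤ] N') (m : DualLattice N') (v : RealSpace N) :
    pairing (m ∘ₗ F) v = pairing m (F.baseChange ℝ v) := by
  simp [pairing, LinearMap.baseChange_comp]

/-- The homomorphism `S_σ' → S_σ`, `m ↦ m ∘ F`, where `[σ', i'] = 𝔣 [σ, i]`. -/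
def FanSystem.Hom.dualMap (ω : S.Chart) :
    dualMonoid (φ.onCharts ω).cone →+ dualMonoid ω.cone where
  toFun m := ⟨m.1 ∘ₗ φ.toLin, fun v hv => by
    rw [pairing_comp]
    exact m.2 _ (φ.maps_cone ω v hv)⟩
  map_zero' := Subtype.ext (LinearMap.zero_comp _)
  map_add' a b := Subtype.ext (LinearMap.add_comp _ _ _)

variable (K : Type u) [Field K]

/-- The toric morphism `U_[σ, i] ⟶ U_𝔣[σ, i]`. -/
def chartMap (ω : S.Chart) : chartScheme K S ω ⟶ chartScheme K S' (φ.onCharts ω) :=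
  specOver.map (AddMonoidAlgebra.mapDomainAlgHom K K (φ.dualMap ω))

lemma chartTrans_chartMap {ω ω' : S.Chart} (h : ω ≤ ω') :
    chartTrans K h ≫ chartMap φ K ω' =
      chartMap φ K ω ≫ chartTrans K (φ.monotone ω ω' h) := by
  change specOver.map _ ≫ specOver.map _ = specOver.map _ ≫ specOver.map _
  rw [← specOver.map_comp, ← specOver.map_comp]
  congr 1
  refine AddMonoidAlgebra.algHom_ext (fun s => ?_) (by ext)
  rw [AlgHom.comp_apply, AlgHom.comp_apply, restrictHom_single]
  simp only [AddMonoidAlgebra.mapDomainAlgHom_apply, AddMonoidAlgebra.mapDomain_single]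
  rw [restrictHom_single]
  rfl

/-- The toric morphism `X(S) ⟶ X(S')` induced by a morphism of systems of fans, glued from the
morphisms `U_[σ, i] ⟶ U_𝔣[σ, i]`. -/
def toricMorphism : toricPrevariety K S ⟶ toricPrevariety K S' :=
  Over.homMk (colimit.desc (chartDiagram K S)
    { pt := (toricPrevariety K S').left
      ι := { app := fun ω => (chartMap φ K ω ≫ chartIncl K (φ.onCharts ω)).left
             naturality := fun ω ω' h => by
              refine Eq.trans ?_ (Category.comp_id _).symm
              change (chartTrans K (leOfHom h)).left ≫ _ = _
              rw [← Over.comp_left, ← Category.assoc, chartTrans_chartMap, Category.assoc,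
                chartTrans_chartIncl] } })
    (by
      refine colimit.hom_ext fun ω => ?_
      refine ((Category.assoc _ _ _).symm.trans
        (congrArg (· ≫ (toricPrevariety K S').hom) (colimit.ι_desc _ ω))).trans ?_
      exact (Over.w (chartMap φ K ω ≫ chartIncl K (φ.onCharts ω))).trans
        (Over.w (chartIncl K ω)).symm)

lemma chartIncl_toricMorphism (ω : S.Chart) :
    chartIncl K ω ≫ toricMorphism φ K = chartMap φ K ω ≫ chartIncl K (φ.onCharts ω) := by
  ext1
  exact colimit.ι_desc _ ω

end ToricMorphism

/-! ### The torus action -/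

section Action

variable (K : Type u) [Field K] (N : Type u) [AddCommGroup N]

/-- The torus `T = Spec K[M]`. -/
abbrev torus : Over (Spec (CommRingCat.of K)) := specOver K (AddMonoidAlgebra K (DualLattice N))

variable {N} {I : Type u} (S : FanSystem N I)

/-- The product `T × X(S)` over `K`. -/
def torusProd : Over (Spec (CommRingCat.of K)) :=
  Over.mk (pullback.fst (torus K N).hom (toricPrevariety K S).hom ≫ (torus K N).hom)

/-- The projection `T × X(S) ⟶ T`. -/
def torusProdFst : torusProd K S ⟶ torus K N :=
  Over.homMk (pullback.fst (torus K N).hom (toricPrevariety K S).hom) rfl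

/-- The projection `T × X(S) ⟶ X(S)`. -/
def torusProdSnd : torusProd K S ⟶ toricPrevariety K S :=
  Over.homMk (pullback.snd (torus K N).hom (toricPrevariety K S).hom) pullback.condition.symm

variable {K}

/-- The coaction `K[S_σ] → K[M] ⊗ K[S_σ]`, `χ^s ↦ χ^s ⊗ χ^s`. -/
def coaction (σ : PointedCone ℝ (RealSpace N)) :
    coordRing K σ →ₐ[K] AddMonoidAlgebra K (DualLattice N) ⊗[K] coordRing K σ :=
  AddMonoidAlgebra.lift K _ _
    { toFun := fun s => AddMonoidAlgebra.single (s.toAdd : dualMonoid σ).1 1 ⊗ₜ[K]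
        chi K (s.toAdd : dualMonoid σ)
      map_one' := rfl
      map_mul' := fun a b => by
        simp [AddMonoidAlgebra.single_mul_single] }

variable (K) {S}

/-- `Spec A ×_K Spec B` is `Spec (A ⊗ B)`. -/
def specProdIso (K : Type u) [Field K] (A B : Type u) [CommRing A] [Algebra K A]
    [CommRing B] [Algebra K B] :
    pullback (specOver K A).hom (specOver K B).hom ≅ Spec (CommRingCat.of (A ⊗[K] B)) :=
  pullbackSpecIso K A B

/-- The action of `T` on `U_[σ, i]`. -/
def chartAction (ω : S.Chart) :
    pullback (torus K N).hom (chartScheme K S ω).hom ⟶ (chartScheme K S ω).left :=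
  (specProdIso K (AddMonoidAlgebra K (DualLattice N)) (coordRing K ω.cone)).hom ≫
    Spec.map (CommRingCat.ofHom (coaction (K := K) ω.cone).toRingHom)

lemma specProdIso_inv_fst {K : Type u} [Field K] (A B : Type u) [CommRing A] [Algebra K A]
    [CommRing B] [Algebra K B] :
    (specProdIso K A B).inv ≫ pullback.fst (specOver K A).hom (specOver K B).hom =
      Spec.map (CommRingCat.ofHom (Algebra.TensorProduct.includeLeft : A →ₐ[K] A ⊗[K] B).toRingHom) :=
  pullbackSpecIso_inv_fst K A B

lemma specProdIso_inv_snd {K : Type u} [Field K] (A B : Type u) [CommRing A] [Algebra K A]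
    [CommRing B] [Algebra K B] :
    (specProdIso K A B).inv ≫ pullback.snd (specOver K A).hom (specOver K B).hom =
      Spec.map (CommRingCat.ofHom
        (Algebra.TensorProduct.includeRight : B →ₐ[K] A ⊗[K] B).toRingHom) :=
  pullbackSpecIso_inv_snd K A B

lemma specProdIso_map {K : Type u} [Field K] (A : Type u) {B B' : Type u}
    [CommRing A] [Algebra K A]
    [CommRing B] [Algebra K B] [CommRing B'] [Algebra K B'] (f : B' →ₐ[K] B) :
    pullback.map (specOver K A).hom (specOver K B).hom (specOver K A).hom (specOver K B').hom
      (𝟙 _) (specOver.map f).left (𝟙 _) (by simp) (by simp) ≫ (specProdIso K A B').hom =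
    (specProdIso K A B).hom ≫
      Spec.map (CommRingCat.ofHom (Algebra.TensorProduct.map (AlgHom.id K A) f).toRingHom) := by
  rw [← Iso.inv_comp_eq, ← Category.assoc, ← Iso.eq_comp_inv]
  apply pullback.hom_ext
  · rw [Category.assoc, pullback.lift_fst, Category.assoc, specProdIso_inv_fst]
    refine (congrArg ((specProdIso K A B).inv ≫ ·) (Category.comp_id _)).trans ?_
    rw [specProdIso_inv_fst]
    refine Eq.trans ?_ (Spec.map_comp _ _)
    rw [← CommRingCat.ofHom_comp]
    congr 2
    ext a
    simp
  · rw [Category.assoc, pullback.lift_snd, Category.assoc, specProdIso_inv_snd,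
      ← Category.assoc, specProdIso_inv_snd]
    refine (Spec.map_comp _ _).symm.trans (Eq.trans ?_ (Spec.map_comp _ _))
    rw [← CommRingCat.ofHom_comp, ← CommRingCat.ofHom_comp]
    congr 2

lemma map_comp_coaction {τ σ : PointedCone ℝ (RealSpace N)} (h : τ ≤ σ) :
    (Algebra.TensorProduct.map (AlgHom.id K (AddMonoidAlgebra K (DualLattice N)))
      (restrictHom K h)).comp (coaction σ) = (coaction τ).comp (restrictHom K h) := by
  refine AddMonoidAlgebra.algHom_ext (fun s => ?_) (by ext)
  rw [AlgHom.comp_apply, AlgHom.comp_apply, restrictHom_single]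
  simp only [coaction, AddMonoidAlgebra.lift_single]
  simp [restrictHom_single]

lemma chartAction_chartTrans {ω ω' : S.Chart} (h : ω ≤ ω') :
    pullback.map (torus K N).hom (chartScheme K S ω).hom (torus K N).hom (chartScheme K S ω').hom
      (𝟙 _) (chartTrans K h).left (𝟙 _) (by simp) (by simp) ≫ chartAction K ω' =
    chartAction K ω ≫ (chartTrans K h).left := by
  refine (Category.assoc _ _ _).symm.trans
    ((congrArg (· ≫ Spec.map (CommRingCat.ofHom (coaction (K := K) ω'.cone).toRingHom))
      (specProdIso_map (AddMonoidAlgebra K (DualLattice N))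
        (restrictHom K (FanSystem.Chart.isFace h).le))).trans ?_)
  refine (Category.assoc _ _ _).trans (Eq.trans ?_ (Category.assoc _ _ _).symm)
  refine congrArg (_ ≫ ·) ?_
  refine (Spec.map_comp _ _).symm.trans (Eq.trans ?_ (Spec.map_comp _ _))
  rw [← CommRingCat.ofHom_comp, ← CommRingCat.ofHom_comp]
  exact congrArg (fun f => Spec.map (CommRingCat.ofHom (AlgHom.toRingHom f)))
    (map_comp_coaction K (FanSystem.Chart.isFace h).le)

lemma chartAction_hom (ω : S.Chart) :
    chartAction K ω ≫ (chartScheme K S ω).hom =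
      pullback.fst (torus K N).hom (chartScheme K S ω).hom ≫ (torus K N).hom := by
  have e : pullback.fst (torus K N).hom (chartScheme K S ω).hom =
      (specProdIso K (AddMonoidAlgebra K (DualLattice N)) (coordRing K ω.cone)).hom ≫
        Spec.map (CommRingCat.ofHom (Algebra.TensorProduct.includeLeft :
          AddMonoidAlgebra K (DualLattice N) →ₐ[K] AddMonoidAlgebra K (DualLattice N) ⊗[K]
            coordRing K ω.cone).toRingHom) := by
    exact ((Iso.inv_comp_eq _).1 (specProdIso_inv_fst _ _))
  rw [e]
  refine (Category.assoc _ _ _).trans (Eq.trans ?_ (Category.assoc _ _ _).symm)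
  refine congrArg (_ ≫ ·) ?_
  refine (Spec.map_comp _ _).symm.trans (Eq.trans ?_ (Spec.map_comp _ _))
  rw [← CommRingCat.ofHom_comp, ← CommRingCat.ofHom_comp]
  congr 2
  exact (coaction (K := K) ω.cone).comp_algebraMap.trans (Algebra.TensorProduct.includeLeft :
    AddMonoidAlgebra K (DualLattice N) →ₐ[K] AddMonoidAlgebra K (DualLattice N) ⊗[K]
      coordRing K ω.cone).comp_algebraMap.symm

/-- The open cover of `X(S)` by the `U_[σ, i]`. -/
abbrev chartCover (S : FanSystem N I) : (toricPrevariety K S).left.OpenCover where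
  I₀ := S.Chart
  X ω := (chartScheme K S ω).left
  f ω := (chartIncl K ω).left
  mem₀ := (Scheme.IsLocallyDirected.openCover (chartDiagram K S)).mem₀

lemma chartDiagram_exists_lift (S : FanSystem N I) (ω₁ ω₂ : S.Chart)
    (x : (pullback (colimit.ι (chartDiagram K S) ω₁) (colimit.ι (chartDiagram K S) ω₂) : Scheme)) :
    ∃ (k : S.Chart) (f₁ : k ⟶ ω₁) (f₂ : k ⟶ ω₂) (y : (chartDiagram K S).obj k),
      pullback.lift ((chartDiagram K S).map f₁) ((chartDiagram K S).map f₂)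
        ((colimit.w (chartDiagram K S) f₁).trans (colimit.w (chartDiagram K S) f₂).symm) y = x := by
  obtain ⟨k, f₁, f₂, y, hy₁, hy₂⟩ := (Scheme.IsLocallyDirected.ι_eq_ι_iff (chartDiagram K S)
    (xi := pullback.fst (colimit.ι (chartDiagram K S) ω₁) (colimit.ι (chartDiagram K S) ω₂) x)
    (xj := pullback.snd (colimit.ι (chartDiagram K S) ω₁) (colimit.ι (chartDiagram K S) ω₂) x)).1
    (by rw [← Scheme.Hom.comp_apply, ← Scheme.Hom.comp_apply, pullback.condition])
  refine ⟨k, f₁, f₂, y, ?_⟩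
  apply (pullback.fst (colimit.ι (chartDiagram K S) ω₁)
    (colimit.ι (chartDiagram K S) ω₂)).isOpenEmbedding.injective
  rw [← hy₁, ← Scheme.Hom.comp_apply, pullback.lift_fst]

instance : (chartCover K S).LocallyDirected where
  trans {ω ω'} h := (chartDiagram K S).map h
  trans_id ω := (chartDiagram K S).map_id ω
  trans_comp h h' := (chartDiagram K S).map_comp h h'
  w h := colimit.w (chartDiagram K S) h
  directed {ω ω'} x := by
    exact chartDiagram_exists_lift K S ω ω' x
  property_trans {ω ω'} h := by
    let ω₁ : S.Chart := ω
    let ω₂ : S.Chart := ω'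
    let h' : ω₁ ⟶ ω₂ := h
    exact (inferInstance : IsOpenImmersion ((chartDiagram K S).map h'))

variable (S)

/-- The open cover of `T × X(S)` by the `T × U_[σ, i]`. -/
abbrev torusProdCover : (torusProd K S).left.OpenCover where
  I₀ := S.Chart
  X ω := pullback (torusProdSnd K S).left (chartIncl K ω).left
  f ω := pullback.fst (torusProdSnd K S).left (chartIncl K ω).left
  mem₀ := ((chartCover K S).pullback₁ (torusProdSnd K S).left).mem₀

/-- The isomorphism from the member of the cover belonging to `[σ, i]` to `T × U_[σ, i]`. -/
def torusProdChart (ω : S.Chart) :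
    pullback (torusProdSnd K S).left (chartIncl K ω).left ⟶
      pullback (torus K N).hom (chartScheme K S ω).hom :=
  pullback.lift (pullback.fst (torusProdSnd K S).left (chartIncl K ω).left ≫ (torusProdFst K S).left)
    (pullback.snd (torusProdSnd K S).left (chartIncl K ω).left)
    (by
      rw [Category.assoc, Over.w, ← Over.w (torusProdSnd K S), pullback.condition_assoc, Over.w])

instance : (torusProdCover K S).LocallyDirected :=
  Scheme.Cover.locallyDirectedPullbackCover (chartCover K S) _

lemma torusProdChart_trans {ω ω' : S.Chart} (h : ω ≤ ω') :
    (torusProdCover K S).trans (i := ω) (j := ω') (homOfLE h) ≫ torusProdChart K S ω' =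
      torusProdChart K S ω ≫ pullback.map (torus K N).hom (chartScheme K S ω).hom (torus K N).hom
        (chartScheme K S ω').hom (𝟙 _) (chartTrans K h).left (𝟙 _) (by simp) (by simp) := by
  apply pullback.hom_ext
  · rw [Category.assoc, Category.assoc, torusProdChart, pullback.lift_fst, pullback.lift_fst,
      ← Category.assoc, Scheme.Cover.trans_map]
    refine Eq.trans ?_ (Category.assoc _ _ _)
    refine Eq.trans ?_ (Category.comp_id _).symm
    exact (pullback.lift_fst _ _ _).symm
  · rw [Category.assoc, Category.assoc, torusProdChart, pullback.lift_snd, pullback.lift_snd]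
    refine (pullback.lift_snd _ _ _).trans ?_
    refine Eq.trans ?_ (Category.assoc _ _ _)
    exact congrArg (· ≫ (chartTrans K h).left) (pullback.lift_snd _ _ _).symm

lemma torusProdChart_action_trans {ω ω' : S.Chart} (h : ω ⟶ ω') :
    (torusProdCover K S).trans (i := ω) (j := ω') h ≫
        torusProdChart K S ω' ≫ chartAction K ω' ≫ (chartIncl K ω').left =
      torusProdChart K S ω ≫ chartAction K ω ≫ (chartIncl K ω).left := by
  rw [← Category.assoc]
  refine (congrArg (· ≫ _) (torusProdChart_trans K S (leOfHom h))).trans ?_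
  rw [Category.assoc, ← Category.assoc (pullback.map _ _ _ _ _ _ _ _ _)]
  rw [chartAction_chartTrans, Category.assoc, ← Over.comp_left, chartTrans_chartIncl]

/-- The action `T × X(S) ⟶ X(S)`, glued from the actions of `T` on the `U_[σ, i]`. -/
def torusAction : torusProd K S ⟶ toricPrevariety K S :=
  Over.homMk ((torusProdCover K S).glueMorphismsOfLocallyDirected
    (fun ω => torusProdChart K S ω ≫ chartAction K ω ≫ (chartIncl K ω).left)
    (torusProdChart_action_trans K S))
    (by
      refine (torusProdCover K S).hom_ext _ _ fun ω => ?_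
      rw [← Category.assoc, Scheme.OpenCover.map_glueMorphismsOfLocallyDirected, Category.assoc,
        Category.assoc, Over.w, chartAction_hom, ← Category.assoc, torusProdChart,
        pullback.lift_fst, Category.assoc, Over.w])

/-- On `T × U_[σ, i]` the action is the morphism given by `χ^s ↦ χ^s ⊗ χ^s`. -/
lemma torusAction_chart (ω : S.Chart) :
    (torusProdCover K S).f ω ≫ (torusAction K S).left =
      torusProdChart K S ω ≫ chartAction K ω ≫ (chartIncl K ω).left :=
  Scheme.OpenCover.map_glueMorphismsOfLocallyDirected (torusProdCover K S)
    (fun ω => torusProdChart K S ω ≫ chartAction K ω ≫ (chartIncl K ω).left)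
    (torusProdChart_action_trans K S) ω

end Action

/-! ### Berkovich analytification -/

section Analytification

variable {K : Type u} [NormedField K]

/-- The homomorphism from `K` to the residue field of a point of a `K`-scheme. -/
def scalarHom (X : Over (Spec (CommRingCat.of K))) (x : X.left) : K →+* X.left.residueField x :=
  ((Scheme.ΓSpecIso (CommRingCat.of K)).inv ≫ X.hom.appTop ≫ X.left.Γevaluation x).hom

/-- The points of the Berkovich analytification of a `K`-scheme: a point `x` together with an
absolute value on the residue field `κ(x)` extending the norm of `K`. (For `X = Spec A` these are
the multiplicative seminorms on `A` extending the norm of `K`.) -/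
structure Analytification (X : Over (Spec (CommRingCat.of K))) where
  pt : X.left
  abv : AbsoluteValue (X.left.residueField pt) ℝ
  abv_scalar : ∀ a : K, abv (scalarHom X pt a) = ‖a‖

namespace Analytification

variable {X Y : Over (Spec (CommRingCat.of K))}

/-- The value `|f|_x` of a function `f ∈ 𝒪(U)` at a point `x` over `U`. -/
def eval (x : Analytification X) (U : X.left.Opens) (hx : x.pt ∈ U) (f : Γ(X.left, U)) : ℝ :=
  x.abv ((X.left.evaluation U x.pt hx).hom f)

/-- The coarsest topology for which the preimage `U^an` of each open `U ⊆ X` is open and all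
functions `x ↦ |f|_x` on `U^an`, `f ∈ 𝒪(U)`, are continuous. -/
instance : TopologicalSpace (Analytification X) :=
  generateFrom {A | ∃ (U : X.left.Opens) (f : Γ(X.left, U)) (V : Set ℝ),
    IsOpen V ∧ A = {x | ∃ hx : x.pt ∈ U, x.eval U hx f ∈ V}}

lemma scalarHom_comp (f : X ⟶ Y) (x : X.left) :
    ((f.left.residueFieldMap x).hom).comp (scalarHom Y (f.left x)) = scalarHom X x := by
  rw [scalarHom, scalarHom, ← CommRingCat.hom_comp, Category.assoc, Category.assoc,
    Scheme.Γevaluation_naturality, ← Over.w f]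
  rw [Scheme.Hom.comp_appTop, Category.assoc]

/-- The map `f^an` induced by a morphism `f` of `K`-schemes. -/
def map (f : X ⟶ Y) (x : Analytification X) : Analytification Y where
  pt := f.left x.pt
  abv := x.abv.comp (f := (f.left.residueFieldMap x.pt).hom) (RingHom.injective _)
  abv_scalar a := by
    rw [← x.abv_scalar a, ← scalarHom_comp f]
    rfl

/-- The value `|a|_x` of `a ∈ A` at a point `x` of `(Spec A)^an`. -/
def absAt {A : Type u} [CommRing A] [Algebra K A] (x : Analytification (specOver K A)) (a : A) : ℝ :=
  x.eval ⊤ trivial ((Scheme.ΓSpecIso (CommRingCat.of A)).inv.hom a)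

lemma absAt_one {A : Type u} [CommRing A] [Algebra K A] (x : Analytification (specOver K A)) :
    x.absAt 1 = 1 := by
  unfold absAt eval
  rw [map_one]
  exact (congrArg x.abv (map_one _)).trans (map_one x.abv)

lemma absAt_mul {A : Type u} [CommRing A] [Algebra K A] (x : Analytification (specOver K A))
    (a b : A) : x.absAt (a * b) = x.absAt a * x.absAt b := by
  unfold absAt eval
  rw [map_mul]
  exact (congrArg x.abv (map_mul _ _ _)).trans (map_mul x.abv _ _)

end Analytification

end Analytification

/-! ### Tropical toric prevarieties -/

/-- The map `-log : ℝ≥0 → ℝ ∪ {∞}`, with `-log 0 = ∞`. -/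
def negLog (r : ℝ) : WithTop ℝ := if r = 0 then ⊤ else ((-Real.log r : ℝ) : WithTop ℝ)

/-- The map `t ↦ e^{-t}` on `ℝ ∪ {∞}`, with `e^{-∞} = 0`. -/
def expNeg : WithTop ℝ → ℝ := WithTop.recTopCoe 0 fun t => Real.exp (-t)

lemma negLog_one : negLog 1 = 0 := by simp [negLog]

lemma negLog_mul (a b : ℝ) : negLog (a * b) = negLog a + negLog b := by
  unfold negLog
  by_cases ha : a = 0
  · simp [ha]
  by_cases hb : b = 0
  · simp [hb]
  rw [if_neg (mul_ne_zero ha hb), if_neg ha, if_neg hb, Real.log_mul ha hb, ← WithTop.coe_add]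
  congr 1
  ring

section Tropical

variable {K : Type u} [NormedField K] {N N' I I' : Type u} [AddCommGroup N] [AddCommGroup N']

/-- The affine tropical toric variety `U_σ^trop = Hom(S_σ, ℝ ∪ {∞})`. -/
abbrev AffineTrop (σ : PointedCone ℝ (RealSpace N)) : Type u := dualMonoid σ →+ WithTop ℝ

/-- The coarsest topology for which all evaluations `u ↦ u s` are continuous. -/
instance (σ : PointedCone ℝ (RealSpace N)) : TopologicalSpace (AffineTrop σ) :=
  TopologicalSpace.induced (fun u s => u s) Pi.topologicalSpace

variable (S : FanSystem N I) {S' : FanSystem N' I'}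

/-- The tropical toric prevariety `X(S)^trop`: the space obtained by gluing the
`U_[σ, i]^trop`, `[σ, i] ∈ Ω(S)`, along the maps `U_[τ, j]^trop → U_[σ, i]^trop`
(restriction of homomorphisms along `S_σ ⊆ S_τ`) for `[τ, j] ⪯ [σ, i]`. -/
def TropPrevariety : Type u :=
  Quot fun p q : Σ ω : S.Chart, AffineTrop ω.cone =>
    ∃ h : p.1 ≤ q.1, q.2 = p.2.comp (AddSubmonoid.inclusion (FanSystem.Chart.dualMonoid_le h))

/-- The quotient of the topology of the disjoint union. -/
instance : TopologicalSpace (TropPrevariety S) :=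
  inferInstanceAs (TopologicalSpace (Quot _))

variable {S}

/-- The map `U_[σ, i]^trop → X(S)^trop`. -/
def TropPrevariety.mk (ω : S.Chart) (u : AffineTrop ω.cone) : TropPrevariety S := Quot.mk _ ⟨ω, u⟩

/-- The map `X(S)^trop → X(S')^trop` induced by a morphism of systems of fans. -/
def TropPrevariety.map (φ : S.Hom S') : TropPrevariety S → TropPrevariety S' :=
  Quot.map (fun p => ⟨φ.onCharts p.1, p.2.comp (φ.dualMap p.1)⟩) (by
    rintro ⟨ω, u⟩ ⟨ω', u'⟩ ⟨h, hu⟩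
    dsimp only at h hu
    refine ⟨φ.monotone _ _ h, ?_⟩
    dsimp only
    rw [hu]
    rfl)

/-- The tropicalization `x ↦ (s ↦ -log |χ^s|_x)` of a point of `U_[σ, i]^an`. -/
def affineTropicalization (ω : S.Chart) (x : Analytification (chartScheme K S ω)) :
    AffineTrop ω.cone where
  toFun s := negLog (x.absAt (chi K s))
  map_zero' := by
    rw [← negLog_one, ← Analytification.absAt_one (A := coordRing K ω.cone) x]
    rfl
  map_add' a b := by
    rw [← negLog_mul, ← Analytification.absAt_mul, AddMonoidAlgebra.single_mul_single, one_mul]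

variable (K S)

/-- The map `t : X^an → X^trop` restricts on each `U_[σ, i]^an` to `x ↦ (s ↦ -log |χ^s|_x)`. -/
def IsTropicalization
    (t : Analytification (toricPrevariety K S) → TropPrevariety S) : Prop :=
  ∀ (ω : S.Chart) (x : Analytification (chartScheme K S ω)),
    t (Analytification.map (chartIncl K ω) x) = TropPrevariety.mk ω (affineTropicalization ω x)

/-- The map `J : X^trop → X^an` sends `u ∈ Hom(S_σ, ℝ ∪ {∞})` to the multiplicative seminorm
`∑ a_s χ^s ↦ sup |a_s| e^{-u(s)}` on `K[S_σ]`. -/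
def IsGaussSection
    (J : TropPrevariety S → Analytification (toricPrevariety K S)) : Prop :=
  ∀ (ω : S.Chart) (u : AffineTrop ω.cone), ∃ x : Analytification (chartScheme K S ω),
    J (TropPrevariety.mk ω u) = Analytification.map (chartIncl K ω) x ∧
    ∀ g : coordRing K ω.cone, x.absAt g =
      ⨆ s : dualMonoid ω.cone, ‖g.coeff s‖ * expNeg (u s)

/-! ### The quotient by the affinoid torus -/

variable (N) in
/-- The affinoid torus `T° ⊆ T^an`, where `|χ^m| = 1` for all `m ∈ M`. -/
def affinoidTorus : Set (Analytification (torus K N)) :=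
  {t | ∀ m : DualLattice N, t.absAt (AddMonoidAlgebra.single m 1) = 1}

/-- The underlying topological space of the analytic stack quotient `[X^an / T°]`: the quotient
of `X^an` by the equivalence relation generated by the action groupoid `T° × X^an ⇉ X^an` (the
topological colimit of the groupoid). Here `T° × X^an` is the product of analytic spaces, that is,
the part of `(T × X)^an` lying over `T°`. -/
def StackQuotientSpace : Type u :=
  Quot fun x y : Analytification (toricPrevariety K S) =>
    ∃ z : Analytification (torusProd K S),
      Analytification.map (torusProdFst K S) z ∈ affinoidTorus K N ∧
      Analytification.map (torusAction K S) z = x ∧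
      Analytification.map (torusProdSnd K S) z = y

/-- The quotient topology. -/
instance : TopologicalSpace (StackQuotientSpace K S) :=
  inferInstanceAs (TopologicalSpace (Quot _))

variable {K S}

/-- The projection `X^an → |[X^an / T°]|`. -/
def StackQuotientSpace.mk (x : Analytification (toricPrevariety K S)) : StackQuotientSpace K S :=
  Quot.mk _ x

end Tropical

end ToricTrop

end

open ToricTrop

noncomputable section

open CategoryTheory CategoryTheory.Limits AlgebraicGeometry TopologicalSpace
open scoped TensorProduct

namespace ToricTrop

/-! ### Multiplicative seminorms -/

/-! Everything is reduced to the affine charts. The analytification of `Spec A` is the space of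
multiplicative seminorms on `A` extending the norm of `K`, with pointwise convergence
(`homeoSeminorm`). Open immersions of schemes induce open embeddings of analytifications, so
`X(S)^an` is glued from the seminorm spaces of the rings `K[S_σ]` (`isOpenEmbedding_chartAn`,
`exists_of_chartAn_eq`).

The central fact on a chart is a maximality property. If `x` is a seminorm with tropicalization `u`,
the ultrametric inequality gives `x(f) ≤ sup |a_s| e^{-u(s)}` (`SeminormSpace.le_gaussPoint`). The
right side is again multiplicative, because finite subsets of the lattice `M` have unique sums
(`le_gauss_mul`). Hence each fibre of the tropicalization has a largest element, its Gauss point,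
and `J` selects it.

Properness: along an ultrafilter whose tropicalizations converge, each value `x(f)` is eventually
bounded by Gauss values, hence converges, and the pointwise limit is a seminorm
(`exists_le_nhds_of_tropPoint`). This globalizes because the preimage of a chart of `X^trop` is the
corresponding chart of `X^an` (`exists_chartAn_eq_of_tropMap_eq`): belonging to a smaller chart
means that some character does not vanish, which the tropicalization detects. The same fact makes
the tropicalization a separated map, although `X^an` itself need not be Hausdorff.

Retraction: for each vector of a basis of `N`, a seminorm is translated by the generic point of the
disc of radius `r` around `1` in the corresponding one-parameter subgroup. Radius `0` changes
nothing. Radius `1` gives a seminorm that bounds every graded part, so after a whole basis it bounds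
every monomial and, by maximality, is the Gauss point (`flowList_one`). Values on monomials never
change and the flow only increases seminorms, so Gauss points stay fixed.

Quotient: characters have absolute value `1` on `T°`, so the tropicalization is invariant.
Conversely, extending a seminorm on `A = K[S_σ]` to `A[M]` with all weights `1` gives a point of `T°
× X^an` that connects `x` with `J (trop x)` (`exists_affinoidTorus_orbit`). The orbit relation
therefore generates exactly the fibres, and `J` supplies the continuous inverse. -/

/-- A multiplicative non-Archimedean seminorm on a `K`-algebra extending the norm of `K`. -/
structure IsMulSeminorm (K : Type*) [NormedField K] {A : Type*} [CommRing A] [Algebra K A]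
    (ν : A → ℝ) : Prop where
  nonneg : ∀ a, 0 ≤ ν a
  mul : ∀ a b, ν (a * b) = ν a * ν b
  add_le : ∀ a b, ν (a + b) ≤ max (ν a) (ν b)
  algebraMap : ∀ c : K, ν (algebraMap K A c) = ‖c‖

namespace IsMulSeminorm

variable {K : Type*} [NormedField K] {A B : Type*} [CommRing A] [Algebra K A] [CommRing B]
  [Algebra K B] {ν : A → ℝ} (h : IsMulSeminorm K ν)

include h

lemma zero : ν 0 = 0 := by simpa using h.algebraMap 0

lemma one : ν 1 = 1 := by simpa using h.algebraMap 1

lemma neg (a : A) : ν (-a) = ν a := by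
  have h1 : ν (-1) = 1 := by simpa using h.algebraMap (-1)
  rw [← neg_one_mul, h.mul, h1, one_mul]

lemma pow (a : A) (n : ℕ) : ν (a ^ n) = ν a ^ n := by
  induction n with
  | zero => simp [h.one]
  | succ n ih => rw [pow_succ, h.mul, ih, pow_succ]

lemma add_eq_of_lt {a b : A} (hab : ν b < ν a) : ν (a + b) = ν a := by
  refine le_antisymm ((h.add_le a b).trans (by rw [max_eq_left hab.le])) ?_
  by_contra! hlt
  have := h.add_le (a + b) (-b)
  rw [add_neg_cancel_right, h.neg] at this
  exact absurd this (not_le.2 (max_lt hlt hab))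

lemma sum_le {ι : Type*} (s : Finset ι) (f : ι → A) {c : ℝ} (hc : 0 ≤ c)
    (hf : ∀ i ∈ s, ν (f i) ≤ c) : ν (∑ i ∈ s, f i) ≤ c := by
  classical
  induction s using Finset.induction_on with
  | empty => simpa [h.zero] using hc
  | insert i s hi ih =>
    rw [Finset.sum_insert hi]
    exact (h.add_le _ _).trans (max_le (hf i (Finset.mem_insert_self i s))
      (ih fun j hj => hf j (Finset.mem_insert_of_mem hj)))

lemma sum_lt {ι : Type*} (s : Finset ι) (f : ι → A) {c : ℝ} (hc : 0 < c)
    (hf : ∀ i ∈ s, ν (f i) < c) : ν (∑ i ∈ s, f i) < c := by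
  classical
  induction s using Finset.induction_on with
  | empty => simpa [h.zero] using hc
  | insert i s hi ih =>
    rw [Finset.sum_insert hi]
    exact (h.add_le _ _).trans_lt (max_lt (hf i (Finset.mem_insert_self i s))
      (ih fun j hj => hf j (Finset.mem_insert_of_mem hj)))

lemma comp (f : B →ₐ[K] A) : IsMulSeminorm K fun b => ν (f b) where
  nonneg b := h.nonneg _
  mul a b := by rw [map_mul, h.mul]
  add_le a b := by rw [map_add]; exact h.add_le _ _
  algebraMap c := by rw [AlgHom.commutes, h.algebraMap]

end IsMulSeminorm

/-! ### Gauss seminorms on monoid algebras -/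

section Gauss

variable {A M : Type*} [CommRing A]

/-- The Gauss seminorm `∑ a_m χ^m ↦ sup ν(a_m) w(m)`. -/
def gauss (ν : A → ℝ) (w : M → ℝ) (f : AddMonoidAlgebra A M) : ℝ := ⨆ m, ν (f.coeff m) * w m

variable {K : Type*} [NormedField K] [Algebra K A] {ν : A → ℝ} (h : IsMulSeminorm K ν)
  {w : M → ℝ} (hw : ∀ m, 0 ≤ w m)

include h

/-- Off the finite support all values are `0`, so the supremum is over finitely many numbers: it is
bounded, and attained when `M` is nonempty. -/
lemma finite_range_gauss (w : M → ℝ) (f : AddMonoidAlgebra A M) :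
    (Set.range fun m => ν (f.coeff m) * w m).Finite := by
  classical
  refine ((f.coeff.support.image fun m => ν (f.coeff m) * w m).finite_toSet.union
    (Set.finite_singleton (0 : ℝ))).subset ?_
  rintro _ ⟨m, rfl⟩
  by_cases hm : m ∈ f.coeff.support
  · exact Or.inl (Finset.mem_coe.2 (Finset.mem_image_of_mem _ hm))
  · right
    simp [Finsupp.notMem_support_iff.1 hm, h.zero]

lemma le_gauss (w : M → ℝ) (f : AddMonoidAlgebra A M) (m : M) :
    ν (f.coeff m) * w m ≤ gauss ν w f :=
  le_ciSup (finite_range_gauss h w f).bddAbove m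

-- The condition `0 ≤ c` covers an empty `M`, where the real supremum is `0` by convention.
omit [NormedField K] [Algebra K A] h in
lemma gauss_le {f : AddMonoidAlgebra A M} {c : ℝ} (hc : 0 ≤ c)
    (hf : ∀ m, ν (f.coeff m) * w m ≤ c) : gauss ν w f ≤ c :=
  Real.iSup_le hf hc

lemma exists_gauss_eq (f : AddMonoidAlgebra A M) (hf : gauss ν w f ≠ 0) :
    ∃ m, ν (f.coeff m) * w m = gauss ν w f := by
  have hne : Nonempty M := by
    by_contra hM
    rw [not_nonempty_iff] at hM
    exact hf (Real.iSup_of_isEmpty _)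
  exact (Set.range_nonempty _).csSup_mem (finite_range_gauss h w f)

include hw

lemma gauss_nonneg (f : AddMonoidAlgebra A M) : 0 ≤ gauss ν w f :=
  Real.iSup_nonneg fun m => mul_nonneg (h.nonneg _) (hw m)

/-- The finite set `t` does not depend on `ν` or `w`; this makes continuity in these parameters
visible. -/
lemma gauss_eq_sup' (f : AddMonoidAlgebra A M) (t : Finset M) (ht : t.Nonempty)
    (hf : f.coeff.support ⊆ t) : gauss ν w f = t.sup' ht fun m => ν (f.coeff m) * w m := by
  refine le_antisymm (gauss_le ?_ fun m => ?_)
    (Finset.sup'_le _ _ fun m _ => le_gauss h w f m)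
  · obtain ⟨m, hm⟩ := ht
    exact (mul_nonneg (h.nonneg _) (hw m)).trans
      (Finset.le_sup' (fun m => ν (f.coeff m) * w m) hm)
  · by_cases hm : m ∈ t
    · exact Finset.le_sup' (fun m => ν (f.coeff m) * w m) hm
    · obtain ⟨m', hm'⟩ := ht
      have : f.coeff m = 0 := Finsupp.notMem_support_iff.1 fun h' => hm (hf h')
      rw [this, h.zero, zero_mul]
      exact (mul_nonneg (h.nonneg _) (hw m')).trans
        (Finset.le_sup' (fun m => ν (f.coeff m) * w m) hm')

lemma gauss_single (m : M) (a : A) : gauss ν w (AddMonoidAlgebra.single m a) = ν a * w m := by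
  classical
  refine le_antisymm (gauss_le (mul_nonneg (h.nonneg _) (hw m)) fun m' => ?_) ?_
  · rw [AddMonoidAlgebra.coeff_single, Finsupp.single_apply]
    split_ifs with e
    · rw [e]
    · rw [h.zero, zero_mul]
      exact mul_nonneg (h.nonneg _) (hw m)
  · simpa using le_gauss h w (AddMonoidAlgebra.single m a) m

lemma gauss_add_le (f g : AddMonoidAlgebra A M) :
    gauss ν w (f + g) ≤ max (gauss ν w f) (gauss ν w g) := by
  refine gauss_le (le_max_of_le_left (gauss_nonneg h hw f)) fun m => ?_
  rw [AddMonoidAlgebra.coeff_add, Finsupp.add_apply]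
  refine (mul_le_mul_of_nonneg_right (h.add_le _ _) (hw m)).trans ?_
  rw [max_mul_of_nonneg _ _ (hw m)]
  exact max_le_max (le_gauss h w f m) (le_gauss h w g m)

variable [AddCommMonoid M] (hw0 : w 0 = 1) (hwadd : ∀ a b, w (a + b) = w a * w b)

include hwadd

lemma gauss_mul_le (f g : AddMonoidAlgebra A M) :
    gauss ν w (f * g) ≤ gauss ν w f * gauss ν w g := by
  classical
  have hnn := mul_nonneg (gauss_nonneg h hw f) (gauss_nonneg h hw g)
  refine gauss_le hnn fun m => ?_
  rcases (hw m).eq_or_lt with h0 | h0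
  · rw [← h0, mul_zero]; exact hnn
  rw [← le_div_iff₀ h0, AddMonoidAlgebra.coeff_mul]
  refine h.sum_le _ _ (div_nonneg hnn h0.le) fun a _ => ?_
  refine h.sum_le _ _ (div_nonneg hnn h0.le) fun b _ => ?_
  dsimp only
  split_ifs with e
  · rw [le_div_iff₀ h0, h.mul, ← e, hwadd, mul_mul_mul_comm]
    exact mul_le_mul (le_gauss h w f a) (le_gauss h w g b)
      (mul_nonneg (h.nonneg _) (hw _)) (gauss_nonneg h hw f)
  · rw [h.zero]; exact div_nonneg hnn h0.le

/-- An analogue of Gauss's lemma. Among the exponents where `f` and `g` attain their Gauss values,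
choose a pair whose sum is attained only once; in that coefficient of `f * g` the product of the
chosen terms strictly dominates all other contributions. -/
lemma le_gauss_mul [UniqueSums M] (f g : AddMonoidAlgebra A M) :
    gauss ν w f * gauss ν w g ≤ gauss ν w (f * g) := by
  classical
  by_cases hf : gauss ν w f = 0
  · rw [hf, zero_mul]; exact gauss_nonneg h hw _
  by_cases hg : gauss ν w g = 0
  · rw [hg, mul_zero]; exact gauss_nonneg h hw _
  have hf0 : 0 < gauss ν w f := (gauss_nonneg h hw f).lt_of_ne' hf
  have hg0 : 0 < gauss ν w g := (gauss_nonneg h hw g).lt_of_ne' hg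
  have mem_supp : ∀ {p : AddMonoidAlgebra A M}, gauss ν w p ≠ 0 → ∀ m,
      ν (p.coeff m) * w m = gauss ν w p → m ∈ p.coeff.support := by
    intro p hp m hm
    rw [Finsupp.mem_support_iff]
    intro h0
    rw [h0, h.zero, zero_mul] at hm
    exact hp hm.symm
  -- `F` and `G` collect the exponents at which the maxima are attained; unique sums are applied to
  -- these sets rather than to the supports.
  set F := f.coeff.support.filter fun m => ν (f.coeff m) * w m = gauss ν w f with hF
  set G := g.coeff.support.filter fun m => ν (g.coeff m) * w m = gauss ν w g with hG
  have hFne : F.Nonempty := by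
    obtain ⟨m, hm⟩ := exists_gauss_eq h f hf
    exact ⟨m, Finset.mem_filter.2 ⟨mem_supp hf m hm, hm⟩⟩
  have hGne : G.Nonempty := by
    obtain ⟨m, hm⟩ := exists_gauss_eq h g hg
    exact ⟨m, Finset.mem_filter.2 ⟨mem_supp hg m hm, hm⟩⟩
  obtain ⟨a, ha, b, hb, hab⟩ := UniqueSums.uniqueAdd_of_nonempty hFne hGne
  obtain ⟨haf, haw⟩ := Finset.mem_filter.1 ha
  obtain ⟨hbg, hbw⟩ := Finset.mem_filter.1 hb
  have hwa : 0 < w a := (hw a).lt_of_ne' fun h0 => by rw [h0, mul_zero] at haw; exact hf haw.symm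
  have hwb : 0 < w b := (hw b).lt_of_ne' fun h0 => by rw [h0, mul_zero] at hbw; exact hg hbw.symm
  refine le_trans ?_ (le_gauss h w (f * g) (a + b))
  rw [← haw, ← hbw, hwadd, mul_mul_mul_comm, ← h.mul]
  refine mul_le_mul_of_nonneg_right (le_of_eq ?_) (mul_pos hwa hwb).le
  have hpos : 0 < ν (f.coeff a * g.coeff b) := by
    rw [h.mul]
    have h1 : 0 < ν (f.coeff a) := pos_of_mul_pos_left (haw ▸ hf0) hwa.le
    have h2 : 0 < ν (g.coeff b) := pos_of_mul_pos_left (hbw ▸ hg0) hwb.le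
    exact mul_pos h1 h2
  have hsum : (f * g).coeff (a + b) =
      ∑ p ∈ f.coeff.support ×ˢ g.coeff.support,
        if p.1 + p.2 = a + b then f.coeff p.1 * g.coeff p.2 else 0 := by
    rw [AddMonoidAlgebra.coeff_mul, Finsupp.sum, Finset.sum_product]
    rfl
  rw [hsum, ← Finset.add_sum_erase _ _ (Finset.mk_mem_product haf hbg), if_pos rfl]
  refine (h.add_eq_of_lt (h.sum_lt _ _ hpos ?_)).symm
  rintro ⟨x, y⟩ hxy
  obtain ⟨hne, hmem⟩ := Finset.mem_erase.1 hxy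
  obtain ⟨hx, hy⟩ := Finset.mem_product.1 hmem
  dsimp only at hx hy ⊢
  split_ifs with e
  · refine lt_of_mul_lt_mul_right (a := w (a + b)) ?_ (hw _)
    have e1 : ν (f.coeff a * g.coeff b) * w (a + b) = gauss ν w f * gauss ν w g := by
      rw [h.mul, hwadd, mul_mul_mul_comm, haw, hbw]
    rw [e1, ← e, h.mul, hwadd, mul_mul_mul_comm]
    have hxl := le_gauss h w f x
    have hyl := le_gauss h w g y
    -- Another pair with the same sum cannot lie in `F × G` by uniqueness, so at least one of its
    -- two factors is strictly below the maximum.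
    by_cases hxF : ν (f.coeff x) * w x = gauss ν w f
    · have hyG : ν (g.coeff y) * w y ≠ gauss ν w g := by
        intro hyG
        obtain ⟨rfl, rfl⟩ := hab (Finset.mem_filter.2 ⟨hx, hxF⟩) (Finset.mem_filter.2 ⟨hy, hyG⟩) e
        exact hne rfl
      rw [hxF]
      exact mul_lt_mul_of_pos_left (hyl.lt_of_ne hyG) hf0
    · exact (mul_le_mul_of_nonneg_left hyl (mul_nonneg (h.nonneg _) (hw _))).trans_lt
        (mul_lt_mul_of_pos_right (hxl.lt_of_ne hxF) hg0)
  · rw [h.zero]; exact hpos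

include hw0

/-- The Gauss seminorm is multiplicative. -/
lemma IsMulSeminorm.gauss [UniqueSums M] : IsMulSeminorm K (gauss (M := M) ν w) where
  nonneg := gauss_nonneg h hw
  mul f g := le_antisymm (gauss_mul_le h hw hwadd f g) (le_gauss_mul h hw hwadd f g)
  add_le := gauss_add_le h hw
  algebraMap c := by
    rw [AddMonoidAlgebra.coe_algebraMap, Function.comp_apply, gauss_single h hw, hw0, mul_one,
      h.algebraMap]

end Gauss

/-! ### Seminorms of closed discs around `1` on Laurent polynomials -/

section Disc

open Polynomial LaurentPolynomial

variable {K : Type*} [NormedField K] {A : Type*} [CommRing A] [Algebra K A] {ν : A → ℝ}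
  (h : IsMulSeminorm K ν) {r : ℝ}

/-- The Gauss seminorm of radius `r` on `A[X]` centred at `1`. -/
def polyDisc (ν : A → ℝ) (r : ℝ) (p : A[X]) : ℝ :=
  gauss ν (fun k : ℕ => r ^ k) (taylor 1 p).toFinsupp

/-- The extension of `polyDisc` to Laurent polynomials for which `T` has value `1`. -/
def laurentDisc (ν : A → ℝ) (r : ℝ) (f : A[T;T⁻¹]) : ℝ :=
  polyDisc ν r (LaurentPolynomial.exists_T_pow f).choose_spec.choose

include h

/-- Taylor expansion at `1` is an algebra homomorphism, so multiplicativity is pulled back from the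
Gauss seminorm with weights `r ^ k`. -/
lemma isMulSeminorm_polyDisc (hr : 0 ≤ r) : IsMulSeminorm K (polyDisc ν r) :=
  (h.gauss (w := fun k : ℕ => r ^ k) (fun k => pow_nonneg hr k) (pow_zero r) (pow_add r)).comp
    (((toFinsuppIsoAlg A).toAlgHom.comp (taylorAlgHom 1)).restrictScalars K)

lemma polyDisc_C (hr : 0 ≤ r) (a : A) : polyDisc ν r (Polynomial.C a) = ν a := by
  rw [polyDisc, taylor_C, toFinsupp_C, gauss_single h fun k => pow_nonneg hr k, pow_zero, mul_one]

/-- Around `1` the variable is `1 + (X - 1)`, of value `max 1 r`; this is where `r ≤ 1` enters. -/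
lemma polyDisc_X (hr : 0 ≤ r) (hr1 : r ≤ 1) : polyDisc ν r (X : A[X]) = 1 := by
  have hw : ∀ k : ℕ, 0 ≤ r ^ k := fun k => pow_nonneg hr k
  rw [polyDisc, taylor_X]
  refine le_antisymm (gauss_le zero_le_one fun m => ?_) ?_
  · refine mul_le_one₀ ?_ (hw m) (pow_le_one₀ hr hr1)
    change ν ((X + Polynomial.C 1 : A[X]).coeff m) ≤ 1
    rw [coeff_add, coeff_X, coeff_C]
    refine (h.add_le _ _).trans (max_le ?_ ?_) <;> split_ifs <;> simp [h.one, h.zero]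
  · refine le_trans (le_of_eq ?_) (le_gauss h _ _ 0)
    change 1 = ν ((X + Polynomial.C 1 : A[X]).coeff 0) * r ^ 0
    simp [h.one]

lemma polyDisc_mul_X_pow (hr : 0 ≤ r) (hr1 : r ≤ 1) (p : A[X]) (n : ℕ) :
    polyDisc ν r (p * X ^ n) = polyDisc ν r p := by
  have h' := isMulSeminorm_polyDisc h hr
  rw [h'.mul, h'.pow, polyDisc_X h hr hr1, one_pow, mul_one]

/-- Since `X` has value `1`, clearing denominators by a different power of `T` does not change the
value, so the choices in `laurentDisc` are irrelevant. -/
lemma laurentDisc_eq (hr : 0 ≤ r) (hr1 : r ≤ 1) {f : A[T;T⁻¹]} {p : A[X]} {n : ℕ}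
    (hp : toLaurent p = f * T n) : laurentDisc ν r f = polyDisc ν r p := by
  have hq := (LaurentPolynomial.exists_T_pow f).choose_spec.choose_spec
  set m := (LaurentPolynomial.exists_T_pow f).choose
  rw [laurentDisc]
  set q := (LaurentPolynomial.exists_T_pow f).choose_spec.choose
  rw [← polyDisc_mul_X_pow h hr hr1 q n, ← polyDisc_mul_X_pow h hr hr1 p m]
  congr 1
  apply toLaurent_injective
  rw [map_mul, map_mul, toLaurent_X_pow, toLaurent_X_pow, hp, hq, mul_assoc, mul_assoc,
    ← T_add, ← T_add, add_comm]

lemma isMulSeminorm_laurentDisc (hr : 0 ≤ r) (hr1 : r ≤ 1) :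
    IsMulSeminorm K (laurentDisc ν r) := by
  have h' := isMulSeminorm_polyDisc h hr
  refine ⟨fun f => h'.nonneg _, fun f g => ?_, fun f g => ?_, fun c => ?_⟩
  · obtain ⟨n, p, hp⟩ := f.exists_T_pow
    obtain ⟨m, q, hq⟩ := g.exists_T_pow
    rw [laurentDisc_eq h hr hr1 hp, laurentDisc_eq h hr hr1 hq, ← h'.mul]
    refine laurentDisc_eq h hr hr1 (n := n + m) ?_
    rw [map_mul, hp, hq, mul_mul_mul_comm, ← T_add, Nat.cast_add]
  · obtain ⟨n, p, hp⟩ := f.exists_T_pow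
    obtain ⟨m, q, hq⟩ := g.exists_T_pow
    have hp' : toLaurent (p * X ^ m) = f * T (n + m : ℕ) := by
      rw [map_mul, toLaurent_X_pow, hp, mul_assoc, ← T_add, Nat.cast_add]
    have hq' : toLaurent (q * X ^ n) = g * T (n + m : ℕ) := by
      rw [map_mul, toLaurent_X_pow, hq, mul_assoc, ← T_add, Nat.cast_add, add_comm]
    rw [laurentDisc_eq h hr hr1 hp', laurentDisc_eq h hr hr1 hq',
      laurentDisc_eq h hr hr1 (n := n + m) (p := p * X ^ m + q * X ^ n)]
    · exact h'.add_le _ _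
    · rw [map_add, hp', hq', add_mul]
  · rw [laurentDisc_eq h hr hr1 (n := 0) (p := Polynomial.C (algebraMap K A c)),
      polyDisc_C h hr, h.algebraMap]
    rw [toLaurent_C, Nat.cast_zero, T_zero, mul_one, LaurentPolynomial.algebraMap_apply]

lemma laurentDisc_single (hr : 0 ≤ r) (hr1 : r ≤ 1) (j : ℤ) (a : A) :
    laurentDisc ν r (AddMonoidAlgebra.single j a) = ν a := by
  have h' := isMulSeminorm_polyDisc h hr
  obtain ⟨n, hn⟩ : ∃ n : ℕ, 0 ≤ j + n := ⟨j.natAbs, by lia⟩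
  rw [laurentDisc_eq h hr hr1 (n := n) (p := Polynomial.C a * X ^ (j + n).toNat),
    polyDisc_mul_X_pow h hr hr1, polyDisc_C h hr]
  rw [toLaurent_C_mul_X_pow, Int.toNat_of_nonneg hn, single_eq_C_mul_T, mul_assoc, ← T_add]

/-- The disc of radius `0` is the point `1`: by the convention `0 ^ 0 = 1` only the constant Taylor
coefficient survives. -/
lemma polyDisc_zero (p : A[X]) : polyDisc ν 0 p = ν (p.eval 1) := by
  rw [← taylor_coeff_zero, polyDisc]
  refine le_antisymm (gauss_le (h.nonneg _) fun m => ?_) ?_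
  · rcases m with _ | m
    · rw [pow_zero, mul_one]
      exact le_rfl
    · simp [h.nonneg]
  · refine le_trans (le_of_eq ?_) (le_gauss h _ _ 0)
    rw [pow_zero, mul_one]
    rfl

lemma le_polyDisc (p : A[X]) : ν (p.eval 1) ≤ polyDisc ν r p := by
  rw [← taylor_coeff_zero, polyDisc]
  refine le_trans (le_of_eq ?_) (le_gauss h _ _ 0)
  rw [pow_zero, mul_one]
  rfl

/-- In the ultrametric setting the unit discs around `1` and `0` agree. Re-expanding at `0`
multiplies the Taylor coefficients by signed binomial coefficients, and integers have value at most
`1`. -/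
lemma le_polyDisc_one (p : A[X]) (k : ℕ) : ν (p.coeff k) ≤ polyDisc ν 1 p := by
  have h1 := isMulSeminorm_polyDisc h zero_le_one
  have hp : p = taylor (-1) (taylor 1 p) := by rw [taylor_taylor, neg_add_cancel, taylor_zero]
  set q := taylor 1 p with hq
  have hqk : ∀ i, ν (q.coeff i) ≤ polyDisc ν 1 p := fun i => by
    refine le_trans (le_of_eq ?_) (le_gauss h _ _ i)
    rw [one_pow, mul_one]
    rfl
  rw [show p.coeff k = _ from congrArg (coeff · k) hp, taylor_coeff, hasseDeriv_apply, sum_def, eval_finsetSum]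
  refine h.sum_le _ _ (h1.nonneg _) fun i _ => ?_
  rw [eval_monomial, h.mul, h.pow, h.neg, h.one, one_pow, mul_one, h.mul]
  refine (mul_le_of_le_one_left (h.nonneg _) ?_).trans (hqk i)
  have : ∀ n : ℕ, ν (n : A) ≤ 1 := fun n => by
    induction n with
    | zero => simp [h.zero]
    | succ n ih => rw [Nat.cast_succ]; exact (h.add_le _ _).trans (max_le ih h.one.le)
  exact this _

end Disc

/-! ### The flow of a one-parameter subgroup -/

section Flow

open Polynomial LaurentPolynomial

variable {K : Type*} [NormedField K] {M M' : Type*} [AddCommMonoid M] [AddCommMonoid M']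

variable (K) in
/-- The grading coaction `χ^m ↦ χ^m T^{d(m)}` on `K[M]` defined by `d : M → ℤ`. -/
def gradingCoaction (d : M →+ ℤ) :
    AddMonoidAlgebra K M →ₐ[K] (AddMonoidAlgebra K M)[T;T⁻¹] :=
  AddMonoidAlgebra.lift K _ _
    { toFun := fun m => AddMonoidAlgebra.single (d m.toAdd) (AddMonoidAlgebra.single m.toAdd 1)
      map_one' := by
        rw [toAdd_one, map_zero]
        rfl
      map_mul' := fun a b => by
        rw [toAdd_mul, map_add, AddMonoidAlgebra.single_mul_single,
          AddMonoidAlgebra.single_mul_single, one_mul] }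

lemma gradingCoaction_single (d : M →+ ℤ) (m : M) (a : K) :
    gradingCoaction K d (AddMonoidAlgebra.single m a) =
      AddMonoidAlgebra.single (d m) (AddMonoidAlgebra.single m a) := by
  rw [gradingCoaction, AddMonoidAlgebra.lift_single]
  change a • AddMonoidAlgebra.single (d m) (AddMonoidAlgebra.single m (1 : K)) = _
  rw [AddMonoidAlgebra.smul_single, AddMonoidAlgebra.smul_single, smul_eq_mul, mul_one]

/-- Translation of a seminorm by the generic point of the disc of radius `r` around `1` in the
one-parameter subgroup given by `d`. -/
def flow (d : M →+ ℤ) (r : ℝ) (ν : AddMonoidAlgebra K M → ℝ) (f : AddMonoidAlgebra K M) : ℝ :=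
  laurentDisc ν r (gradingCoaction K d f)

/-- The part of degree `j` of an element of `K[M]`. -/
def gradedPart (d : M →+ ℤ) (j : ℤ) (f : AddMonoidAlgebra K M) : AddMonoidAlgebra K M :=
  (gradingCoaction K d f).coeff j

lemma gradedPart_single (d : M →+ ℤ) (j : ℤ) (m : M) (a : K) :
    gradedPart d j (AddMonoidAlgebra.single m a) =
      if d m = j then AddMonoidAlgebra.single m a else 0 := by
  rw [gradedPart, gradingCoaction_single, AddMonoidAlgebra.coeff_single, Finsupp.single_apply]

lemma coeff_gradedPart (d : M →+ ℤ) (j : ℤ) (f : AddMonoidAlgebra K M) (m : M) :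
    (gradedPart d j f).coeff m = if d m = j then f.coeff m else 0 := by
  classical
  induction f using AddMonoidAlgebra.induction_linear with
  | zero => simp [gradedPart]
  | add f g hf hg =>
    have : gradedPart d j (f + g) = gradedPart d j f + gradedPart d j g := by
      simp [gradedPart]
    rw [this, AddMonoidAlgebra.coeff_add, Finsupp.add_apply, hf, hg]
    split_ifs <;> simp
  | single x a =>
    rw [gradedPart_single]
    by_cases hx : x = m
    · subst hx
      split_ifs <;> simp
    · split_ifs <;> simp [hx]

/-- The value of the Laurent polynomial `gradingCoaction K d f` at `T = 1` is `f`. -/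
lemma eval_one_of_toLaurent_eq (d : M →+ ℤ) {f : AddMonoidAlgebra K M}
    {p : (AddMonoidAlgebra K M)[X]} {n : ℕ} (hp : toLaurent p = gradingCoaction K d f * T n) :
    p.eval 1 = f := by
  have h1 := congrArg (LaurentPolynomial.eval₂ (RingHom.id (AddMonoidAlgebra K M)) 1) hp
  -- Setting `T = 1` forgets the grading; here `T` is specialized to the unit `1`.
  have h2 : ∀ g : AddMonoidAlgebra K M,
      LaurentPolynomial.eval₂ (RingHom.id _) 1 (gradingCoaction K d g) = g := fun g => by
    induction g using AddMonoidAlgebra.induction_linear with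
    | zero => simp
    | add f g hf hg => rw [map_add, map_add, hf, hg]
    | single m a =>
      rw [gradingCoaction_single, single_eq_C_mul_T, map_mul, LaurentPolynomial.eval₂_C, eval₂_T]
      simp
  rw [eval₂_toLaurent, map_mul, h2, eval₂_T] at h1
  rw [one_zpow, Units.val_one, mul_one] at h1
  exact h1

section

variable {ν : AddMonoidAlgebra K M → ℝ} (h : IsMulSeminorm K ν) {r : ℝ} (d : M →+ ℤ)

include h

lemma IsMulSeminorm.flow (hr : 0 ≤ r) (hr1 : r ≤ 1) : IsMulSeminorm K (flow d r ν) :=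
  (isMulSeminorm_laurentDisc h hr hr1).comp (gradingCoaction K d)

lemma flow_single (hr : 0 ≤ r) (hr1 : r ≤ 1) (m : M) (a : K) :
    ToricTrop.flow d r ν (AddMonoidAlgebra.single m a) = ν (AddMonoidAlgebra.single m a) := by
  rw [ToricTrop.flow, gradingCoaction_single, laurentDisc_single h hr hr1]

lemma flow_zero : ToricTrop.flow d 0 ν = ν := by
  funext f
  obtain ⟨n, p, hp⟩ := (gradingCoaction K d f).exists_T_pow
  rw [ToricTrop.flow, laurentDisc_eq h le_rfl zero_le_one hp, polyDisc_zero h,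
    eval_one_of_toLaurent_eq d hp]

/-- The constant Taylor coefficient at `T = 1` of the coaction of `f` is `f` itself, up to the
harmless power of `T`. -/
lemma le_flow (hr : 0 ≤ r) (hr1 : r ≤ 1) (f : AddMonoidAlgebra K M) :
    ν f ≤ ToricTrop.flow d r ν f := by
  obtain ⟨n, p, hp⟩ := (gradingCoaction K d f).exists_T_pow
  rw [ToricTrop.flow, laurentDisc_eq h hr hr1 hp]
  exact (congrArg ν (eval_one_of_toLaurent_eq d hp)).symm.le.trans (le_polyDisc h p)

/-- The unit disc seminorm bounds every coefficient in `T`, and these coefficients are the graded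
parts. -/
lemma gradedPart_le_flow_one (j : ℤ) (f : AddMonoidAlgebra K M) :
    ν (gradedPart d j f) ≤ ToricTrop.flow d 1 ν f := by
  obtain ⟨n, p, hp⟩ := (gradingCoaction K d f).exists_T_pow
  -- The degree `j` may be so negative that `j + n` is not an exponent of a polynomial; an
  -- additional shift by `k` repairs this.
  obtain ⟨k, hk⟩ : ∃ k : ℕ, 0 ≤ j + n + k := ⟨(j + n).natAbs, by lia⟩
  have hp' : toLaurent (p * X ^ k) = gradingCoaction K d f * T (n + k : ℕ) := by
    rw [map_mul, toLaurent_X_pow, hp, mul_assoc, ← T_add, Nat.cast_add]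
  rw [ToricTrop.flow, laurentDisc_eq h zero_le_one le_rfl hp']
  refine le_trans (le_of_eq ?_) (le_polyDisc_one h _ (j + n + k).toNat)
  rw [gradedPart]
  congr 1
  have h1 := congrArg (fun q : (AddMonoidAlgebra K M)[T;T⁻¹] => q.coeff (j + n + k)) hp'
  have h2 : (toLaurent (p * X ^ k)).coeff (j + n + k) = (p * X ^ k).coeff (j + n + k).toNat := by
    rw [coeff_toLaurent]
    nth_rewrite 1 [← Int.toNat_of_nonneg hk]
    exact Finsupp.mapDomain_apply Nat.castEmbedding.injective _ _
  have h3 : (gradingCoaction K d f * T (n + k : ℕ)).coeff (j + n + k) =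
      (gradingCoaction K d f).coeff j := by
    rw [T, Nat.cast_add, add_assoc, AddMonoidAlgebra.coeff_mul_single_add, mul_one]
  exact h3.symm.trans (h1.symm.trans h2)

end

lemma gradingCoaction_mapDomain {φ : M →+ M'} {d : M →+ ℤ} {d' : M' →+ ℤ}
    (hd : ∀ m, d' (φ m) = d m) (f : AddMonoidAlgebra K M) :
    gradingCoaction K d' (AddMonoidAlgebra.mapDomainAlgHom K K φ f) =
      AddMonoidAlgebra.mapRingHom ℤ (AddMonoidAlgebra.mapDomainAlgHom K K φ).toRingHom
        (gradingCoaction K d f) := by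
  induction f using AddMonoidAlgebra.induction_linear with
  | zero => simp
  | add f g hf hg => rw [map_add, map_add, map_add, map_add, hf, hg]
  | single m a =>
    rw [gradingCoaction_single, AddMonoidAlgebra.mapRingHom_single]
    change gradingCoaction K d' (AddMonoidAlgebra.mapDomain φ (AddMonoidAlgebra.single m a)) =
      AddMonoidAlgebra.single (d m) (AddMonoidAlgebra.mapDomain φ (AddMonoidAlgebra.single m a))
    rw [AddMonoidAlgebra.mapDomain_single, gradingCoaction_single, hd]

lemma toLaurent_map {A B : Type*} [CommRing A] [CommRing B] (φ : A →+* B) (p : A[X]) :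
    toLaurent (p.map φ) = AddMonoidAlgebra.mapRingHom ℤ φ (toLaurent p) := by
  induction p using Polynomial.induction_on' with
  | add p q hp hq => rw [Polynomial.map_add, map_add, map_add, map_add, hp, hq]
  | monomial n a =>
    rw [Polynomial.map_monomial, ← C_mul_X_pow_eq_monomial, ← C_mul_X_pow_eq_monomial,
      toLaurent_C_mul_X_pow, toLaurent_C_mul_X_pow, ← single_eq_C_mul_T, ← single_eq_C_mul_T,
      AddMonoidAlgebra.mapRingHom_single]

/-- The flow is compatible with homomorphisms of graded monoids. -/
lemma flow_mapDomain {ν : AddMonoidAlgebra K M' → ℝ} (h : IsMulSeminorm K ν) {φ : M →+ M'}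
    {d : M →+ ℤ} {d' : M' →+ ℤ} (hd : ∀ m, d' (φ m) = d m) {r : ℝ} (hr : 0 ≤ r) (hr1 : r ≤ 1) :
    flow d r (fun f => ν (AddMonoidAlgebra.mapDomainAlgHom K K φ f)) =
      fun f => flow d' r ν (AddMonoidAlgebra.mapDomainAlgHom K K φ f) := by
  funext f
  obtain ⟨n, p, hp⟩ := (gradingCoaction K d f).exists_T_pow
  rw [flow, flow, laurentDisc_eq (h.comp _) hr hr1 hp,
    laurentDisc_eq h hr hr1 (n := n) (p := p.map (AddMonoidAlgebra.mapDomainAlgHom K K φ).toRingHom)]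
  -- The centre `1` is written as the image of `1`, so that Taylor expansion commutes with the
  -- change of coefficients.
  · rw [polyDisc, polyDisc, ← map_one (AddMonoidAlgebra.mapDomainAlgHom K K φ).toRingHom]
    change _ = gauss ν _ (taylor ((AddMonoidAlgebra.mapDomainAlgHom K K φ).toRingHom 1)
      (p.map (AddMonoidAlgebra.mapDomainAlgHom K K φ).toRingHom)).toFinsupp
    rw [← map_taylor]
    refine congrArg iSup (funext fun k => congrArg (· * r ^ k) ?_)
    exact congrArg ν (Polynomial.coeff_map (AddMonoidAlgebra.mapDomainAlgHom K K φ).toRingHom k).symm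
  · rw [toLaurent_map, hp, map_mul, gradingCoaction_mapDomain hd, T,
      AddMonoidAlgebra.mapRingHom_single, map_one]
    rfl

end Flow

/-! ### The space of multiplicative seminorms -/

section SeminormSpace

/-- The multiplicative seminorms on `A` extending the norm of `K`, with the topology of pointwise
convergence. -/
abbrev SeminormSpace (K : Type*) [NormedField K] (A : Type*) [CommRing A] [Algebra K A] :=
  {ν : A → ℝ // IsMulSeminorm K ν}

variable {K : Type*} [NormedField K]

lemma SeminormSpace.continuous_eval {A : Type*} [CommRing A] [Algebra K A] (a : A) :
    Continuous fun x : SeminormSpace K A => x.1 a :=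
  (continuous_apply a).comp continuous_subtype_val

lemma SeminormSpace.continuous_iff {A : Type*} [CommRing A] [Algebra K A] {Z : Type*}
    [TopologicalSpace Z] {f : Z → SeminormSpace K A} :
    Continuous f ↔ ∀ a, Continuous fun z => (f z).1 a :=
  continuous_induced_rng.trans continuous_pi_iff

variable {M : Type*} [AddCommMonoid M]

/-- The composite of the flows of a list of one-parameter subgroups. -/
def flowList (l : List (M →+ ℤ)) (r : unitInterval) :
    SeminormSpace K (AddMonoidAlgebra K M) → SeminormSpace K (AddMonoidAlgebra K M) :=
  l.foldr (fun d F x => ⟨flow d r (F x).1, (F x).2.flow d r.2.1 r.2.2⟩) id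

lemma flowList_cons (d : M →+ ℤ) (l : List (M →+ ℤ)) (r : unitInterval)
    (x : SeminormSpace K (AddMonoidAlgebra K M)) :
    (flowList (d :: l) r x).1 = flow d r (flowList l r x).1 := rfl

lemma flowList_single (l : List (M →+ ℤ)) (r : unitInterval)
    (x : SeminormSpace K (AddMonoidAlgebra K M)) (m : M) (a : K) :
    (flowList l r x).1 (AddMonoidAlgebra.single m a) = x.1 (AddMonoidAlgebra.single m a) := by
  induction l with
  | nil => rfl
  | cons d l ih => rw [flowList_cons, flow_single (flowList l r x).2 d r.2.1 r.2.2, ih]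

lemma flowList_zero (l : List (M →+ ℤ)) (x : SeminormSpace K (AddMonoidAlgebra K M)) :
    flowList l 0 x = x := by
  induction l with
  | nil => rfl
  | cons d l ih =>
    refine Subtype.ext ?_
    rw [flowList_cons, ih]
    exact flow_zero x.2 d

lemma le_flowList (l : List (M →+ ℤ)) (r : unitInterval)
    (x : SeminormSpace K (AddMonoidAlgebra K M)) (f : AddMonoidAlgebra K M) :
    x.1 f ≤ (flowList l r x).1 f := by
  induction l with
  | nil => exact le_rfl
  | cons d l ih =>
    exact ih.trans (le_flow (flowList l r x).2 d r.2.1 r.2.2 f)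

/-- Each `d` in the list permits passing to the part of degree `d m`. When the list separates `m`
from all other exponents, only the monomial at `m` is left. -/
lemma le_flowList_one (l : List (M →+ ℤ)) (x : SeminormSpace K (AddMonoidAlgebra K M)) (m : M)
    (hm : ∀ m', (∀ d ∈ l, d m' = d m) → m' = m) (f : AddMonoidAlgebra K M) :
    x.1 (AddMonoidAlgebra.single m (f.coeff m)) ≤ (flowList l 1 x).1 f := by
  classical
  -- The induction needs a condition on the element instead of on the list: a shorter list may fail
  -- to separate points, but the graded part has already lost the exponents distinguished by `d`.
  suffices H : ∀ g : AddMonoidAlgebra K M, (∀ m', (∀ d ∈ l, d m' = d m) → m' ≠ m → g.coeff m' = 0) →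
      x.1 (AddMonoidAlgebra.single m (g.coeff m)) ≤ (flowList l 1 x).1 g from
    H f fun m' h1 h2 => absurd (hm m' h1) h2
  clear hm
  induction l with
  | nil =>
    intro g hg
    refine le_of_eq (congrArg x.1 ?_)
    ext m'
    rw [AddMonoidAlgebra.coeff_single, Finsupp.single_apply]
    split_ifs with e
    · rw [e]
    · exact (hg m' (by simp) (Ne.symm e)).symm
  | cons d l ih =>
    intro g hg
    refine le_trans ?_ (gradedPart_le_flow_one (flowList l 1 x).2 d (d m) g)
    have := ih (gradedPart d (d m) g) ?_
    · rwa [coeff_gradedPart, if_pos rfl] at this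
    · intro m' h1 h2
      rw [coeff_gradedPart]
      split_ifs with e
      · exact hg m' (by simpa [e] using h1) h2
      · rfl

/-- For fixed `f` the cleared polynomial and its Taylor coefficients do not depend on the radius or
the seminorm, so the value is a maximum of finitely many jointly continuous functions. -/
lemma continuous_flow (d : M →+ ℤ) :
    Continuous fun p : unitInterval × SeminormSpace K (AddMonoidAlgebra K M) =>
      (⟨flow d p.1 p.2.1, p.2.2.flow d p.1.2.1 p.1.2.2⟩ :
        SeminormSpace K (AddMonoidAlgebra K M)) := by
  refine SeminormSpace.continuous_iff.2 fun f => ?_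
  obtain ⟨n, p, hp⟩ := (gradingCoaction K d f).exists_T_pow
  set q := Polynomial.taylor 1 p
  have heq : (fun z : unitInterval × SeminormSpace K (AddMonoidAlgebra K M) => flow d z.1 z.2.1 f) =
      fun z => (Finset.range (q.natDegree + 1)).sup' ⟨0, by simp⟩
        fun k => z.2.1 (q.coeff k) * (z.1 : ℝ) ^ k := by
    funext z
    rw [flow, laurentDisc_eq z.2.2 z.1.2.1 z.1.2.2 hp, polyDisc, gauss_eq_sup' z.2.2 (fun k => pow_nonneg z.1.2.1 k)]
    · rfl
    · exact Polynomial.supp_subset_range_natDegree_succ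
  change Continuous fun z : unitInterval × SeminormSpace K (AddMonoidAlgebra K M) => flow d z.1 z.2.1 f
  rw [heq]
  refine Continuous.finset_sup'_apply _ fun k _ => ?_
  exact ((SeminormSpace.continuous_eval _).comp continuous_snd).mul
    ((continuous_subtype_val.comp continuous_fst).pow k)

lemma continuous_flowList (l : List (M →+ ℤ)) :
    Continuous fun p : unitInterval × SeminormSpace K (AddMonoidAlgebra K M) =>
      flowList l p.1 p.2 := by
  induction l with
  | nil => exact continuous_snd
  | cons d l ih => exact (continuous_flow d).comp (continuous_fst.prodMk ih)

end SeminormSpace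

/-! ### Pullback of seminorms -/

section Comap

variable {K : Type*} [NormedField K] {A B C : Type*} [CommRing A] [Algebra K A] [CommRing B]
  [Algebra K B] [CommRing C] [Algebra K C]

/-- The pullback of seminorms along a homomorphism of `K`-algebras. -/
def SeminormSpace.comap (f : A →ₐ[K] B) (x : SeminormSpace K B) : SeminormSpace K A :=
  ⟨fun a => x.1 (f a), x.2.comp f⟩

/-- This compatibility lets the flows on the charts glue. -/
lemma flowList_comap {M M' : Type*} [AddCommMonoid M] [AddCommMonoid M'] (φ : M →+ M') {ι : Type*}
    {d : ι → M →+ ℤ} {d' : ι → M' →+ ℤ} (hd : ∀ i m, d' i (φ m) = d i m) (l : List ι)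
    (r : unitInterval) (x : SeminormSpace K (AddMonoidAlgebra K M')) :
    flowList (l.map d) r (x.comap (AddMonoidAlgebra.mapDomainAlgHom K K φ)) =
      (flowList (l.map d') r x).comap (AddMonoidAlgebra.mapDomainAlgHom K K φ) := by
  induction l with
  | nil => rfl
  | cons i l ih =>
    refine Subtype.ext ?_
    rw [List.map_cons, List.map_cons, flowList_cons, ih]
    exact flow_mapDomain (flowList (l.map d') r x).2 (hd i) r.2.1 r.2.2

end Comap

/-! ### Extended real weights -/

lemma expNeg_top : expNeg ⊤ = 0 := rfl

lemma expNeg_coe (t : ℝ) : expNeg t = Real.exp (-t) := rfl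

lemma expNeg_zero : expNeg 0 = 1 := by
  change Real.exp (-0) = 1
  simp

lemma expNeg_nonneg (t : WithTop ℝ) : 0 ≤ expNeg t := by
  induction t using WithTop.recTopCoe with
  | top => exact le_rfl
  | coe t => exact (Real.exp_pos _).le

lemma expNeg_add (s t : WithTop ℝ) : expNeg (s + t) = expNeg s * expNeg t := by
  induction s using WithTop.recTopCoe with
  | top => simp [expNeg_top]
  | coe s =>
    induction t using WithTop.recTopCoe with
    | top => simp [expNeg_top]
    | coe t => rw [← WithTop.coe_add, expNeg_coe, expNeg_coe, expNeg_coe, neg_add, Real.exp_add]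

lemma negLog_expNeg (t : WithTop ℝ) : negLog (expNeg t) = t := by
  induction t using WithTop.recTopCoe with
  | top => simp [expNeg_top, negLog]
  | coe t => simp [expNeg_coe, negLog, Real.exp_ne_zero]

lemma expNeg_negLog {r : ℝ} (hr : 0 ≤ r) : expNeg (negLog r) = r := by
  rcases hr.eq_or_lt with rfl | hr
  · simp [negLog, expNeg_top]
  · rw [negLog, if_neg hr.ne', expNeg_coe, neg_neg, Real.exp_log hr]

/-- Continuity holds on all of `ℝ` since `Real.log` depends only on the absolute value; at `0`, the
bound `|x| < e^{-i}` forces `-log |x| > i`. -/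
lemma continuous_negLog : Continuous negLog := by
  refine continuous_iff_continuousAt.2 fun r => ?_
  by_cases hr : r = 0
  · subst hr
    have h0 : negLog 0 = ⊤ := by simp [negLog]
    rw [ContinuousAt, h0, WithTop.tendsto_nhds_top_iff]
    intro i
    have hball : Metric.ball (0 : ℝ) (Real.exp (-i)) ∈ nhds (0 : ℝ) :=
      Metric.ball_mem_nhds _ (Real.exp_pos _)
    filter_upwards [hball] with x hx
    rw [negLog]
    split_ifs with hx0
    · exact WithTop.coe_lt_top i
    · rw [mem_ball_zero_iff, Real.norm_eq_abs] at hx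
      rw [WithTop.coe_lt_coe, ← Real.log_abs]
      have := (Real.log_lt_iff_lt_exp (abs_pos.2 hx0)).2 hx
      linarith
  · have h1 : ContinuousAt (fun x : ℝ => ((-Real.log x : ℝ) : WithTop ℝ)) r :=
      WithTop.continuous_coe.continuousAt.comp (Real.continuousAt_log hr).neg
    refine h1.congr ?_
    filter_upwards [isOpen_ne.mem_nhds hr] with x hx
    rw [negLog, if_neg hx]

lemma continuous_expNeg : Continuous expNeg := by
  refine continuous_iff_continuousAt.2 fun t => ?_
  induction t using WithTop.recTopCoe with
  | top =>
    rw [ContinuousAt, expNeg_top, Metric.tendsto_nhds]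
    intro ε hε
    have h1 : Set.Ioi (((-Real.log ε : ℝ)) : WithTop ℝ) ∈ nhds (⊤ : WithTop ℝ) :=
      isOpen_Ioi.mem_nhds (WithTop.coe_lt_top _)
    filter_upwards [h1] with x hx
    rw [Real.dist_eq, sub_zero, abs_of_nonneg (expNeg_nonneg x)]
    induction x using WithTop.recTopCoe with
    | top => exact hε
    | coe x =>
      have hx' := WithTop.coe_lt_coe.1 hx
      rw [expNeg_coe, ← Real.lt_log_iff_exp_lt hε]
      linarith
  | coe t =>
    rw [← WithTop.isOpenEmbedding_coe.continuousAt_iff]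
    exact (Real.continuous_exp.comp continuous_neg).continuousAt

/-! ### Gauss points and tropicalization on `K[M]` -/

section GaussPoint

variable {K : Type*} [NormedField K] [IsUltrametricDist K] {M : Type*} [AddCommMonoid M]

variable (K) in
lemma isMulSeminorm_norm : IsMulSeminorm K (norm : K → ℝ) where
  nonneg := norm_nonneg
  mul := norm_mul
  add_le := IsUltrametricDist.norm_add_le_max
  algebraMap _ := rfl

variable (K) in
/-- The Gauss point `∑ a_m χ^m ↦ sup ‖a_m‖ e^{-u(m)}` of `u ∈ Hom(M, ℝ ∪ {∞})`. -/
def gaussPoint [UniqueSums M] (u : M →+ WithTop ℝ) : SeminormSpace K (AddMonoidAlgebra K M) :=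
  ⟨gauss norm fun m => expNeg (u m), (isMulSeminorm_norm K).gauss (fun m => expNeg_nonneg _)
    (by rw [map_zero, expNeg_zero]) fun a b => by rw [map_add, expNeg_add]⟩

omit [IsUltrametricDist K] in
/-- The tropicalization `m ↦ -log |χ^m|` of a seminorm. -/
def tropPoint (x : SeminormSpace K (AddMonoidAlgebra K M)) : M →+ WithTop ℝ where
  toFun m := negLog (x.1 (AddMonoidAlgebra.single m 1))
  map_zero' := by
    rw [← negLog_one, ← x.2.one]
    rfl
  map_add' a b := by
    rw [← negLog_mul, ← x.2.mul, AddMonoidAlgebra.single_mul_single, one_mul]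

lemma gaussPoint_single [UniqueSums M] (u : M →+ WithTop ℝ) (m : M) (a : K) :
    (gaussPoint K u).1 (AddMonoidAlgebra.single m a) = ‖a‖ * expNeg (u m) :=
  gauss_single (isMulSeminorm_norm K) (fun m => expNeg_nonneg (u m)) m a

lemma tropPoint_gaussPoint [UniqueSums M] (u : M →+ WithTop ℝ) :
    tropPoint (gaussPoint K u) = u := by
  ext m
  change negLog ((gaussPoint K u).1 (AddMonoidAlgebra.single m 1)) = _
  rw [gaussPoint_single, norm_one, one_mul, negLog_expNeg]

omit [IsUltrametricDist K] in
lemma SeminormSpace.apply_single (x : SeminormSpace K (AddMonoidAlgebra K M)) (m : M) (a : K) :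
    x.1 (AddMonoidAlgebra.single m a) = ‖a‖ * expNeg (tropPoint x m) := by
  have h1 : AddMonoidAlgebra.single m a =
      algebraMap K (AddMonoidAlgebra K M) a * AddMonoidAlgebra.single m 1 := by
    rw [← Algebra.smul_def, AddMonoidAlgebra.smul_single, smul_eq_mul, mul_one]
  rw [h1, x.2.mul, x.2.algebraMap]
  exact congrArg _ (expNeg_negLog (x.2.nonneg _)).symm

/-- The tropicalization fixes the values on monomials, and the ultrametric inequality bounds a sum
by its largest monomial. Thus the Gauss point is the maximum of its fibre. -/
lemma SeminormSpace.le_gaussPoint [UniqueSums M] (x : SeminormSpace K (AddMonoidAlgebra K M))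
    (f : AddMonoidAlgebra K M) : x.1 f ≤ (gaussPoint K (tropPoint x)).1 f := by
  rw [show x.1 f = x.1 (f.coeff.sum AddMonoidAlgebra.single) by
    rw [AddMonoidAlgebra.sum_coeff_single]]
  refine x.2.sum_le _ _ ((gaussPoint K (tropPoint x)).2.nonneg f) fun m _ => ?_
  rw [x.apply_single]
  exact le_gauss (isMulSeminorm_norm K) (fun m => expNeg (tropPoint x m)) f m

omit [IsUltrametricDist K] in
lemma tropPoint_flowList (l : List (M →+ ℤ)) (r : unitInterval)
    (x : SeminormSpace K (AddMonoidAlgebra K M)) : tropPoint (flowList l r x) = tropPoint x := by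
  ext m
  change negLog _ = negLog _
  rw [flowList_single]

/-- The flow increases a seminorm without changing its tropicalization, and a Gauss point is already
maximal. -/
lemma flowList_gaussPoint [UniqueSums M] (l : List (M →+ ℤ)) (r : unitInterval)
    (u : M →+ WithTop ℝ) : flowList l r (gaussPoint K u) = gaussPoint K u := by
  refine Subtype.ext (funext fun f => le_antisymm ?_ (le_flowList l r _ f))
  have := (flowList l r (gaussPoint K u)).le_gaussPoint f
  rwa [tropPoint_flowList, tropPoint_gaussPoint] at this

/-- One inequality is maximality of the Gauss point. For the other, the list separates the elements
of `M`, so the final seminorm dominates each monomial of `f`. -/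
lemma flowList_one [UniqueSums M] (l : List (M →+ ℤ))
    (hl : ∀ m m' : M, (∀ d ∈ l, d m' = d m) → m' = m)
    (x : SeminormSpace K (AddMonoidAlgebra K M)) :
    flowList l 1 x = gaussPoint K (tropPoint x) := by
  refine Subtype.ext (funext fun f => le_antisymm ?_ ?_)
  · have := (flowList l 1 x).le_gaussPoint f
    rwa [tropPoint_flowList] at this
  · refine gauss_le ((flowList l 1 x).2.nonneg f) fun m => ?_
    rw [← x.apply_single]
    exact le_flowList_one l x m (hl m) f

/-- Injectivity of `φ` prevents distinct monomials from merging and cancelling; without it only `≤`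
would survive. -/
lemma gaussPoint_comap {M' : Type*} [AddCommMonoid M'] [UniqueSums M] [UniqueSums M'] (φ : M →+ M')
    (hφ : Function.Injective φ) (u : M' →+ WithTop ℝ) :
    (gaussPoint K u).comap (AddMonoidAlgebra.mapDomainAlgHom K K φ) =
      gaussPoint K (u.comp φ) := by
  refine Subtype.ext (funext fun f => le_antisymm ?_ ?_)
  · have h1 := ((gaussPoint K u).comap (AddMonoidAlgebra.mapDomainAlgHom K K φ)).le_gaussPoint f
    have h2 : tropPoint ((gaussPoint K u).comap (AddMonoidAlgebra.mapDomainAlgHom K K φ)) =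
        u.comp φ := by
      ext m
      change negLog ((gaussPoint K u).1 (AddMonoidAlgebra.mapDomain φ _)) = _
      rw [AddMonoidAlgebra.mapDomain_single, gaussPoint_single, norm_one, one_mul, negLog_expNeg]
      rfl
    rwa [h2] at h1
  · refine gauss_le ((gaussPoint K u).2.nonneg _) fun m => ?_
    have h1 : (AddMonoidAlgebra.mapDomain φ f).coeff (φ m) = f.coeff m :=
      Finsupp.mapDomain_apply hφ _ _
    rw [← h1]
    exact le_gauss (isMulSeminorm_norm K) (fun m => expNeg (u m)) (AddMonoidAlgebra.mapDomain φ f) (φ m)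

end GaussPoint

/-! ### Cones -/

section Cone

variable {N : Type u} [AddCommGroup N] [Module.Free ℤ N] [Module.Finite ℤ N]

/-- A basis embeds `M` in the finitely supported integer functions. This property of the lattice is
what makes Gauss seminorms multiplicative. -/
instance : UniqueSums (DualLattice N) :=
  UniqueSums.of_injective_addHom
    (Module.Free.chooseBasis ℤ (DualLattice N)).repr.toAddEquiv.toAddHom
    (Module.Free.chooseBasis ℤ (DualLattice N)).repr.injective inferInstance

instance (σ : PointedCone ℝ (RealSpace N)) : UniqueSums (dualMonoid σ) :=
  UniqueSums.of_injective_addHom (AddHomClass.toAddHom (dualMonoid σ).subtype)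
    Subtype.val_injective inferInstance

omit [Module.Free ℤ N] [Module.Finite ℤ N] in
/-- Evaluation of characters at a one-parameter subgroup. -/
def evalAt (σ : PointedCone ℝ (RealSpace N)) (n : N) : dualMonoid σ →+ ℤ :=
  (LinearMap.applyₗ n : (N →ₗ[ℤ] ℤ) →ₗ[ℤ] ℤ).toAddMonoidHom.comp (dualMonoid σ).subtype

variable (N) in
/-- The elements of a basis of `N`. -/
def latticeGenerators : List N := Finset.univ.toList.map (Module.Free.chooseBasis ℤ N)

lemma eq_of_evalAt_eq (σ : PointedCone ℝ (RealSpace N)) (m m' : dualMonoid σ)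
    (h : ∀ d ∈ (latticeGenerators N).map (evalAt σ), d m' = d m) : m' = m := by
  refine Subtype.ext ((Module.Free.chooseBasis ℤ N).ext fun i => ?_)
  exact h (evalAt σ _) (List.mem_map_of_mem (by simp [latticeGenerators]))

variable {K : Type*} [NormedField K]

omit [Module.Free ℤ N] [Module.Finite ℤ N] in
lemma continuous_tropPoint (σ : PointedCone ℝ (RealSpace N)) :
    Continuous (tropPoint : SeminormSpace K (AddMonoidAlgebra K (dualMonoid σ)) → AffineTrop σ) :=
  continuous_induced_rng.2 (continuous_pi fun _ =>
    continuous_negLog.comp (SeminormSpace.continuous_eval _))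

lemma continuous_gaussPoint [IsUltrametricDist K] (σ : PointedCone ℝ (RealSpace N)) :
    Continuous (gaussPoint K : AffineTrop σ → SeminormSpace K (AddMonoidAlgebra K (dualMonoid σ))) := by
  classical
  refine SeminormSpace.continuous_iff.2 fun f => ?_
  have heq : (fun u : AffineTrop σ => (gaussPoint K u).1 f) = fun u =>
      (insert 0 f.coeff.support).sup' ⟨0, by simp⟩ fun s => ‖f.coeff s‖ * expNeg (u s) :=
    funext fun u => gauss_eq_sup' (isMulSeminorm_norm K) (fun m => expNeg_nonneg (u m)) f _ _
      (Finset.subset_insert _ _)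
  rw [heq]
  refine Continuous.finset_sup'_apply _ fun s _ => continuous_const.mul (continuous_expNeg.comp ?_)
  exact (continuous_apply s).comp continuous_induced_dom

/-- A seminorm along which all `|χ^s|` converge has a limit: tropicalization is proper. -/
lemma exists_le_nhds_of_tropPoint [IsUltrametricDist K] (σ : PointedCone ℝ (RealSpace N))
    (F : Ultrafilter (SeminormSpace K (AddMonoidAlgebra K (dualMonoid σ)))) (u : AffineTrop σ)
    (hF : Filter.Tendsto (tropPoint : SeminormSpace K _ → AffineTrop σ) F (nhds u)) :
    ∃ x : SeminormSpace K (AddMonoidAlgebra K (dualMonoid σ)), tropPoint x = u ∧ F ≤ nhds x := by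
  -- Gauss values depend continuously on the tropicalization, so `x.1 f` eventually stays in a
  -- compact interval, where an ultrafilter converges.
  have hbd : ∀ f : AddMonoidAlgebra K (dualMonoid σ), ∃ c : ℝ,
      Filter.Tendsto (fun x : SeminormSpace K (AddMonoidAlgebra K (dualMonoid σ)) => x.1 f) F (nhds c) := by
    intro f
    have h1 : Filter.Tendsto (fun x : SeminormSpace K (AddMonoidAlgebra K (dualMonoid σ)) =>
        (gaussPoint K (tropPoint x)).1 f) F (nhds ((gaussPoint K u).1 f)) :=
      (((SeminormSpace.continuous_eval f).comp (continuous_gaussPoint σ)).tendsto u).comp hF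
    have h2 : ∀ᶠ x in (F : Filter (SeminormSpace K (AddMonoidAlgebra K (dualMonoid σ)))),
        x.1 f ∈ Set.Icc 0 ((gaussPoint K u).1 f + 1) := by
      filter_upwards [h1.eventually (gt_mem_nhds (lt_add_one _))] with x hx
      exact ⟨x.2.nonneg f, (x.le_gaussPoint f).trans hx.le⟩
    obtain ⟨c, -, hc⟩ := (isCompact_Icc (a := (0 : ℝ)) (b := (gaussPoint K u).1 f + 1)).ultrafilter_le_nhds
      (F.map fun x : SeminormSpace K _ => x.1 f) (Filter.le_principal_iff.2 h2)
    exact ⟨c, hc⟩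
  choose c hc using hbd
  -- The defining identities and inequalities are closed conditions and pass to the pointwise limit.
  have hsem : IsMulSeminorm K c := by
    refine ⟨fun a => ?_, fun a b => ?_, fun a b => ?_, fun a => ?_⟩
    · exact ge_of_tendsto' (hc a) fun x => x.2.nonneg a
    · exact tendsto_nhds_unique (hc (a * b)) (((hc a).mul (hc b)).congr fun x => (x.2.mul a b).symm)
    · exact le_of_tendsto_of_tendsto' (hc (a + b)) ((hc a).max (hc b)) fun x => x.2.add_le a b
    · exact tendsto_nhds_unique (hc _) (tendsto_const_nhds.congr fun x => (x.2.algebraMap a).symm)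
  have hle : (F : Filter (SeminormSpace K (AddMonoidAlgebra K (dualMonoid σ)))) ≤
      nhds (⟨c, hsem⟩ : SeminormSpace K _) := by
    rw [nhds_subtype_eq_comap, ← Filter.map_le_iff_le_comap]
    exact tendsto_pi_nhds.2 hc
  refine ⟨⟨c, hsem⟩, ?_, hle⟩
  ext s
  have h1 := ((continuous_tropPoint (K := K) σ).tendsto ⟨c, hsem⟩).mono_left hle
  have hev : Continuous fun u : AffineTrop σ => u s :=
    (continuous_apply s).comp continuous_induced_dom
  exact tendsto_nhds_unique ((hev.tendsto _).comp h1) ((hev.tendsto _).comp hF)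

end Cone

/-! ### Analytification: functoriality and open immersions -/

namespace Analytification

variable {K : Type u} [NormedField K] {X Y Z : Over (Spec (CommRingCat.of K))}

lemma abv_evaluation_surjective (X : Scheme.{u}) (x : X) (a : X.residueField x) :
    ∃ (U : X.Opens) (hx : x ∈ U) (f : Γ(X, U)), (X.evaluation U x hx).hom f = a := by
  obtain ⟨g, rfl⟩ := X.residue_surjective x a
  obtain ⟨U, hx, f, rfl⟩ := X.presheaf.exists_germ_eq g
  exact ⟨U, hx, f, rfl⟩

/-- Every element of a residue field is the value of a local function, so local functions determine
the absolute value. -/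
lemma ext_eval {x y : Analytification X} (hpt : x.pt = y.pt)
    (h : ∀ (U : X.left.Opens) (hx : x.pt ∈ U) (hy : y.pt ∈ U) (f : Γ(X.left, U)),
      x.eval U hx f = y.eval U hy f) : x = y := by
  obtain ⟨p, v, hv⟩ := x
  obtain ⟨q, w, hw⟩ := y
  obtain rfl : p = q := hpt
  have : v = w := by
    ext a
    obtain ⟨U, hx, f, rfl⟩ := abv_evaluation_surjective X.left p a
    exact h U hx hx f
  subst this
  rfl

lemma eval_map (f : X ⟶ Y) (x : Analytification X) (U : Y.left.Opens)
    (hx : (map f x).pt ∈ U) (s : Γ(Y.left, U)) :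
    (map f x).eval U hx s =
      x.eval (f.left ⁻¹ᵁ U) (show x.pt ∈ f.left ⁻¹ᵁ U from hx) ((f.left.app U).hom s) :=
  congrArg x.abv (Scheme.evaluation_naturality_apply f.left x.pt hx s)

lemma map_comp (f : X ⟶ Y) (g : Y ⟶ Z) (x : Analytification X) :
    map (f ≫ g) x = map g (map f x) := by
  refine ext_eval rfl fun U hx hy s => ?_
  refine (eval_map (f ≫ g) x U hx s).trans (Eq.trans ?_ (eval_map g (map f x) U hy s).symm)
  refine Eq.trans ?_ (eval_map f x (g.left ⁻¹ᵁ U) hy _).symm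
  rfl

lemma eval_res (x : Analytification X) {U V : X.left.Opens} (h : U ≤ V) (hx : x.pt ∈ U)
    (f : Γ(X.left, V)) :
    x.eval U hx ((X.left.presheaf.map (homOfLE h).op).hom f) = x.eval V (h hx) f := by
  unfold eval
  congr 1
  exact congrArg _ (X.left.presheaf.germ_res_apply (homOfLE h) x.pt hx f)

lemma isOpen_setOf_eval (U : X.left.Opens) (f : Γ(X.left, U)) {V : Set ℝ} (hV : IsOpen V) :
    IsOpen {x : Analytification X | ∃ hx : x.pt ∈ U, x.eval U hx f ∈ V} :=
  isOpen_generateFrom_of_mem ⟨U, f, V, hV, rfl⟩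

lemma isOpen_setOf_pt_mem (U : X.left.Opens) : IsOpen {x : Analytification X | x.pt ∈ U} := by
  convert isOpen_setOf_eval U 0 isOpen_univ using 2
  ext x
  simp

lemma continuous_map (f : X ⟶ Y) : Continuous (map (K := K) f) := by
  refine continuous_generateFrom_iff.2 ?_
  rintro _ ⟨U, s, V, hV, rfl⟩
  convert isOpen_setOf_eval (f.left ⁻¹ᵁ U) ((f.left.app U).hom s) hV using 1
  ext x
  exact exists_congr fun hx => iff_of_eq (congrArg (· ∈ V) (eval_map f x U hx s))

/-- An open immersion induces isomorphisms of residue fields, along which absolute values can be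
carried back. -/
lemma range_map (f : X ⟶ Y) [IsOpenImmersion f.left] :
    Set.range (map (K := K) f) = {y | y.pt ∈ f.left.opensRange} := by
  refine Set.Subset.antisymm ?_ ?_
  · rintro _ ⟨x, rfl⟩
    exact ⟨x.pt, rfl⟩
  · rintro ⟨q, v, hv⟩ ⟨p, hp⟩
    obtain rfl : f.left p = q := hp
    let e := inv (f.left.residueFieldMap p)
    have he : ∀ a, e.hom ((f.left.residueFieldMap p).hom a) = a := fun a => by
      rw [← CommRingCat.comp_apply, IsIso.hom_inv_id, CommRingCat.id_apply]
    refine ⟨⟨p, v.comp (f := e.hom) (RingHom.injective _), fun a => ?_⟩, ?_⟩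
    · rw [← hv a]
      exact congrArg v ((congrArg e.hom (RingHom.congr_fun (scalarHom_comp f p) a).symm).trans (he (scalarHom Y (f.left p) a)))
    · refine ext_eval rfl fun U hx hy s => ?_
      exact congrArg v (he ((Y.left.evaluation U (f.left p) hy).hom s))

lemma eval_map_appIso (f : X ⟶ Y) [IsOpenImmersion f.left] (x : Analytification X)
    (U : X.left.Opens) (hx : x.pt ∈ U) (s : Γ(X.left, U)) :
    (map f x).eval (f.left ''ᵁ U) ⟨x.pt, hx, rfl⟩ ((f.left.appIso U).inv.hom s) =
      x.eval U hx s := by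
  have hU : f.left ⁻¹ᵁ f.left ''ᵁ U = U := f.left.preimage_image_eq U
  rw [← x.eval_res hU.le (hU.ge hx)]
  refine (eval_map f x _ _ _).trans (congrArg (x.eval _ (hU.ge hx)) ?_)
  exact congrArg (fun g => g.hom s) (f.left.appIso_inv_app U)

lemma map_injective (f : X ⟶ Y) [IsOpenImmersion f.left] :
    Function.Injective (map (K := K) f) := by
  intro x y hxy
  have hpt : x.pt = y.pt :=
    f.left.isOpenEmbedding.injective (congrArg Analytification.pt hxy)
  refine ext_eval hpt fun U hx hy s => ?_
  have key : ∀ (z : Analytification X) (hz : z.pt ∈ U), z.eval U hz s =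
      (map f z).eval (f.left ''ᵁ U) ⟨z.pt, hz, rfl⟩ ((f.left.appIso U).inv.hom s) :=
    fun z hz => (eval_map_appIso f z U hz s).symm
  rw [key x hx, key y hy]
  congr 1

/-- A function on an open `U` of `X` is also a function on the image of `U` in `Y`, so each subbasic
open set of `X^an` is the preimage of one of `Y^an`. -/
lemma isOpenEmbedding_map (f : X ⟶ Y) [IsOpenImmersion f.left] :
    Topology.IsOpenEmbedding (map (K := K) f) := by
  refine ⟨⟨⟨le_antisymm (continuous_map f).le_induced ?_⟩, map_injective f⟩, ?_⟩
  · refine le_generateFrom ?_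
    rintro _ ⟨U, s, V, hV, rfl⟩
    refine isOpen_induced_iff.2 ⟨_, isOpen_setOf_eval (f.left ''ᵁ U) ((f.left.appIso U).inv.hom s) hV, ?_⟩
    ext x
    constructor
    · rintro ⟨⟨p, hp, hpx⟩, h⟩
      have hx : x.pt ∈ U := by
        rwa [← f.left.isOpenEmbedding.injective hpx]
      exact ⟨hx, by rwa [← eval_map_appIso f x U hx s]⟩
    · rintro ⟨hx, h⟩
      exact ⟨⟨x.pt, hx, rfl⟩, by rwa [eval_map_appIso f x U hx s]⟩
  · rw [range_map]
    exact isOpen_setOf_pt_mem f.left.opensRange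

end Analytification

/-! ### Analytification of affine schemes -/

/-- A multiplicative seminorm induces an absolute value on the field of fractions of the quotient
by its kernel. -/
lemma IsMulSeminorm.exists_absoluteValue {K A F : Type*} [NormedField K] [CommRing A] [Algebra K A]
    [Field F] {ν : A → ℝ} (h : IsMulSeminorm K ν) (π : A →+* F) (hπ : ∀ a, π a = 0 ↔ ν a = 0)
    (hfrac : ∀ z : F, ∃ a b : A, π b ≠ 0 ∧ z * π b = π a) :
    ∃ v : AbsoluteValue F ℝ, ∀ a, v (π a) = ν a := by
  choose num den hden hnum using hfrac
  have heq : ∀ a b, π a = π b → ν a = ν b := fun a b hab => by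
    have h0 : ν (a - b) = 0 := by rw [← hπ, map_sub, hab, sub_self]
    refine le_antisymm ?_ ?_
    · have := h.add_le (a - b) b
      rwa [sub_add_cancel, h0, max_eq_right (h.nonneg b)] at this
    · have := h.add_le (-(a - b)) a
      rwa [neg_sub, sub_add_cancel, ← neg_sub, h.neg, h0, max_eq_right (h.nonneg a)] at this
  let v : F → ℝ := fun z => ν (num z) / ν (den z)
  -- The quotient `ν a / ν b` is the same for every representation of `z` as a fraction, because `ν`
  -- factors through `π`.
  have hv : ∀ z a b, π b ≠ 0 → z * π b = π a → v z = ν a / ν b := fun z a b hb hz => by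
    have h1 : ν (num z * b) = ν (a * den z) := heq _ _ <| by
      rw [map_mul, map_mul, ← hnum, ← hz]; ring
    rw [h.mul, h.mul] at h1
    have h2 : ν (den z) ≠ 0 := fun h0 => hden z ((hπ _).2 h0)
    have h3 : ν b ≠ 0 := fun h0 => hb ((hπ _).2 h0)
    exact (div_eq_div_iff h2 h3).2 h1
  have hvπ : ∀ a, v (π a) = ν a := fun a => by
    rw [hv (π a) a 1 (by rw [map_one]; exact one_ne_zero) (by rw [map_one, mul_one]), h.one, div_one]
  have hpos : ∀ z, 0 < ν (den z) := fun z =>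
    (h.nonneg _).lt_of_ne' fun h0 => hden z ((hπ _).2 h0)
  refine ⟨⟨⟨v, fun x y => ?_⟩, fun x => div_nonneg (h.nonneg _) (h.nonneg _), fun x => ?_,
    fun x y => ?_⟩, hvπ⟩
  · rw [hv (x * y) (num x * num y) (den x * den y) (by
      rw [map_mul]; exact mul_ne_zero (hden x) (hden y)) (by
      rw [map_mul, map_mul, ← hnum, ← hnum]; ring), h.mul, h.mul, mul_div_mul_comm]
  · change v x = 0 ↔ x = 0
    rw [div_eq_zero_iff, or_iff_left (hpos x).ne', ← hπ, ← hnum, mul_eq_zero,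
      or_iff_left (hden x)]
  · change v (x + y) ≤ v x + v y
    rw [hv (x + y) (num x * den y + num y * den x) (den x * den y) (by
      rw [map_mul]; exact mul_ne_zero (hden x) (hden y)) (by
      rw [map_mul, map_add, map_mul, map_mul, ← hnum, ← hnum]; ring),
      div_add_div _ _ (hpos x).ne' (hpos y).ne', h.mul]
    refine div_le_div_of_nonneg_right ((h.add_le _ _).trans ?_) (mul_pos (hpos x) (hpos y)).le
    rw [h.mul, h.mul, mul_comm (ν (den x))]
    exact max_le_add_of_nonneg (mul_nonneg (h.nonneg _) (h.nonneg _))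
      (mul_nonneg (h.nonneg _) (h.nonneg _))

/-- Near a point of an affine scheme a local function is a fraction of global functions. -/
lemma exists_evaluation_fraction {X : Scheme.{u}} [IsAffine X] (x : X) (U : X.Opens) (hx : x ∈ U)
    (f : Γ(X, U)) : ∃ a b : Γ(X, ⊤), x ∈ X.basicOpen b ∧ ∀ y ∈ X.basicOpen b, ∃ hy : y ∈ U,
      (X.evaluation U y hy).hom f * (X.evaluation ⊤ y trivial).hom b =
        (X.evaluation ⊤ y trivial).hom a := by
  obtain ⟨_, ⟨_, ⟨b, rfl⟩, rfl⟩, hxb, hbU⟩ := (isBasis_basicOpen X).exists_subset_of_mem_open hx U.2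
  have hbU' : X.basicOpen b ≤ U := hbU
  have hloc := (isAffineOpen_top X).isLocalization_basicOpen b
  obtain ⟨n, a, ha⟩ := IsLocalization.Away.surj b ((X.presheaf.map (homOfLE hbU').op).hom f)
  -- The exponent `n + 1` is positive even for `n = 0`, so the power has the same nonvanishing locus
  -- as `b`; the numerator receives the extra factor `b`.
  have hb : X.basicOpen (b ^ (n + 1)) = X.basicOpen b := X.basicOpen_pow b n.succ_pos
  refine ⟨a * b, b ^ (n + 1), by rw [hb]; exact hxb, fun y hy => ?_⟩
  rw [hb] at hy
  refine ⟨hbU' hy, ?_⟩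
  have h1 := congrArg (X.evaluation (X.basicOpen b) y hy).hom ha
  have hres : ∀ (V : X.Opens) (hV : X.basicOpen b ≤ V) (g : Γ(X, V)),
      (X.evaluation (X.basicOpen b) y hy).hom ((X.presheaf.map (homOfLE hV).op).hom g) =
        (X.evaluation V y (hV hy)).hom g := fun V hV g =>
    congrArg _ (X.presheaf.germ_res_apply (homOfLE hV) y hy g)
  rw [map_mul, map_pow, hres U hbU' f] at h1
  have h2 : ∀ g : Γ(X, ⊤), (X.evaluation (X.basicOpen b) y hy).hom
      (algebraMap Γ(X, ⊤) Γ(X, X.basicOpen b) g) = (X.evaluation ⊤ y trivial).hom g :=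
    fun g => hres ⊤ le_top g
  rw [h2, h2] at h1
  rw [map_pow, map_mul, pow_succ, ← mul_assoc, h1]

/-- Evaluation of global functions on `Spec A` in the residue field of a point. -/
def specEval {A : Type u} [CommRing A] (p : Spec (CommRingCat.of A)) :
    A →+* (Spec (CommRingCat.of A)).residueField p :=
  ((Spec (CommRingCat.of A)).evaluation ⊤ p trivial).hom.comp
    (Scheme.ΓSpecIso (CommRingCat.of A)).inv.hom

lemma specEval_eq_zero {A : Type u} [CommRing A] (p : Spec (CommRingCat.of A)) (a : A) :
    specEval p a = 0 ↔ a ∈ (show PrimeSpectrum A from p).asIdeal := by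
  have h1 : (Spec (CommRingCat.of A)).basicOpen
      ((Scheme.ΓSpecIso (CommRingCat.of A)).inv.hom a) = PrimeSpectrum.basicOpen a :=
    basicOpen_eq_of_affine (R := CommRingCat.of A) a
  refine ((Spec (CommRingCat.of A)).evaluation_eq_zero_iff_notMem_basicOpen
    (U := ⊤) p trivial _).trans ?_
  exact (iff_of_eq (congrArg (fun V => p ∉ V) h1)).trans not_not

lemma exists_specEval_fraction {A : Type u} [CommRing A] (p : Spec (CommRingCat.of A))
    (U : (Spec (CommRingCat.of A)).Opens) (hp : p ∈ U) (f : Γ(Spec (CommRingCat.of A), U)) :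
    ∃ a b : A, specEval p b ≠ 0 ∧ ∀ q, specEval q b ≠ 0 → ∃ hq : q ∈ U,
      ((Spec (CommRingCat.of A)).evaluation U q hq).hom f * specEval q b = specEval q a := by
  obtain ⟨a, b, hb, hab⟩ := exists_evaluation_fraction p U hp f
  have hinv : ∀ c, (Scheme.ΓSpecIso (CommRingCat.of A)).inv.hom
      ((Scheme.ΓSpecIso (CommRingCat.of A)).hom.hom c) = c := fun c =>
    congrArg (fun g => g.hom c) (Scheme.ΓSpecIso (CommRingCat.of A)).hom_inv_id
  have heval : ∀ q c, specEval q ((Scheme.ΓSpecIso (CommRingCat.of A)).hom.hom c) =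
      ((Spec (CommRingCat.of A)).evaluation ⊤ q trivial).hom c := fun q c =>
    congrArg ((Spec (CommRingCat.of A)).evaluation ⊤ q trivial).hom (hinv c)
  have hne : ∀ q, specEval q ((Scheme.ΓSpecIso (CommRingCat.of A)).hom.hom b) ≠ 0 ↔
      q ∈ (Spec (CommRingCat.of A)).basicOpen b := fun q => by
    rw [heval]
    exact (Spec (CommRingCat.of A)).evaluation_ne_zero_iff_mem_basicOpen (U := ⊤) q trivial b
  refine ⟨(Scheme.ΓSpecIso (CommRingCat.of A)).hom.hom a,
    (Scheme.ΓSpecIso (CommRingCat.of A)).hom.hom b, (hne p).2 hb, fun q hq => ?_⟩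
  obtain ⟨hqU, h⟩ := hab q ((hne q).1 hq)
  exact ⟨hqU, (congrArg (_ * ·) (heval q b)).trans (h.trans (heval q a).symm)⟩

namespace Analytification

variable {K : Type u} [NormedField K] {A B : Type u} [CommRing A] [Algebra K A] [CommRing B]
  [Algebra K B]

lemma absAt_map (f : A →ₐ[K] B) (x : Analytification (specOver K B)) (a : A) :
    (map (specOver.map f) x).absAt a = x.absAt (f a) := by
  refine (eval_map (specOver.map f) x ⊤ trivial _).trans (congrArg (x.eval ⊤ trivial) ?_)
  exact (congrArg (fun g => g.hom a)
    (Scheme.ΓSpecIso_inv_naturality (CommRingCat.ofHom f.toRingHom))).symm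

lemma absAt_algebraMap (x : Analytification (specOver K A)) (c : K) :
    x.absAt (algebraMap K A c) = ‖c‖ := by
  rw [← x.abv_scalar c]
  refine congrArg x.abv (congrArg ((specOver K A).left.Γevaluation x.pt).hom ?_)
  exact congrArg (fun g => g.hom c)
    (Scheme.ΓSpecIso_inv_naturality (CommRingCat.ofHom (algebraMap K A)))

lemma absAt_eq_zero (x : Analytification (specOver K A)) (a : A) :
    x.absAt a = 0 ↔ a ∈ (show PrimeSpectrum A from x.pt).asIdeal := by
  exact x.abv.eq_zero.trans (specEval_eq_zero x.pt a)

/-- An `AbsoluteValue` satisfies only the triangle inequality. The ultrametric one follows because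
integers come from `K` and hence have absolute value at most `1`. -/
lemma abv_add_le_max [IsUltrametricDist K] {X : Over (Spec (CommRingCat.of K))}
    (x : Analytification X) (a b : X.left.residueField x.pt) :
    x.abv (a + b) ≤ max (x.abv a) (x.abv b) := by
  let _ : NormedField (X.left.residueField x.pt) := x.abv.toNormedField
  have : IsUltrametricDist (X.left.residueField x.pt) := by
    refine IsUltrametricDist.isUltrametricDist_of_forall_norm_natCast_le_one fun n => ?_
    have h1 := x.abv_scalar (n : K)
    rw [map_natCast] at h1
    exact h1.trans_le (IsUltrametricDist.norm_natCast_le_one K n)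
  exact IsUltrametricDist.norm_add_le_max a b

lemma isMulSeminorm_absAt [IsUltrametricDist K] (x : Analytification (specOver K A)) :
    IsMulSeminorm K x.absAt where
  nonneg _ := x.abv.nonneg _
  mul := x.absAt_mul
  add_le a b := by
    unfold absAt eval
    rw [map_add]
    exact (congrArg x.abv (map_add _ _ _)).trans_le (abv_add_le_max x _ _)
  algebraMap := x.absAt_algebraMap

/-- On a neighbourhood given by the nonvanishing of `b`, the value of a local function is a quotient
of values of elements of `A`. Both injectivity and the comparison of topologies rest on this. -/
lemma exists_fraction (x : Analytification (specOver K A)) (U : (specOver K A).left.Opens)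
    (hx : x.pt ∈ U) (f : Γ((specOver K A).left, U)) :
    ∃ a b : A, x.absAt b ≠ 0 ∧ ∀ y : Analytification (specOver K A), y.absAt b ≠ 0 →
      ∃ hy : y.pt ∈ U, y.eval U hy f = y.absAt a / y.absAt b := by
  obtain ⟨a, b, hb, hab⟩ := exists_specEval_fraction x.pt U hx f
  refine ⟨a, b, x.abv.ne_zero_iff.2 hb, fun y hy => ?_⟩
  obtain ⟨hyU, h⟩ := hab y.pt (y.abv.ne_zero_iff.1 hy)
  refine ⟨hyU, (eq_div_iff hy).2 ?_⟩
  exact (_root_.map_mul y.abv _ _).symm.trans (congrArg y.abv h)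

lemma ext_absAt {x y : Analytification (specOver K A)} (h : x.absAt = y.absAt) : x = y := by
  have hpt : x.pt = y.pt := PrimeSpectrum.ext <| Ideal.ext fun a => by
    exact (absAt_eq_zero x a).symm.trans ((by rw [h] : _ ↔ _).trans (absAt_eq_zero y a))
  refine ext_eval hpt fun U hx hy f => ?_
  obtain ⟨a, b, hb, hab⟩ := exists_fraction x U hx f
  obtain ⟨_, h1⟩ := hab x hb
  obtain ⟨_, h2⟩ := hab y (by rwa [← h])
  rw [h1, h2, h]

variable [IsUltrametricDist K]

/-- The seminorm on `A` defined by a point of `(Spec A)^an`. -/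
def toSeminorm (x : Analytification (specOver K A)) : SeminormSpace K A :=
  ⟨x.absAt, x.isMulSeminorm_absAt⟩

/-- The kernel of the seminorm is a prime ideal, which gives the point; the seminorm extends to its
residue field by fractions. -/
lemma toSeminorm_surjective (ν : SeminormSpace K A) :
    ∃ x : Analytification (specOver K A), x.toSeminorm = ν := by
  obtain ⟨ν, h⟩ := ν
  let I : Ideal A :=
    { carrier := {a | ν a = 0}
      add_mem' := fun {a b} (ha : ν a = 0) (hb : ν b = 0) => le_antisymm
        ((h.add_le a b).trans (by rw [ha, hb, max_self])) (h.nonneg _)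
      zero_mem' := h.zero
      smul_mem' := fun c a (ha : ν a = 0) => by
        change ν (c * a) = 0
        rw [h.mul, ha, mul_zero] }
  have hI : I.IsPrime := by
    refine ⟨fun htop => ?_, fun {a b} (hab : ν (a * b) = 0) => ?_⟩
    · have : ν 1 = 0 := (Ideal.eq_top_iff_one I).1 htop
      rw [h.one] at this
      exact one_ne_zero this
    · rw [h.mul] at hab
      exact mul_eq_zero.1 hab
  let p : Spec (CommRingCat.of A) := (⟨I, hI⟩ : PrimeSpectrum A)
  have hπ : ∀ a, specEval p a = 0 ↔ ν a = 0 := fun a => specEval_eq_zero p a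
  obtain ⟨v, hv⟩ := h.exists_absoluteValue (specEval p) hπ fun z => by
    obtain ⟨U, hx, f, rfl⟩ := abv_evaluation_surjective _ p z
    obtain ⟨a, b, hb, hab⟩ := exists_specEval_fraction p U hx f
    exact ⟨a, b, hb, (hab p hb).2⟩
  refine ⟨⟨p, v, fun c => ?_⟩, Subtype.ext (funext hv)⟩
  rw [← h.algebraMap c, ← hv]
  refine congrArg v (congrArg ((specOver K A).left.Γevaluation p).hom ?_)
  exact congrArg (fun g => g.hom c)
    (Scheme.ΓSpecIso_inv_naturality (CommRingCat.ofHom (algebraMap K A))).symm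

lemma isInducing_toSeminorm :
    Topology.IsInducing (toSeminorm : Analytification (specOver K A) → SeminormSpace K A) := by
  refine ⟨le_antisymm ?_ (le_generateFrom ?_)⟩
  · rw [← continuous_iff_le_induced, SeminormSpace.continuous_iff]
    refine fun a => continuous_def.2 fun V hV => ?_
    convert isOpen_setOf_eval (⊤ : (specOver K A).left.Opens)
      ((Scheme.ΓSpecIso (CommRingCat.of A)).inv.hom a) hV using 1
    ext x
    exact ⟨fun h => ⟨trivial, h⟩, fun ⟨_, h⟩ => h⟩
  · rintro _ ⟨U, f, V, hV, rfl⟩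
    refine (@isOpen_iff_forall_mem_open _ (_) (_)).2 ?_
    rintro x ⟨hx, hxV⟩
    obtain ⟨a, b, hb, hab⟩ := exists_fraction x U hx f
    refine ⟨toSeminorm ⁻¹' {ν | ν.1 b ≠ 0 ∧ ν.1 a / ν.1 b ∈ V}, ?_, isOpen_induced ?_, hb, ?_⟩
    · rintro y ⟨hy, hyV⟩
      obtain ⟨hyU, h⟩ := hab y hy
      exact ⟨hyU, by rwa [h]⟩
    · have hcont : ContinuousOn (fun ν : SeminormSpace K A => ν.1 a / ν.1 b) {ν | ν.1 b ≠ 0} :=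
        ((SeminormSpace.continuous_eval a).continuousOn).div
          (SeminormSpace.continuous_eval b).continuousOn fun _ h => h
      exact hcont.isOpen_inter_preimage
        (isOpen_ne_fun (SeminormSpace.continuous_eval b) continuous_const) hV
    · obtain ⟨_, h⟩ := hab x hb
      change x.absAt a / x.absAt b ∈ V
      rwa [← h]

variable (K A) in
/-- `(Spec A)^an` is the space of multiplicative seminorms on `A`. -/
def homeoSeminorm : Analytification (specOver K A) ≃ₜ SeminormSpace K A :=
  (Equiv.ofBijective toSeminorm ⟨fun _ _ h => ext_absAt (congrArg Subtype.val h),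
    toSeminorm_surjective⟩).toHomeomorphOfIsInducing isInducing_toSeminorm

lemma absAt_homeoSeminorm_symm (ν : SeminormSpace K A) :
    ((homeoSeminorm K A).symm ν).absAt = ν.1 :=
  congrArg Subtype.val ((homeoSeminorm K A).apply_symm_apply ν)

lemma homeoSeminorm_map (f : A →ₐ[K] B) (x : Analytification (specOver K B)) :
    homeoSeminorm K A (map (specOver.map f) x) = (homeoSeminorm K B x).comap f :=
  Subtype.ext (funext (absAt_map f x))

lemma map_homeoSeminorm_symm (f : A →ₐ[K] B) (ν : SeminormSpace K B) :
    map (specOver.map f) ((homeoSeminorm K B).symm ν) = (homeoSeminorm K A).symm (ν.comap f) := by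
  rw [← (homeoSeminorm K A).injective.eq_iff, homeoSeminorm_map, Homeomorph.apply_symm_apply,
    Homeomorph.apply_symm_apply]

end Analytification

/-! ### Affine charts of the toric prevariety and of its analytification -/

section ChartImmersion

variable (K : Type u) [Field K] {N : Type u} [AddCommGroup N] {I : Type u} {S : FanSystem N I}

instance (ω : S.Chart) : IsOpenImmersion (chartIncl K ω).left :=
  inferInstanceAs (IsOpenImmersion (colimit.ι (chartDiagram K S) ω))

instance {ω ω' : S.Chart} (h : ω ≤ ω') : IsOpenImmersion (chartTrans K h).left :=
  inferInstanceAs (IsOpenImmersion ((chartDiagram K S).map (homOfLE h)))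

end ChartImmersion

section Charts

variable (K : Type u) [NormedField K] {N : Type u} [AddCommGroup N] {I : Type u}
  {S : FanSystem N I}

/-- The space of seminorms on `K[S_σ]`. -/
abbrev ChartSpace (ω : S.Chart) : Type u := SeminormSpace K (coordRing K ω.cone)

variable {K} in
/-- The inclusion of charts on seminorms. -/
abbrev chartRestrict {ω ω' : S.Chart} (h : ω ≤ ω') (ν : ChartSpace K ω) : ChartSpace K ω' :=
  ν.comap (restrictHom K (FanSystem.Chart.isFace h).le)

variable [IsUltrametricDist K]

/-- The inclusion of the affine chart `U_[σ, i]^an`, identified with a space of seminorms, into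
`X(S)^an`. -/
def chartAn (ω : S.Chart) (ν : ChartSpace K ω) : Analytification (toricPrevariety K S) :=
  Analytification.map (chartIncl K ω) ((Analytification.homeoSeminorm K _).symm ν)

variable {K}

lemma chartAn_homeoSeminorm (ω : S.Chart) (x : Analytification (chartScheme K S ω)) :
    chartAn K ω (Analytification.homeoSeminorm K _ x) = Analytification.map (chartIncl K ω) x := by
  rw [chartAn, Homeomorph.symm_apply_apply]

lemma isOpenEmbedding_chartAn (ω : S.Chart) : Topology.IsOpenEmbedding (chartAn K ω) :=
  (Analytification.isOpenEmbedding_map (chartIncl K ω)).comp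
    (Analytification.homeoSeminorm K _).symm.isOpenEmbedding

lemma exists_chartAn_eq (x : Analytification (toricPrevariety K S)) :
    ∃ (ω : S.Chart) (ν : ChartSpace K ω), chartAn K ω ν = x := by
  obtain ⟨ω, p, hp⟩ := (chartCover K S).exists_eq x.pt
  have hx : x ∈ Set.range (Analytification.map (chartIncl K ω)) := by
    rw [Analytification.range_map]
    exact ⟨p, hp⟩
  obtain ⟨y, rfl⟩ := hx
  exact ⟨ω, _, chartAn_homeoSeminorm ω y⟩

lemma chartAn_chartRestrict {ω ω' : S.Chart} (h : ω ≤ ω') (ν : ChartSpace K ω) :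
    chartAn K ω' (chartRestrict h ν) = chartAn K ω ν := by
  rw [chartAn, chartAn, ← chartTrans_chartIncl K S h, Analytification.map_comp]
  congr 1
  exact (Analytification.map_homeoSeminorm_symm _ ν).symm

/-- Two charts of `X(S)^an` meet in common smaller charts. -/
lemma exists_of_chartAn_eq {ω ω' : S.Chart} {ν : ChartSpace K ω} {ν' : ChartSpace K ω'}
    (h : chartAn K ω ν = chartAn K ω' ν') :
    ∃ (ω₀ : S.Chart) (h₁ : ω₀ ≤ ω) (h₂ : ω₀ ≤ ω') (μ : ChartSpace K ω₀),
      chartRestrict h₁ μ = ν ∧ chartRestrict h₂ μ = ν' := by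
  set x := (Analytification.homeoSeminorm K _).symm ν with hx
  set x' := (Analytification.homeoSeminorm K _).symm ν' with hx'
  have hpt : colimit.ι (chartDiagram K S) ω x.pt = colimit.ι (chartDiagram K S) ω' x'.pt :=
    congrArg Analytification.pt h
  obtain ⟨ω₀, f₁, f₂, p, hp₁, hp₂⟩ :=
    (Scheme.IsLocallyDirected.ι_eq_ι_iff (chartDiagram K S)).1 hpt
  have hr : x ∈ Set.range (Analytification.map (chartTrans K (leOfHom f₁))) := by
    rw [Analytification.range_map]
    exact ⟨p, hp₁⟩
  obtain ⟨y, hy⟩ := hr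
  have h1 : chartRestrict (leOfHom f₁) (Analytification.homeoSeminorm K _ y) = ν := by
    refine (Analytification.homeoSeminorm_map _ y).symm.trans ?_
    exact (congrArg (Analytification.homeoSeminorm K _) hy).trans
      ((Analytification.homeoSeminorm K _).apply_symm_apply ν)
  refine ⟨ω₀, leOfHom f₁, leOfHom f₂, Analytification.homeoSeminorm K _ y, h1, ?_⟩
  apply (isOpenEmbedding_chartAn ω').injective
  rw [← h, ← h1, chartAn_chartRestrict, chartAn_chartRestrict]

/-- A seminorm on the larger chart for which the character defining the smaller chart does not
vanish belongs to the smaller chart. -/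
lemma exists_chartRestrict_eq_iff {ω ω' : S.Chart} (h : ω ≤ ω') :
    ∃ m : dualMonoid ω'.cone, ∀ ν : ChartSpace K ω',
      (∃ μ, chartRestrict h μ = ν) ↔ ν.1 (chi K m) ≠ 0 := by
  obtain ⟨m, hm, hτ⟩ := FanSystem.Chart.isFace h
  have hl := (FanSystem.Chart.isFace h).le
  refine ⟨⟨m, hm⟩, fun ν => ⟨?_, fun hν => ?_⟩⟩
  · rintro ⟨μ, rfl⟩
    change μ.1 (restrictHom K hl _) ≠ 0
    rw [restrictHom_single]
    obtain ⟨c, hc⟩ := (isUnit_chi K (⟨m, dualMonoid_anti hl hm⟩ : dualMonoid ω.cone)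
      fun v hv => ((hτ v).1 hv).2).exists_right_inv
    intro h0
    have := μ.2.mul (chi K ⟨m, dualMonoid_anti hl hm⟩) c
    rw [hc, μ.2.one] at this
    exact one_ne_zero (this.trans (mul_eq_zero_of_left h0 _))
  -- The smaller chart is the localization at `χ^m`, so its image is the locus where `χ^m` lies
  -- outside the prime ideal, that is, has nonzero value.
  · let _ := (restrictHom K hl).toRingHom.toAlgebra
    have := isLocalization_restrictHom K ω'.rational ⟨m, hm⟩ hτ hl
    set x := (Analytification.homeoSeminorm K _).symm ν with hx
    have hxm : x.absAt (chi K ⟨m, hm⟩) ≠ 0 := by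
      rw [hx, Analytification.absAt_homeoSeminorm_symm]
      exact hν
    have hr : x ∈ Set.range (Analytification.map (chartTrans K h)) := by
      rw [Analytification.range_map]
      have := PrimeSpectrum.localization_away_comap_range (coordRing K ω.cone)
        (chi K (⟨m, hm⟩ : dualMonoid ω'.cone))
      have hmem : (show PrimeSpectrum (coordRing K ω'.cone) from x.pt) ∈ Set.range
          (PrimeSpectrum.comap (algebraMap (coordRing K ω'.cone) (coordRing K ω.cone))) := by
        rw [this]
        exact fun hmem => hxm ((Analytification.absAt_eq_zero x _).2 hmem)
      exact hmem
    obtain ⟨y, hy⟩ := hr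
    refine ⟨Analytification.homeoSeminorm K _ y, ?_⟩
    refine (Analytification.homeoSeminorm_map _ y).symm.trans ?_
    exact (congrArg (Analytification.homeoSeminorm K _) hy).trans
      ((Analytification.homeoSeminorm K _).apply_symm_apply ν)

/-! ### Gluing maps defined on the charts -/

section Glue

variable {P Z : Type*}

/-- The map on `X(S)^an` given by a compatible family of maps on the charts. -/
def glueCharts (f : ∀ ω : S.Chart, ChartSpace K ω → Z) (x : Analytification (toricPrevariety K S)) :
    Z :=
  f (exists_chartAn_eq x).choose (exists_chartAn_eq x).choose_spec.choose

/-- Two representations of a point come from a common smaller chart, where compatibility applies;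
the choice in `glueCharts` is thus irrelevant. -/
lemma glueCharts_chartAn {f : ∀ ω : S.Chart, ChartSpace K ω → Z}
    (hf : ∀ {ω ω' : S.Chart} (h : ω ≤ ω') (ν : ChartSpace K ω), f ω' (chartRestrict h ν) = f ω ν)
    (ω : S.Chart) (ν : ChartSpace K ω) : glueCharts f (chartAn K ω ν) = f ω ν := by
  have h := (exists_chartAn_eq (chartAn K ω ν)).choose_spec.choose_spec
  obtain ⟨ω₀, h₁, h₂, μ, e₁, e₂⟩ := exists_of_chartAn_eq h
  rw [glueCharts, ← e₁, hf]
  exact (hf h₂ μ).symm.trans (congrArg _ e₂)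

/-- The parameter space `P` serves the homotopy, with `P` the unit interval. -/
lemma continuous_of_chartAn [TopologicalSpace P] [TopologicalSpace Z]
    {f : P × Analytification (toricPrevariety K S) → Z}
    (hf : ∀ ω : S.Chart, Continuous fun p : P × ChartSpace K ω => f (p.1, chartAn K ω p.2)) :
    Continuous f := by
  refine continuous_iff_continuousAt.2 ?_
  rintro ⟨p, x⟩
  obtain ⟨ω, ν, rfl⟩ := exists_chartAn_eq x
  have h := (Topology.IsOpenEmbedding.id (X := P)).prodMap (isOpenEmbedding_chartAn (K := K) ω)
  exact (h.continuousAt_iff (x := ((p, ν) : P × ChartSpace K ω))).1 (hf ω).continuousAt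

lemma continuous_of_chartAn' [TopologicalSpace Z]
    {f : Analytification (toricPrevariety K S) → Z}
    (hf : ∀ ω : S.Chart, Continuous fun ν : ChartSpace K ω => f (chartAn K ω ν)) :
    Continuous f := by
  refine continuous_iff_continuousAt.2 fun x => ?_
  obtain ⟨ω, ν, rfl⟩ := exists_chartAn_eq x
  exact ((isOpenEmbedding_chartAn (K := K) ω).continuousAt_iff (x := ν)).1 (hf ω).continuousAt

end Glue

end Charts

/-! ### Tropicalization and its section -/

section Trop

variable (K : Type u) [NormedField K] [IsUltrametricDist K] {N : Type u} [AddCommGroup N]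
  {I : Type u} (S : FanSystem N I)

lemma TropPrevariety.mk_comp {S : FanSystem N I} {ω ω' : S.Chart} (h : ω ≤ ω')
    (u : AffineTrop ω.cone) :
    TropPrevariety.mk ω' (u.comp (AddSubmonoid.inclusion (FanSystem.Chart.dualMonoid_le h))) =
      TropPrevariety.mk ω u :=
  (Quot.sound ⟨h, rfl⟩).symm

lemma TropPrevariety.continuous_mk {S : FanSystem N I} (ω : S.Chart) :
    Continuous (TropPrevariety.mk ω) :=
  continuous_quot_mk.comp continuous_sigmaMk

variable {K} in
omit [IsUltrametricDist K] in
lemma tropPoint_chartRestrict {S : FanSystem N I} {ω ω' : S.Chart} (h : ω ≤ ω')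
    (ν : ChartSpace K ω) : tropPoint (chartRestrict h ν) =
      (tropPoint ν).comp (AddSubmonoid.inclusion (FanSystem.Chart.dualMonoid_le h)) := by
  ext s
  change negLog (ν.1 (restrictHom K _ _)) = negLog _
  rw [restrictHom_single]

/-- The tropicalization map `X(S)^an → X(S)^trop`. -/
def tropMap : Analytification (toricPrevariety K S) → TropPrevariety S :=
  glueCharts fun ω ν => TropPrevariety.mk ω (tropPoint ν)

variable {K S}

lemma tropMap_chartAn (ω : S.Chart) (ν : ChartSpace K ω) :
    tropMap K S (chartAn K ω ν) = TropPrevariety.mk ω (tropPoint ν) :=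
  glueCharts_chartAn (f := fun ω ν => TropPrevariety.mk ω (tropPoint ν))
    (fun h ν => by rw [tropPoint_chartRestrict h, TropPrevariety.mk_comp h]) ω ν

lemma isTropicalization_tropMap : IsTropicalization K S (tropMap K S) := fun ω x => by
  rw [← chartAn_homeoSeminorm, tropMap_chartAn]
  rfl

lemma IsTropicalization.eq_tropMap {t : Analytification (toricPrevariety K S) → TropPrevariety S}
    (ht : IsTropicalization K S t) : t = tropMap K S := by
  funext x
  obtain ⟨ω, ν, rfl⟩ := exists_chartAn_eq x
  rw [chartAn, ht, isTropicalization_tropMap]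

lemma continuous_tropMap : Continuous (tropMap K S) := by
  refine continuous_of_chartAn' fun ω => ?_
  simp only [tropMap_chartAn]
  exact (TropPrevariety.continuous_mk ω).comp (continuous_tropPoint ω.cone)

/-- Tropicalization is functorial for toric morphisms. -/
lemma IsTropicalization.map_toricMorphism {N' I' : Type u} [AddCommGroup N']
    {S' : FanSystem N' I'} (φ : S.Hom S')
    {trop' : Analytification (toricPrevariety K S') → TropPrevariety S'}
    (h : IsTropicalization K S' trop') (x : Analytification (toricPrevariety K S)) :
    trop' (Analytification.map (toricMorphism φ K) x) =
      TropPrevariety.map φ (tropMap K S x) := by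
  obtain ⟨ω, ν, rfl⟩ := exists_chartAn_eq x
  rw [chartAn, ← Analytification.map_comp, chartIncl_toricMorphism, Analytification.map_comp, h,
    isTropicalization_tropMap]
  refine congrArg (TropPrevariety.mk (φ.onCharts ω)) ?_
  ext s
  refine congrArg negLog ((Analytification.absAt_map _ _ _).trans ?_)
  exact congrArg _ (AddMonoidAlgebra.mapDomain_single)

variable [Module.Free ℤ N] [Module.Finite ℤ N]

variable (K S) in
/-- The section `J : X(S)^trop → X(S)^an` of the tropicalization map by Gauss points. -/
def gaussSection : TropPrevariety S → Analytification (toricPrevariety K S) :=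
  Quot.lift (fun p => chartAn K p.1 (gaussPoint K p.2)) (by
    rintro ⟨ω, u⟩ ⟨ω', u'⟩ ⟨h, hu⟩
    dsimp only at h hu ⊢
    rw [hu, ← chartAn_chartRestrict h]
    congr 1
    exact gaussPoint_comap _ (AddSubmonoid.inclusion_injective _) u)

lemma gaussSection_mk (ω : S.Chart) (u : AffineTrop ω.cone) :
    gaussSection K S (TropPrevariety.mk ω u) = chartAn K ω (gaussPoint K u) := rfl

lemma tropMap_gaussSection (y : TropPrevariety S) : tropMap K S (gaussSection K S y) = y := by
  induction y using Quot.inductionOn with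
  | _ p =>
    exact (tropMap_chartAn p.1 (gaussPoint K p.2)).trans
      (congrArg (TropPrevariety.mk p.1) (tropPoint_gaussPoint p.2))

lemma isGaussSection_gaussSection : IsGaussSection K S (gaussSection K S) := fun ω u =>
  ⟨(Analytification.homeoSeminorm K _).symm (gaussPoint K u), rfl, fun g => by
    rw [Analytification.absAt_homeoSeminorm_symm]
    rfl⟩

lemma continuous_gaussSection : Continuous (gaussSection K S) := by
  refine continuous_quot_lift _ (continuous_sigma fun ω => ?_)
  exact (isOpenEmbedding_chartAn ω).continuous.comp (continuous_gaussPoint ω.cone)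

/-- The statement does not involve `K`: the field only supplies `X^an`, whose charts are already
known to be open embeddings. Injectivity and openness are transported through the Gauss section,
avoiding an analysis of the gluing relation on `X^trop`. -/
lemma TropPrevariety.isOpenEmbedding_mk (K : Type u) [NormedField K] [IsUltrametricDist K]
    (ω : S.Chart) :
    Topology.IsOpenEmbedding (TropPrevariety.mk ω) := by
  refine .of_continuous_injective_isOpenMap (TropPrevariety.continuous_mk ω) ?_ ?_
  · intro u u' h
    have h1 : gaussPoint K u = gaussPoint K u' :=
      (isOpenEmbedding_chartAn ω).injective (congrArg (gaussSection K S) h)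
    rw [← tropPoint_gaussPoint (K := K) u, h1, tropPoint_gaussPoint]
  · intro V hV
    have h1 : TropPrevariety.mk ω '' V =
        gaussSection K S ⁻¹' (chartAn K ω '' (tropPoint ⁻¹' V)) := by
      ext y
      constructor
      · rintro ⟨u, hu, rfl⟩
        refine ⟨gaussPoint K u, ?_, rfl⟩
        rwa [Set.mem_preimage, tropPoint_gaussPoint]
      · rintro ⟨ν, hν, h⟩
        refine ⟨tropPoint ν, hν, ?_⟩
        rw [← tropMap_chartAn, h, tropMap_gaussSection]
    rw [h1]
    exact ((isOpenEmbedding_chartAn ω).isOpenMap _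
      (hV.preimage (continuous_tropPoint ω.cone))).preimage continuous_gaussSection

/-- The preimage of a chart of `X^trop` is the corresponding chart of `X^an`. -/
lemma exists_chartAn_eq_of_tropMap_eq {x : Analytification (toricPrevariety K S)} {ω : S.Chart}
    {u : AffineTrop ω.cone} (h : tropMap K S x = TropPrevariety.mk ω u) :
    ∃ ν, chartAn K ω ν = x ∧ tropPoint ν = u := by
  suffices H : ∃ ν, chartAn K ω ν = x by
    obtain ⟨ν, rfl⟩ := H
    rw [tropMap_chartAn] at h
    exact ⟨ν, rfl, (TropPrevariety.isOpenEmbedding_mk K ω).injective h⟩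
  obtain ⟨ω', ν', rfl⟩ := exists_chartAn_eq x
  rw [tropMap_chartAn] at h
  -- The Gauss section turns an equality in `X^trop` into one in `X^an`, where charts are known to
  -- meet in smaller charts.
  obtain ⟨ω₀, h₁, h₂, μ, e₁, -⟩ := exists_of_chartAn_eq
    (show chartAn K ω' (gaussPoint K (tropPoint ν')) = chartAn K ω (gaussPoint K u) from
      congrArg (gaussSection K S) h)
  obtain ⟨m, hm⟩ := exists_chartRestrict_eq_iff (K := K) h₁
  have h3 := (hm _).1 ⟨μ, e₁⟩
  -- The seminorm `ν'` and its Gauss point have the same value at `χ^m`, so they lie in the smaller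
  -- chart together.
  obtain ⟨μ', rfl⟩ := (hm ν').2 (by
    change (gaussPoint K (tropPoint ν')).1 (AddMonoidAlgebra.single m 1) ≠ 0 at h3
    rw [gaussPoint_single, ← SeminormSpace.apply_single] at h3
    exact h3)
  refine ⟨chartRestrict h₂ μ', ?_⟩
  rw [chartAn_chartRestrict, chartAn_chartRestrict]

/-- In the ultrafilter criterion, the limit in `X^trop` lies in an open chart. The preimage of that
chart is a chart of `X^an`, so the ultrafilter lives on one seminorm space and the affine result
applies. -/
lemma isProperMap_tropMap : IsProperMap (tropMap K S) := by
  refine isProperMap_iff_ultrafilter.2 ⟨continuous_tropMap, fun U y hU => ?_⟩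
  obtain ⟨⟨ω, u⟩, rfl⟩ := Quot.exists_rep y
  change Filter.Tendsto _ _ (nhds (TropPrevariety.mk ω u)) at hU
  have hmem : Set.range (chartAn K ω) ∈ U := by
    have h1 : Set.range (TropPrevariety.mk ω) ∈ nhds (TropPrevariety.mk ω u) :=
      (TropPrevariety.isOpenEmbedding_mk K ω).isOpen_range.mem_nhds ⟨u, rfl⟩
    refine Filter.mem_of_superset (hU h1) ?_
    rintro x ⟨u', hu'⟩
    obtain ⟨ν, hν, -⟩ := exists_chartAn_eq_of_tropMap_eq hu'.symm
    exact ⟨ν, hν⟩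
  have hinj := (isOpenEmbedding_chartAn (K := K) ω).injective
  let F : Ultrafilter (ChartSpace K ω) := U.comap hinj hmem
  have hFU : Filter.map (chartAn K ω) F = U := by
    rw [Ultrafilter.coe_comap]
    exact Filter.map_comap_of_mem hmem
  have hF : Filter.Tendsto (tropPoint : ChartSpace K ω → AffineTrop ω.cone) F (nhds u) := by
    rw [(TropPrevariety.isOpenEmbedding_mk K ω).tendsto_nhds_iff]
    have h2 : Filter.Tendsto (tropMap K S) (Filter.map (chartAn K ω) F)
        (nhds (TropPrevariety.mk ω u)) := by rwa [hFU]
    refine (Filter.tendsto_map'_iff.1 h2).congr fun ν => ?_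
    exact tropMap_chartAn ω ν
  obtain ⟨ν, hν, hle⟩ := exists_le_nhds_of_tropPoint ω.cone F u hF
  refine ⟨chartAn K ω ν, ?_, ?_⟩
  · rw [tropMap_chartAn, hν]
    rfl
  · rw [← hFU]
    exact (Filter.map_mono hle).trans (isOpenEmbedding_chartAn ω).continuous.continuousAt

/-- Two points of one fibre lie in a common chart, and spaces of seminorms are Hausdorff. -/
lemma isSeparatedMap_tropMap : IsSeparatedMap (tropMap K S) := by
  intro x y hxy hne
  obtain ⟨ω, ν, rfl⟩ := exists_chartAn_eq x
  rw [tropMap_chartAn] at hxy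
  obtain ⟨ν', rfl, -⟩ := exists_chartAn_eq_of_tropMap_eq hxy.symm
  obtain ⟨U, V, hU, hV, hxU, hyV, hd⟩ := t2_separation (ne_of_apply_ne _ hne)
  have he := isOpenEmbedding_chartAn (K := K) ω
  exact ⟨_, _, he.isOpenMap U hU, he.isOpenMap V hV, ⟨ν, hxU, rfl⟩, ⟨ν', hyV, rfl⟩,
    Set.disjoint_image_of_injective he.injective hd⟩

/-- Points in one fibre are separated by `hs`, points in different fibres by their images in `A`. -/
lemma t2Space_preimage {X Y : Type*} [TopologicalSpace X] [TopologicalSpace Y] {f : X → Y}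
    (hf : Continuous f) (hs : IsSeparatedMap f) (A : Set Y) [T2Space A] : T2Space (f ⁻¹' A) := by
  refine ⟨fun x y hne => ?_⟩
  by_cases hxy : f x = f y
  · obtain ⟨U, V, hU, hV, hx, hy, hd⟩ := hs x y hxy (Subtype.coe_injective.ne hne)
    exact ⟨_, _, hU.preimage continuous_subtype_val, hV.preimage continuous_subtype_val, hx, hy,
      hd.preimage _⟩
  · let g : f ⁻¹' A → A := fun z => ⟨f z, z.2⟩
    have hg : Continuous g := (hf.comp continuous_subtype_val).subtype_mk _
    obtain ⟨U, V, hU, hV, hx, hy, hd⟩ :=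
      t2_separation (x := g x) (y := g y) fun h => hxy (congrArg Subtype.val h)
    exact ⟨_, _, hU.preimage hg, hV.preimage hg, hx, hy, hd.preimage _⟩

/-- The image is the locus where `J ∘ trop` equals the identity. As `X^an` need not be Hausdorff,
closedness uses that both maps agree after `trop`, which is a separated map. -/
lemma isClosed_range_gaussSection : IsClosed (Set.range (gaussSection K S)) := by
  have h : Set.range (gaussSection K S) = {x | gaussSection K S (tropMap K S x) = id x} := by
    ext x
    constructor
    · rintro ⟨y, rfl⟩
      exact congrArg _ (tropMap_gaussSection y)
    · exact fun hx => ⟨_, hx⟩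
  rw [h]
  exact isSeparatedMap_tropMap.isClosed_eqLocus
    (continuous_gaussSection.comp continuous_tropMap) continuous_id
    (funext fun x => tropMap_gaussSection _)

lemma isEmbedding_gaussSection : Topology.IsEmbedding (gaussSection K S) :=
  .of_leftInverse tropMap_gaussSection continuous_tropMap continuous_gaussSection

/-! ### The deformation retraction -/

variable (K S) in
/-- The deformation of `X(S)^an` to the Gauss points. -/
def toricFlow (p : unitInterval × Analytification (toricPrevariety K S)) :
    Analytification (toricPrevariety K S) :=
  glueCharts (fun ω ν =>
    chartAn K ω (flowList ((latticeGenerators N).map (evalAt ω.cone)) p.1 ν)) p.2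

/-- The gradings are evaluations at vectors of `N`, the same for all charts, hence compatible with
restriction. -/
lemma toricFlow_chartAn (r : unitInterval) (ω : S.Chart) (ν : ChartSpace K ω) :
    toricFlow K S (r, chartAn K ω ν) =
      chartAn K ω (flowList ((latticeGenerators N).map (evalAt ω.cone)) r ν) :=
  glueCharts_chartAn (f := fun ω ν =>
    chartAn K ω (flowList ((latticeGenerators N).map (evalAt ω.cone)) r ν)) (fun h ν => by
      refine Eq.trans ?_ (chartAn_chartRestrict h _)
      congr 1
      exact flowList_comap _ (fun _ _ => rfl) _ r ν) ω ν

lemma continuous_toricFlow : Continuous (toricFlow K S) := by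
  refine continuous_of_chartAn fun ω => ?_
  simp only [toricFlow_chartAn]
  exact (isOpenEmbedding_chartAn ω).continuous.comp (continuous_flowList _)

lemma toricFlow_zero (x : Analytification (toricPrevariety K S)) : toricFlow K S (0, x) = x := by
  obtain ⟨ω, ν, rfl⟩ := exists_chartAn_eq x
  rw [toricFlow_chartAn, flowList_zero]

lemma toricFlow_one (x : Analytification (toricPrevariety K S)) :
    toricFlow K S (1, x) = gaussSection K S (tropMap K S x) := by
  obtain ⟨ω, ν, rfl⟩ := exists_chartAn_eq x
  rw [toricFlow_chartAn, tropMap_chartAn, gaussSection_mk,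
    flowList_one _ (eq_of_evalAt_eq ω.cone)]

lemma toricFlow_gaussSection (r : unitInterval) (y : TropPrevariety S) :
    toricFlow K S (r, gaussSection K S y) = gaussSection K S y := by
  obtain ⟨⟨ω, u⟩, rfl⟩ := Quot.exists_rep y
  change toricFlow K S (r, chartAn K ω (gaussPoint K u)) = chartAn K ω (gaussPoint K u)
  rw [toricFlow_chartAn, flowList_gaussPoint]

end Trop

/-! ### The product of the torus with a chart -/

section TorusProd

variable (K : Type u) [Field K] {N : Type u} [AddCommGroup N] {I : Type u} {S : FanSystem N I}

/-- The coordinate ring of `T × U_[σ, i]`. -/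
abbrev prodRing (σ : PointedCone ℝ (RealSpace N)) : Type u :=
  AddMonoidAlgebra K (DualLattice N) ⊗[K] coordRing K σ

/-- The open subscheme `T × U_[σ, i]` of `T × X(S)`. -/
def torusProdOpen (ω : S.Chart) : Over (Spec (CommRingCat.of K)) :=
  Over.mk ((torusProdCover K S).f ω ≫ (torusProd K S).hom)

/-- The inclusion of `T × U_[σ, i]` in `T × X(S)`. -/
def torusProdOpenIncl (ω : S.Chart) : torusProdOpen K ω ⟶ torusProd K S :=
  Over.homMk ((torusProdCover K S).f ω) rfl

instance (ω : S.Chart) : IsOpenImmersion (torusProdOpenIncl K ω).left :=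
  inferInstanceAs (IsOpenImmersion (pullback.fst (torusProdSnd K S).left (chartIncl K ω).left))

lemma specProdIso_hom_includeLeft (A B : Type u) [CommRing A] [Algebra K A] [CommRing B]
    [Algebra K B] : (specProdIso K A B).hom ≫ Spec.map (CommRingCat.ofHom
      (Algebra.TensorProduct.includeLeft : A →ₐ[K] A ⊗[K] B).toRingHom) =
        pullback.fst (specOver K A).hom (specOver K B).hom :=
  ((Iso.inv_comp_eq _).1 (specProdIso_inv_fst A B)).symm

lemma specProdIso_hom_includeRight (A B : Type u) [CommRing A] [Algebra K A] [CommRing B]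
    [Algebra K B] : (specProdIso K A B).hom ≫ Spec.map (CommRingCat.ofHom
      (Algebra.TensorProduct.includeRight : B →ₐ[K] A ⊗[K] B).toRingHom) =
        pullback.snd (specOver K A).hom (specOver K B).hom :=
  ((Iso.inv_comp_eq _).1 (specProdIso_inv_snd A B)).symm

/-- The morphism of schemes from `T × U_[σ, i]` to `Spec (K[M] ⊗ K[S_σ])`. -/
def torusProdToSpec (ω : S.Chart) : pullback (torusProdSnd K S).left (chartIncl K ω).left ⟶
    Spec (CommRingCat.of (prodRing K ω.cone)) :=
  torusProdChart K S ω ≫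
    (specProdIso K (AddMonoidAlgebra K (DualLattice N)) (coordRing K ω.cone)).hom

lemma torusProdToSpec_includeLeft (ω : S.Chart) :
    torusProdToSpec K ω ≫ Spec.map (CommRingCat.ofHom (Algebra.TensorProduct.includeLeft :
      AddMonoidAlgebra K (DualLattice N) →ₐ[K] prodRing K ω.cone).toRingHom) =
    pullback.fst (torusProdSnd K S).left (chartIncl K ω).left ≫ (torusProdFst K S).left :=
  (Category.assoc _ _ _).trans ((congrArg (torusProdChart K S ω ≫ ·)
    (specProdIso_hom_includeLeft K _ _)).trans (pullback.lift_fst _ _ _))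

lemma torusProdToSpec_includeRight (ω : S.Chart) :
    torusProdToSpec K ω ≫ Spec.map (CommRingCat.ofHom (Algebra.TensorProduct.includeRight :
      coordRing K ω.cone →ₐ[K] prodRing K ω.cone).toRingHom) =
    pullback.snd (torusProdSnd K S).left (chartIncl K ω).left :=
  (Category.assoc _ _ _).trans ((congrArg (torusProdChart K S ω ≫ ·)
    (specProdIso_hom_includeRight K _ _)).trans (pullback.lift_snd _ _ _))

/-- The morphism of `K`-schemes from `T × U_[σ, i]` to `Spec (K[M] ⊗ K[S_σ])`. -/
def torusProdOpenToSpec (ω : S.Chart) : torusProdOpen K ω ⟶ specOver K (prodRing K ω.cone) :=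
  Over.homMk (torusProdToSpec K ω)
    ((congrArg (torusProdToSpec K ω ≫ ·) (Over.w (specOver.map
      (Algebra.TensorProduct.includeLeft :
        AddMonoidAlgebra K (DualLattice N) →ₐ[K] prodRing K ω.cone))).symm).trans
    ((Category.assoc _ _ _).symm.trans ((congrArg (· ≫ (torus K N).hom)
      (torusProdToSpec_includeLeft K ω)).trans ((Category.assoc _ _ _).trans
        (congrArg (pullback.fst (torusProdSnd K S).left (chartIncl K ω).left ≫ ·)
          (Over.w (torusProdFst K S)))))))

lemma torusProdOpenIncl_fst (ω : S.Chart) :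
    torusProdOpenIncl K ω ≫ torusProdFst K S =
      torusProdOpenToSpec K ω ≫ specOver.map Algebra.TensorProduct.includeLeft := by
  ext1
  exact (torusProdToSpec_includeLeft K ω).symm

lemma torusProdOpenIncl_snd (ω : S.Chart) :
    torusProdOpenIncl K ω ≫ torusProdSnd K S =
      torusProdOpenToSpec K ω ≫ specOver.map Algebra.TensorProduct.includeRight ≫
        chartIncl K ω := by
  ext1
  exact pullback.condition.trans ((congrArg (· ≫ (chartIncl K ω).left)
    (torusProdToSpec_includeRight K ω)).symm.trans (Category.assoc _ _ _))

lemma torusProdOpenIncl_action (ω : S.Chart) :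
    torusProdOpenIncl K ω ≫ torusAction K S =
      torusProdOpenToSpec K ω ≫ specOver.map (coaction (K := K) ω.cone) ≫ chartIncl K ω := by
  ext1
  exact (torusAction_chart K S ω).trans ((congrArg (torusProdChart K S ω ≫ ·)
    (Category.assoc _ _ _)).trans (Category.assoc _ _ _).symm)

/-- The morphism of schemes from `Spec (K[M] ⊗ K[S_σ])` to `T × X(S)`. -/
def specToTorusProd (ω : S.Chart) :
    Spec (CommRingCat.of (prodRing K ω.cone)) ⟶ (torusProd K S).left :=
  pullback.lift (f := (torus K N).hom) (g := (toricPrevariety K S).hom)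
    (Spec.map (CommRingCat.ofHom (Algebra.TensorProduct.includeLeft :
        AddMonoidAlgebra K (DualLattice N) →ₐ[K] prodRing K ω.cone).toRingHom))
    ((specOver.map (Algebra.TensorProduct.includeRight :
        coordRing K ω.cone →ₐ[K] prodRing K ω.cone) ≫ chartIncl K ω).left)
    ((Over.w (specOver.map (Algebra.TensorProduct.includeLeft :
        AddMonoidAlgebra K (DualLattice N) →ₐ[K] prodRing K ω.cone))).trans (Over.w _).symm)

/-- The morphism of schemes from `Spec (K[M] ⊗ K[S_σ])` to `T × U_[σ, i]`. -/
def specToTorusProdOpen (ω : S.Chart) : Spec (CommRingCat.of (prodRing K ω.cone)) ⟶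
    pullback (torusProdSnd K S).left (chartIncl K ω).left :=
  pullback.lift (specToTorusProd K ω)
    (Spec.map (CommRingCat.ofHom (Algebra.TensorProduct.includeRight :
        coordRing K ω.cone →ₐ[K] prodRing K ω.cone).toRingHom))
    (pullback.lift_snd _ _ _)

lemma specToTorusProdOpen_chart (ω : S.Chart) :
    specToTorusProdOpen K ω ≫ torusProdChart K S ω =
      (specProdIso K (AddMonoidAlgebra K (DualLattice N)) (coordRing K ω.cone)).inv := by
  apply pullback.hom_ext
  · rw [Category.assoc, torusProdChart, pullback.lift_fst]
    refine ((Category.assoc _ _ _).symm.trans (congrArg (· ≫ (torusProdFst K S).left)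
      (pullback.lift_fst _ _ _))).trans ((pullback.lift_fst _ _ _).trans ?_)
    exact (specProdIso_inv_fst _ _).symm
  · rw [Category.assoc, torusProdChart, pullback.lift_snd]
    exact (pullback.lift_snd _ _ _).trans (specProdIso_inv_snd _ _).symm

lemma specToTorusProdOpen_toSpec (ω : S.Chart) :
    specToTorusProdOpen K ω ≫ torusProdToSpec K ω = 𝟙 _ := by
  rw [torusProdToSpec, ← Category.assoc, specToTorusProdOpen_chart, Iso.inv_hom_id]

/-- The section of `torusProdOpenToSpec`. -/
def specToTorusProdOver (ω : S.Chart) : specOver K (prodRing K ω.cone) ⟶ torusProdOpen K ω :=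
  Over.homMk (specToTorusProdOpen K ω)
    ((congrArg (specToTorusProdOpen K ω ≫ ·) (Over.w (torusProdOpenToSpec K ω)).symm).trans
      ((Category.assoc _ _ _).symm.trans ((congrArg (· ≫ (specOver K (prodRing K ω.cone)).hom)
        (specToTorusProdOpen_toSpec K ω)).trans (Category.id_comp _))))

lemma specToTorusProdOver_toSpec (ω : S.Chart) :
    specToTorusProdOver K ω ≫ torusProdOpenToSpec K ω = 𝟙 _ := by
  ext1
  exact specToTorusProdOpen_toSpec K ω

end TorusProd

/-! ### The quotient by the affinoid torus -/

section Quotient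

variable {K : Type u} [NormedField K] [IsUltrametricDist K] {N : Type u} [AddCommGroup N]
  {I : Type u} {S : FanSystem N I}

/-- Every point of `(T × X(S))^an` lies over a chart, where it is given by a seminorm on
`K[M] ⊗ K[S_σ]`. -/
lemma exists_prod_seminorm (z : Analytification (torusProd K S)) :
    ∃ (ω : S.Chart) (w : SeminormSpace K (prodRing K ω.cone)),
      Analytification.homeoSeminorm K _ (Analytification.map (torusProdFst K S) z) =
        w.comap Algebra.TensorProduct.includeLeft ∧
      Analytification.map (torusProdSnd K S) z =
        chartAn K ω (w.comap Algebra.TensorProduct.includeRight) ∧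
      Analytification.map (torusAction K S) z = chartAn K ω (w.comap (coaction (K := K) ω.cone)) := by
  obtain ⟨ω, p, hp⟩ := (torusProdCover K S).exists_eq z.pt
  have hz : z ∈ Set.range (Analytification.map (torusProdOpenIncl K ω)) := by
    rw [Analytification.range_map]
    exact ⟨p, hp⟩
  obtain ⟨y, rfl⟩ := hz
  refine ⟨ω, Analytification.homeoSeminorm K _ (Analytification.map (torusProdOpenToSpec K ω) y),
    ?_, ?_, ?_⟩
  · rw [← Analytification.map_comp, torusProdOpenIncl_fst, Analytification.map_comp,
      Analytification.homeoSeminorm_map]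
  · rw [← Analytification.map_comp, torusProdOpenIncl_snd, Analytification.map_comp,
      Analytification.map_comp, ← Analytification.homeoSeminorm_map, chartAn_homeoSeminorm]
  · rw [← Analytification.map_comp, torusProdOpenIncl_action, Analytification.map_comp,
      Analytification.map_comp, ← Analytification.homeoSeminorm_map, chartAn_homeoSeminorm]

/-- Every seminorm on `K[M] ⊗ K[S_σ]` gives a point of `(T × X(S))^an`. -/
lemma exists_point_of_prod_seminorm (ω : S.Chart) (w : SeminormSpace K (prodRing K ω.cone)) :
    ∃ z : Analytification (torusProd K S),
      Analytification.homeoSeminorm K _ (Analytification.map (torusProdFst K S) z) =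
        w.comap Algebra.TensorProduct.includeLeft ∧
      Analytification.map (torusProdSnd K S) z =
        chartAn K ω (w.comap Algebra.TensorProduct.includeRight) ∧
      Analytification.map (torusAction K S) z = chartAn K ω (w.comap (coaction (K := K) ω.cone)) := by
  -- A one-sided inverse of `torusProdOpenToSpec` suffices to compute all three structure maps on
  -- the point.
  have h : ∀ {Y : Over (Spec (CommRingCat.of K))} (g : torusProd K S ⟶ Y)
      (g' : specOver K (prodRing K ω.cone) ⟶ Y),
      torusProdOpenIncl K ω ≫ g = torusProdOpenToSpec K ω ≫ g' →
      (specToTorusProdOver K ω ≫ torusProdOpenIncl K ω) ≫ g = g' := fun g g' e => by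
    rw [Category.assoc, e, ← Category.assoc, specToTorusProdOver_toSpec, Category.id_comp]
  refine ⟨Analytification.map (specToTorusProdOver K ω ≫ torusProdOpenIncl K ω)
    ((Analytification.homeoSeminorm K _).symm w), ?_, ?_, ?_⟩
  · rw [← Analytification.map_comp, h _ _ (torusProdOpenIncl_fst K ω),
      Analytification.homeoSeminorm_map, Homeomorph.apply_symm_apply]
  · rw [← Analytification.map_comp, h _ _ (torusProdOpenIncl_snd K ω), Analytification.map_comp,
      Analytification.map_homeoSeminorm_symm]
    rfl
  · rw [← Analytification.map_comp, h _ _ (torusProdOpenIncl_action K ω),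
      Analytification.map_comp, Analytification.map_homeoSeminorm_symm]
    rfl

/-- The tropicalization is invariant under the action of the affinoid torus. -/
lemma tropMap_eq_of_affinoidTorus {z : Analytification (torusProd K S)}
    (hz : Analytification.map (torusProdFst K S) z ∈ affinoidTorus K N) :
    tropMap K S (Analytification.map (torusAction K S) z) =
      tropMap K S (Analytification.map (torusProdSnd K S) z) := by
  obtain ⟨ω, w, h₁, h₂, h₃⟩ := exists_prod_seminorm z
  rw [h₂, h₃, tropMap_chartAn, tropMap_chartAn]
  congr 1
  ext s
  refine congrArg negLog ?_
  -- This is the only use of `T°`: the torus factor of `χ^s ⊗ χ^s` has value `1`.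
  have hs : w.1 (AddMonoidAlgebra.single s.1 1 ⊗ₜ[K] 1) = 1 :=
    (congrArg (fun ν => ν.1 (AddMonoidAlgebra.single s.1 1)) h₁).symm.trans (hz s.1)
  have hc : coaction (K := K) ω.cone (AddMonoidAlgebra.single s (1 : K)) =
      (AddMonoidAlgebra.single s.1 1 ⊗ₜ[K] 1) * (1 ⊗ₜ[K] chi K s) := by
    rw [coaction, AddMonoidAlgebra.lift_single, one_smul, Algebra.TensorProduct.tmul_mul_tmul,
      mul_one, one_mul]
    rfl
  change w.1 (coaction (K := K) ω.cone (AddMonoidAlgebra.single s 1)) = w.1 (1 ⊗ₜ[K] chi K s)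
  rw [hc, w.2.mul, hs, one_mul]

variable (K) in
/-- The homomorphism `K[M] ⊗ A → A[M]`. -/
def tensorToMonoidAlgebra (M A : Type*) [AddCommMonoid M] [CommRing A] [Algebra K A] :
    AddMonoidAlgebra K M ⊗[K] A →ₐ[K] AddMonoidAlgebra A M :=
  Algebra.TensorProduct.productMap
    (AddMonoidAlgebra.lift K (AddMonoidAlgebra A M) M (AddMonoidAlgebra.of A M))
    ((Algebra.ofId A (AddMonoidAlgebra A M)).restrictScalars K)

omit [IsUltrametricDist K] in
lemma tensorToMonoidAlgebra_tmul {M A : Type*} [AddCommMonoid M] [CommRing A] [Algebra K A]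
    (m : M) (a : A) :
    tensorToMonoidAlgebra K M A (AddMonoidAlgebra.single m 1 ⊗ₜ[K] a) =
      AddMonoidAlgebra.single m a := by
  rw [tensorToMonoidAlgebra, Algebra.TensorProduct.productMap_apply_tmul,
    AddMonoidAlgebra.lift_single, one_smul]
  change AddMonoidAlgebra.single m (1 : A) * algebraMap A (AddMonoidAlgebra A M) a = _
  rw [mul_comm, ← Algebra.smul_def, AddMonoidAlgebra.smul_single, smul_eq_mul, mul_one]

-- Under the coaction the monomials of `f` land in distinct degrees of `A[M]`, so a Gauss seminorm
-- on `A[M]` sees them separately.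
omit [IsUltrametricDist K] in
lemma coeff_tensorToMonoidAlgebra_coaction (σ : PointedCone ℝ (RealSpace N)) (f : coordRing K σ)
    (s : dualMonoid σ) :
    (tensorToMonoidAlgebra K (DualLattice N) (coordRing K σ) (coaction (K := K) σ f)).coeff s.1 =
      AddMonoidAlgebra.single s (f.coeff s) := by
  classical
  induction f using AddMonoidAlgebra.induction_linear with
  | zero => simp
  | add f g hf hg =>
    rw [map_add, map_add, AddMonoidAlgebra.coeff_add, AddMonoidAlgebra.coeff_add,
      Finsupp.add_apply, Finsupp.add_apply, hf, hg, AddMonoidAlgebra.single_add]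
  | single t a =>
    have h1 : coaction (K := K) σ (AddMonoidAlgebra.single t a) =
        a • (AddMonoidAlgebra.single t.1 1 ⊗ₜ[K] chi K t) := by
      rw [coaction, AddMonoidAlgebra.lift_single]
      rfl
    rw [h1, map_smul, tensorToMonoidAlgebra_tmul, AddMonoidAlgebra.smul_single,
      AddMonoidAlgebra.coeff_single, AddMonoidAlgebra.coeff_single, Finsupp.single_apply,
      Finsupp.single_apply]
    by_cases h : t = s
    · rw [if_pos (congrArg Subtype.val h), if_pos h, h, AddMonoidAlgebra.smul_single, smul_eq_mul,
        mul_one]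
    · rw [if_neg (fun e => h (Subtype.ext e)), if_neg h, AddMonoidAlgebra.single_zero]

variable [Module.Free ℤ N] [Module.Finite ℤ N]

/-- A point and the Gauss point of its tropicalization lie in one orbit of the affinoid torus. -/
lemma exists_affinoidTorus_orbit (x : Analytification (toricPrevariety K S)) :
    ∃ z : Analytification (torusProd K S),
      Analytification.map (torusProdFst K S) z ∈ affinoidTorus K N ∧
      Analytification.map (torusAction K S) z = gaussSection K S (tropMap K S x) ∧
      Analytification.map (torusProdSnd K S) z = x := by
  obtain ⟨ω, ν, rfl⟩ := exists_chartAn_eq x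
  -- Coefficients in `K[S_σ]` are measured by `ν` and all characters of `T` get weight `1`: this is
  -- `ν` multiplied by the Gauss point of `T°`.
  have hG := ν.2.gauss (w := fun _ : DualLattice N => (1 : ℝ)) (fun _ => zero_le_one) rfl
    fun _ _ => (one_mul 1).symm
  let w : SeminormSpace K (prodRing K ω.cone) :=
    SeminormSpace.comap (tensorToMonoidAlgebra K (DualLattice N) (coordRing K ω.cone)) ⟨_, hG⟩
  have hw : ∀ m a, w.1 (AddMonoidAlgebra.single m 1 ⊗ₜ[K] a) = ν.1 a := fun m a => by
    change gauss ν.1 _ (tensorToMonoidAlgebra K _ _ _) = _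
    rw [tensorToMonoidAlgebra_tmul, gauss_single ν.2 fun _ => zero_le_one, mul_one]
  obtain ⟨z, h₁, h₂, h₃⟩ := exists_point_of_prod_seminorm ω w
  refine ⟨z, fun m => ?_, ?_, ?_⟩
  · refine (congrArg (fun ν => ν.1 (AddMonoidAlgebra.single m 1)) h₁).trans ?_
    exact (hw m 1).trans ν.2.one
  · rw [h₃, tropMap_chartAn, gaussSection_mk]
    congr 1
    -- The translated seminorm has the tropicalization of `ν`, so it lies below the Gauss point; it
    -- also dominates every monomial of `f`, which gives the reverse inequality.
    have ht : tropPoint (w.comap (coaction (K := K) ω.cone)) = tropPoint ν := by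
      ext s
      refine congrArg negLog (Eq.trans ?_ (hw s.1 (chi K s)))
      change w.1 (coaction (K := K) ω.cone _) = _
      rw [coaction, AddMonoidAlgebra.lift_single, one_smul]
      rfl
    refine Subtype.ext (funext fun f => le_antisymm ?_ ?_)
    · rw [← ht]
      exact (w.comap (coaction (K := K) ω.cone)).le_gaussPoint f
    · refine gauss_le ((w.comap (coaction (K := K) ω.cone)).2.nonneg f) fun s => ?_
      rw [← SeminormSpace.apply_single, ← coeff_tensorToMonoidAlgebra_coaction]
      refine le_trans (le_of_eq (mul_one _).symm) (le_gauss ν.2 (fun _ => (1 : ℝ)) _ s.1)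
  · rw [h₂]
    congr 1
    exact Subtype.ext (funext fun a => hw 0 a)

variable (K S) in
/-- The homeomorphism from the quotient by the affinoid torus to `X(S)^trop`. -/
def quotientHomeo : StackQuotientSpace K S ≃ₜ TropPrevariety S where
  toFun := Quot.lift (tropMap K S) (by
    rintro x y ⟨z, hz, rfl, rfl⟩
    exact tropMap_eq_of_affinoidTorus hz)
  invFun y := StackQuotientSpace.mk (gaussSection K S y)
  left_inv q := by
    induction q using Quot.inductionOn with
    | _ x => exact Quot.sound (exists_affinoidTorus_orbit x)
  right_inv := tropMap_gaussSection
  continuous_toFun := continuous_quot_lift _ continuous_tropMap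
  continuous_invFun := continuous_quot_mk.comp continuous_gaussSection

end Quotient

end ToricTrop

end

/-! ### The main theorem -/

theorem mainTheorem3 {K : Type u} [NormedField K] [IsUltrametricDist K]
    {N : Type u} [AddCommGroup N] [Module.Free ℤ N] [Module.Finite ℤ N]
    {I : Type u} [Finite I] (S : FanSystem N I) :
    ∃ trop : Analytification (toricPrevariety K S) → TropPrevariety S,
      -- (i) the tropicalization map exists, is unique, continuous and proper
      (IsTropicalization K S trop ∧ (∀ t, IsTropicalization K S t → t = trop) ∧
        Continuous trop ∧ IsProperMap trop ∧
        ∀ A : Set (TropPrevariety S), IsCompact A → T2Space A →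
          IsCompact (trop ⁻¹' A) ∧ T2Space (trop ⁻¹' A)) ∧
      -- (ii) functoriality for toric morphisms
      (∀ (N' : Type u) [AddCommGroup N'] [Module.Free ℤ N'] [Module.Finite ℤ N']
        (I' : Type u) [Finite I'] (S' : FanSystem N' I') (φ : S.Hom S')
        (trop' : Analytification (toricPrevariety K S') → TropPrevariety S'),
        IsTropicalization K S' trop' →
          ∀ x, trop' (Analytification.map (toricMorphism φ K) x) =
            TropPrevariety.map φ (trop x)) ∧
      -- (iii) the section and the strong deformation retraction onto the skeleton
      (∃ J : TropPrevariety S → Analytification (toricPrevariety K S),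
        IsGaussSection K S J ∧ Continuous J ∧ (∀ u, trop (J u) = u) ∧
        IsClosed (Set.range J) ∧ Topology.IsEmbedding J ∧
        ∃ H : unitInterval × Analytification (toricPrevariety K S) →
            Analytification (toricPrevariety K S),
          Continuous H ∧ (∀ x, H (0, x) = x) ∧ (∀ x, H (1, x) = J (trop x)) ∧
          ∀ s, ∀ x ∈ Set.range J, H (s, x) = x) ∧
      -- (iv) the stack quotient by the affinoid torus
      ∃ μ : StackQuotientSpace K S ≃ₜ TropPrevariety S,
        ∀ x, μ (StackQuotientSpace.mk x) = trop x := by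
  exact ⟨tropMap K S,
    ⟨isTropicalization_tropMap, fun _ ht => ht.eq_tropMap, continuous_tropMap, isProperMap_tropMap,
      fun A hA _ => ⟨isProperMap_tropMap.isCompact_preimage hA,
        t2Space_preimage continuous_tropMap isSeparatedMap_tropMap A⟩⟩,
    fun _ _ _ _ _ _ _ φ _ h x => h.map_toricMorphism φ x,
    ⟨gaussSection K S, isGaussSection_gaussSection, continuous_gaussSection, tropMap_gaussSection,
      isClosed_range_gaussSection, isEmbedding_gaussSection, toricFlow K S, continuous_toricFlow,
      toricFlow_zero, toricFlow_one, by
        rintro r _ ⟨y, rfl⟩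
        exact toricFlow_gaussSection r y⟩,
    quotientHomeo K S, fun _ => rfl⟩
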